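/- Let $k$ be a field and $Q,q\in k^\times$. **Hecke operators.** For $n\ge 1$ let $V_n$ be the vector space with basis $v_i$, $i\in\mathbb I_n$, where $\mathbb I_n=\{-r,\dots,-1,1,\dots,r\}$ for $n=2r$ and $\mathbb I_n=\{-r,\dots,r\}$ for $n=2r+1$. Define $R_q$ on $V_n\otimes V_n$ by $v_i\otimes v_j\mapsto q^{-1}v_i\otimes v_i$ if $i=j$, $v_j\otimes v_i$ if $i<j$, and $v_j\otimes v_i+(q^{-1}-q)v_i\otimes v_j$ if $i>j$; define $K_Q$ on $V_n$ by $v_i\mapsto Q^{-1}v_i$ if $i=0$, $v_{-i}$ if $i>0$, and $v_{-i}+(Q^{-1}-Q)v_i$ if $i<0$. On $V_n^{\otimes N}$ let $T_i$ ($1\le i\le N-1$) be $R_q$ in factors $i,i+1$ and let $T_0$ be $K_Q$ in the first factor. Let $S_q^A(n;e)$ be the algebra of endomorphisms of $V_n^{\otimes e}$ commuting with $T_1,\dots,T_{e-1}$. **$e$-Hecke algebras.** On $V_n^{\otimes de}$ let $T_{w_i}$ ($1\le i\le d-1$) be the product of the $T_j$ along a reduced expression of the permutation exchanging the $i$-th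 and $(i+1)$-st block of length $e$, and let $T_{w_0}=T_0(T_1T_0T_1)\cdots(T_{e-1}\cdots T_1T_0T_1\cdots T_{e-1})$. With $P_i$ the flip of the $i$-th and $(i+1)$-st factor of $(V_n^{\otimes e})^{\otimes d}$, both $P_iT_{w_i}$ and $T_{w_0}$ lie in $S_q^A(n;e)^{\otimes d}$. Hence for every $S_q^A(n;e)$-module $V$ one obtains operators on $V^{\otimes d}$: $T_{w_i}$ acts by the action of $P_iT_{w_i}$ followed by the flip of factors $i,i+1$, and $T_{w_0}$ by the action of the element $T_{w_0}$. Write $\mathrm{Hom}_{\mathcal H_q^A(d,e)}(V^{\otimes d},W^{\otimes d})$ for the linear maps commuting with $T_{w_1},\dots,T_{w_{d-1}}$, and $\mathrm{Hom}_{\mathcal H_{Q,q}^B(d,e)}(V^{\otimes d},W^{\otimes d})$ for those commuting with $T_{w_0},T_{w_1},\dots,T_{w_{d-1}}$. **Polynomial functors.** Let $\mathcal C^A_{d,e}$ (resp. $\mathcal C^B_{d,e}$) be the category whose objects are the finite-dimensional $S_q^A(n;e)$-modules for all $n\ge1$, with morphisms $V\to W$ the space $\mathrm{Hom}_{\mathcal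 H_q^A(d,e)}(V^{\otimes d},W^{\otimes d})$ (resp. $\mathrm{Hom}_{\mathcal H_{Q,q}^B(d,e)}(V^{\otimes d},W^{\otimes d})$). Let $\mathcal{AP}^{d,e}_q$ (resp. $\mathcal P^{d,e}_{Q,q}$) be the category of $k$-linear functors from $\mathcal C^A_{d,e}$ (resp. $\mathcal C^B_{d,e}$) to finite-dimensional $k$-vector spaces. $\mathrm{Id}\in\mathcal{AP}_q^{1,e}$ is the functor $V\mapsto V$, $x\mapsto x$. **Claim 1 (composition is well defined).** Let $d_1,d_2,e\ge 0$ be integers, $G\in\mathcal{AP}_q^{d_1,e}$, and let $V,W$ be finite-dimensional modules over $S_q^A(n;e)$, $S_q^A(m;e)$. (a) $S_q^A(n;d_1e)\subseteq S_q^A(n;e)^{\otimes d_1}$ acts on $V^{\otimes d_1}$ by maps in $\mathrm{Hom}_{\mathcal H_q^A(d_1,e)}(V^{\otimes d_1},V^{\otimes d_1})$; applying $G$ makes $G(V)$ an $S_q^A(n;d_1e)$-module. (b) Every $x\in\mathrm{Hom}_{\mathcal H^B_{Q,q}(d_1d_2,e)}(V^{\otimes d_1d_2},W^{\otimes d_1d_2})$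 is a sum of tensors $x_1\otimes\cdots\otimes x_{d_2}$ with $x_i\in\mathrm{Hom}_{\mathcal H_q^A(d_1,e)}(V^{\otimes d_1},W^{\otimes d_1})$, and $x_1\otimes\cdots\otimes x_{d_2}\mapsto G(x_1)\otimes\cdots\otimes G(x_{d_2})$ gives a well-defined linear map $$\Psi:\mathrm{Hom}_{\mathcal H^B_{Q,q}(d_1d_2,e)}(V^{\otimes d_1d_2},W^{\otimes d_1d_2})\to\mathrm{Hom}_{\mathcal H^B_{Q,q}(d_2,d_1e)}(G(V)^{\otimes d_2},G(W)^{\otimes d_2})$$ that respects identities and composition. For a morphism $g:G\to G'$ the maps $g_V^{\otimes d_2}$ lie in $\mathrm{Hom}_{\mathcal H^B_{Q,q}(d_2,d_1e)}(G(V)^{\otimes d_2},G'(V)^{\otimes d_2})$ and are compatible with $\Psi$. The same holds with type B replaced by type A. (c) Hence, for $F\in\mathcal P^{d_2,d_1e}_{Q,q}$ (resp. $F\in\mathcal{AP}^{d_2,d_1e}_q$), $(F\circ G)(V)=F(G(V))$, $(F\circ G)(x)=F(\Psi(x))$ defines an object $F\circ G$ of $\mathcal P^{d_1d_2,e}_{Q,q}$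 (resp. $\mathcal{AP}^{d_1d_2,e}_q$), functorial in $F$ and $G$. Moreover $(F\circ G)\circ K\cong F\circ(G\circ K)$, $F\circ\mathrm{Id}\cong F$ and $\mathrm{Id}\circ G\cong G$, whenever the degrees match. **Claim 2 (action pair).** Let $\mathcal{EP}_{Q,q}=\bigoplus_{d,e\ge1}\mathcal P^{d,e}_{Q,q}$, i.e. the category of families $(F_{d,e})_{d,e\geq 1}$, $F_{d,e}\in\mathcal P^{d,e}_{Q,q}$, only finitely many of which are nonzero. Let $\mathcal{AEP}_q$ be the category of families $(G_{d,e})_{d,e\ge1}$, $G_{d,e}\in\mathcal{AP}_q^{d,e}$, such that for each $e$ there is at most one $d$ with $G_{d,e}\ne0$ (morphisms are families of morphisms in both cases). Extend composition by letting $F_{a,b}\circ G_{d,e}$ be $0$ if $b\ne de$, i.e. $$(F\circ G)_{c,e}=\bigoplus_{ad=c}F_{a,de}\circ G_{d,e}.$$ This defines functors $\mathcal{AEP}_q\times\mathcal{AEP}_q\to\mathcal{AEP}_q$ and $\mathcal{EP}_{Q,q}\times\mathcal{AEP}_q\to\mathcal{EP}_{Q,q}$. The first one is the tensor product of a monoidal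 category structure on $\mathcal{AEP}_q$ with unit object the family of all $\mathrm{Id}\in\mathcal{AP}_q^{1,e}$, $e\ge1$; and the second one is a right action of this monoidal category on $\mathcal{EP}_{Q,q}$, that is, there are natural isomorphisms $F\circ(G\circ G')\cong(F\circ G)\circ G'$ and $F\circ\mathrm{Id}\cong F$ that satisfy the pentagon and triangle identities. So $(\mathcal{EP}_{Q,q},\mathcal{AEP}_q)$ is an action pair. -/

import Mathlib

open CategoryTheory

universe u

noncomputable section

namespace QPoly

/-! ### Tensor powers of finite-dimensional vector spaces -/

section Tensor

variable (k : Type u) [Field k]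

/-- The tensor power `M^{⊗d}`. -/
abbrev TPow (M : Type u) [AddCommGroup M] [Module k M] (d : ℕ) : Type u :=
  PiTensorProduct k (fun _ : Fin d => M)

variable {k} {M N M' N' : Type u} [AddCommGroup M] [Module k M] [AddCommGroup N] [Module k N]
  [AddCommGroup M'] [Module k M'] [AddCommGroup N'] [Module k N']

/-- For a subspace `U ⊆ Hom(M, N)`, the canonical map `U^{⊗d} → Hom(M^{⊗d}, N^{⊗d})`,
`u₁ ⊗ ⋯ ⊗ u_d ↦ (m₁ ⊗ ⋯ ⊗ m_d ↦ u₁ m₁ ⊗ ⋯ ⊗ u_d m_d)`. -/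
def ofTensors (U : Submodule k (M →ₗ[k] N)) (d : ℕ) :
    TPow k U d →ₗ[k] (TPow k M d →ₗ[k] TPow k N d) :=
  PiTensorProduct.piTensorHomMap ∘ₗ PiTensorProduct.map (fun _ => U.subtype)

/-- `x : M^{⊗d} → N^{⊗d}` lies in `U^{⊗d}`, i.e. is a linear combination of maps
`u₁ ⊗ ⋯ ⊗ u_d` with all `uᵢ ∈ U`. -/
def IsTensor (U : Submodule k (M →ₗ[k] N)) (d : ℕ) (x : TPow k M d →ₗ[k] TPow k N d) : Prop :=
  x ∈ LinearMap.range (ofTensors U d)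

theorem piTensorHomMap_injective [FiniteDimensional k M] [FiniteDimensional k N] (d : ℕ) :
    Function.Injective
      (PiTensorProduct.piTensorHomMap : TPow k (M →ₗ[k] N) d →ₗ[k] _ →ₗ[k] TPow k N d) := by
  classical
  let bM := Module.finBasis k M
  let bN := Module.finBasis k N
  let bH := bM.linearMap bN
  have key : ∀ (t : TPow k (M →ₗ[k] N) d) (p : Fin d → _ × _),
      (Basis.piTensorProduct (fun _ : Fin d => bH)).repr t p =
      (Basis.piTensorProduct (fun _ : Fin d => bN)).repr
        (PiTensorProduct.piTensorHomMap t (PiTensorProduct.tprod k fun i => bM (p i).2))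
        (fun i => (p i).1) := by
    intro t p
    induction t using PiTensorProduct.induction_on with
    | smul_tprod r f =>
      simp only [map_smul, LinearMap.smul_apply, PiTensorProduct.piTensorHomMap_tprod_tprod,
        Finsupp.smul_apply, Basis.piTensorProduct_repr_tprod_apply]
      congr 1
      refine Finset.prod_congr rfl fun i _ => ?_
      rw [← LinearMap.toMatrix_apply bM bN]
      rfl
    | add x y hx hy => simp [map_add, hx, hy]
  intro s t hst
  refine (Basis.piTensorProduct (fun _ : Fin d => bH)).ext_elem fun p => ?_
  rw [key, key, hst]

theorem ofTensors_injective [FiniteDimensional k M] [FiniteDimensional k N]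
    (U : Submodule k (M →ₗ[k] N)) (d : ℕ) : Function.Injective (ofTensors U d) := by
  obtain ⟨p, hp⟩ := U.subtype.exists_leftInverse_of_injective (by simp)
  have h : Function.Injective
      (PiTensorProduct.map (fun _ : Fin d => U.subtype) : TPow k U d →ₗ[k] _) := by
    refine Function.LeftInverse.injective
      (g := (PiTensorProduct.map (fun _ : Fin d => p))) fun t => ?_
    rw [← LinearMap.comp_apply, ← PiTensorProduct.map_comp, hp, PiTensorProduct.map_id]
    rfl
  exact (piTensorHomMap_injective d).comp h

theorem exists_tensorExt [FiniteDimensional k M] [FiniteDimensional k N]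
    (U : Submodule k (M →ₗ[k] N)) (φ : U →ₗ[k] (M' →ₗ[k] N')) (d : ℕ) :
    ∃ L : (TPow k M d →ₗ[k] TPow k N d) →ₗ[k] (TPow k M' d →ₗ[k] TPow k N' d),
      L ∘ₗ ofTensors U d =
        PiTensorProduct.piTensorHomMap ∘ₗ PiTensorProduct.map (fun _ => φ) := by
  obtain ⟨r, hr⟩ := LinearMap.exists_leftInverse_of_injective (K := k) (V := TPow k U d)
    (V' := TPow k M d →ₗ[k] TPow k N d) (ofTensors U d)
    (LinearMap.ker_eq_bot_of_injective (ofTensors_injective U d))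
  refine ⟨(PiTensorProduct.piTensorHomMap ∘ₗ PiTensorProduct.map (fun _ => φ)) ∘ₗ r, ?_⟩
  rw [LinearMap.comp_assoc, hr, LinearMap.comp_id]

/-- Given a linear map `φ : U → Hom(M', N')` on a subspace `U ⊆ Hom(M, N)`, the linear map
`φ^{⊗d}` sending `u₁ ⊗ ⋯ ⊗ u_d ∈ U^{⊗d} ⊆ Hom(M^{⊗d}, N^{⊗d})` to
`φ u₁ ⊗ ⋯ ⊗ φ u_d ∈ Hom(M'^{⊗d}, N'^{⊗d})`. By `tensorExt_ofTensors` its values on the subspace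
`U^{⊗d}` are determined by this formula; it is only ever evaluated on that subspace, and its
(arbitrary) linear extension to all of `Hom(M^{⊗d}, N^{⊗d})` plays no role. -/
def tensorExt [FiniteDimensional k M] [FiniteDimensional k N]
    (U : Submodule k (M →ₗ[k] N)) (φ : U →ₗ[k] (M' →ₗ[k] N')) (d : ℕ) :
    (TPow k M d →ₗ[k] TPow k N d) →ₗ[k] (TPow k M' d →ₗ[k] TPow k N' d) :=
  Classical.choose (exists_tensorExt U φ d)

theorem tensorExt_ofTensors [FiniteDimensional k M] [FiniteDimensional k N]
    (U : Submodule k (M →ₗ[k] N)) (φ : U →ₗ[k] (M' →ₗ[k] N')) (d : ℕ) (t : TPow k U d) :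
    tensorExt U φ d (ofTensors U d t) =
      PiTensorProduct.piTensorHomMap (PiTensorProduct.map (fun _ => φ) t) :=
  LinearMap.congr_fun (Classical.choose_spec (exists_tensorExt U φ d)) t

/-- Positions in a word of length `c = a * d`, cut into `a` consecutive blocks of length `d`. -/
def blockIdx {c a d : ℕ} (h : c = a * d) : Fin a × Fin d ≃ Fin c :=
  finProdFinEquiv.trans (finCongr h.symm)

variable (k M) in
/-- The identification `M^{⊗ad} = (M^{⊗d})^{⊗a}`; see `regroup_tprod`. -/
def regroup {c a d : ℕ} (h : c = a * d) : TPow k M c ≃ₗ[k] TPow k (TPow k M d) a :=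
  (Basis.piTensorProduct (fun _ : Fin c => Module.Free.chooseBasis k M)).equiv
    (Basis.piTensorProduct (fun _ : Fin a =>
      Basis.piTensorProduct (fun _ : Fin d => Module.Free.chooseBasis k M)))
    ((Equiv.arrowCongr (blockIdx h).symm (Equiv.refl _)).trans (Equiv.curry _ _ _))

theorem regroup_tprod {c a d : ℕ} (h : c = a * d) (v : Fin c → M) :
    regroup k M h (PiTensorProduct.tprod k v) =
      PiTensorProduct.tprod k fun i => PiTensorProduct.tprod k fun j => v (blockIdx h (i, j)) := by
  refine (Basis.piTensorProduct (fun _ : Fin a => Basis.piTensorProduct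
    (fun _ : Fin d => Module.Free.chooseBasis k M))).ext_elem fun p => ?_
  have hr : ∀ x, (Basis.piTensorProduct (fun _ : Fin a => Basis.piTensorProduct
      (fun _ : Fin d => Module.Free.chooseBasis k M))).repr (regroup k M h x) p =
      (Basis.piTensorProduct (fun _ : Fin c => Module.Free.chooseBasis k M)).repr x
        (fun l => p ((blockIdx h).symm l).1 ((blockIdx h).symm l).2) := by
    intro x
    rw [regroup, Module.Basis.equiv, LinearEquiv.trans_apply]
    set e' := ((Equiv.arrowCongr (blockIdx h).symm
      (Equiv.refl (Module.Free.ChooseBasisIndex k M))).trans (Equiv.curry _ _ _)).symm with he'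
    conv_lhs => rw [← e'.symm_apply_apply p, ← Module.Basis.repr_reindex_apply,
      LinearEquiv.apply_symm_apply]
    rfl
  rw [hr]
  simp only [Basis.piTensorProduct_repr_tprod_apply]
  rw [← (blockIdx h).prod_comp, Fintype.prod_prod_type]
  simp

/-- Conjugation with `regroup`: a map `M^{⊗ad} → N^{⊗ad}` seen as a map
`(M^{⊗d})^{⊗a} → (N^{⊗d})^{⊗a}`. -/
def regroupHom {c a d : ℕ} (h : c = a * d) :
    (TPow k M c →ₗ[k] TPow k N c) ≃ₗ[k]
      (TPow k (TPow k M d) a →ₗ[k] TPow k (TPow k N d) a) :=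
  (regroup k M h).arrowCongr (regroup k N h)

end Tensor
/-! ### The tensor space `V_n^{⊗N}` and the action of the Hecke generators

`V_n` has basis `v_i`, `i ∈ 𝕀_n`. We index the basis by `Fin n`, identified with `𝕀_n` by the
order-preserving bijection; under it `i ↦ -i` becomes `Fin.rev`, and `i = 0`, `i > 0`, `i < 0` become
`i.rev = i`, `i.rev < i`, `i < i.rev`. -/

section Hecke

variable {k : Type u} [Field k] {n N : ℕ}

variable (k n N) in
/-- The tensor space `V_n^{⊗N}`. -/
abbrev VTensor : Type u := TPow k (Fin n → k) N

variable (k) in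
/-- The basis vector `v_a = v_{a_1} ⊗ ⋯ ⊗ v_{a_N}`. -/
def vBasis : Module.Basis (Fin N → Fin n) k (VTensor k n N) :=
  Basis.piTensorProduct (fun _ : Fin N => Pi.basisFun k (Fin n))

/-- The matrix `R_q` acting in positions `i`, `j` of `V_n^{⊗N}`. -/
def opR (q : kˣ) (i j : Fin N) : Module.End k (VTensor k n N) :=
  (vBasis k).constr k fun a =>
    if a i = a j then (↑q⁻¹ : k) • vBasis k a
    else if a i < a j then vBasis k (a ∘ Equiv.swap i j)
    else vBasis k (a ∘ Equiv.swap i j) + ((↑q⁻¹ : k) - q) • vBasis k a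

/-- The matrix `K_Q` acting in position `i` of `V_n^{⊗N}`. -/
def opK (Q : kˣ) (i : Fin N) : Module.End k (VTensor k n N) :=
  (vBasis k).constr k fun a =>
    if (a i).rev = a i then (↑Q⁻¹ : k) • vBasis k a
    else if (a i).rev < a i then vBasis k (Function.update a i (a i).rev)
    else vBasis k (Function.update a i (a i).rev) + ((↑Q⁻¹ : k) - Q) • vBasis k a

variable (n N) in
/-- The action of the Hecke generator `T_i`, `1 ≤ i ≤ N - 1`, on `V_n^{⊗N}`: the matrix `R_q` in the
`i`-th and `(i+1)`-st tensor factor (`Fin N` counts from `0`). The identity for other `i`. -/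
def opT (q : kˣ) (i : ℕ) : Module.End k (VTensor k n N) :=
  if h : 1 ≤ i ∧ i < N then opR q ⟨i - 1, by omega⟩ ⟨i, h.2⟩ else 1

variable (n N) in
/-- The action of the Hecke generator `T_0` on `V_n^{⊗N}`: the matrix `K_Q` in the first tensor
factor. The identity if there is no tensor factor. -/
def opT0 (Q : kˣ) : Module.End k (VTensor k n N) :=
  if h : 0 < N then opK Q ⟨0, h⟩ else 1

variable (k n) in
/-- The `q`-Schur algebra `S_q^A(n;e)`: the endomorphisms of `V_n^{⊗e}` commuting with the action
of the type A Hecke algebra, i.e. of `T_1, …, T_{e-1}`. -/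
def schur (q : kˣ) (e : ℕ) : Subalgebra k (Module.End k (VTensor k n e)) :=
  Subalgebra.centralizer k (Set.range (opT n e q))

/-- `T_m T_{m+1} ⋯ T_{m+e-1}`. -/
def opCol (q : kˣ) (e m : ℕ) : Module.End k (VTensor k n N) :=
  ((List.range e).map fun l => opT n N q (m + l)).prod

variable (n N) in
/-- The action on `V_n^{⊗de}` of `T_{w_i}`, `1 ≤ i ≤ d - 1`, where `w_i` is the permutation that
exchanges the `i`-th and the `(i+1)`-st block of length `e`. It is given by the reduced expression
`(s_{ei} ⋯ s_{ei+e-1}) (s_{ei-1} ⋯ s_{ei+e-2}) ⋯ (s_{e(i-1)+1} ⋯ s_{ei})`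
(since `w_i` is an involution, left and right action of `T_{w_i}` are the same operator). -/
def opTw (q : kˣ) (e i : ℕ) : Module.End k (VTensor k n N) :=
  ((List.range e).map fun j => opCol q e (e * i - j)).prod

variable (n N) in
/-- `T_i ⋯ T_1 T_0 T_1 ⋯ T_i` on `V_n^{⊗N}`. -/
def opJM (Q q : kˣ) : ℕ → Module.End k (VTensor k n N)
  | 0 => opT0 n N Q
  | i + 1 => opT n N q (i + 1) * opJM Q q i * opT n N q (i + 1)

variable (n N) in
/-- The action on `V_n^{⊗de}` of `T_{w_0}`, where
`w_0 = s_0 (s_1 s_0 s_1) ⋯ (s_{e-1} ⋯ s_1 s_0 s_1 ⋯ s_{e-1})`. -/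
def opTw0 (Q q : kˣ) (e : ℕ) : Module.End k (VTensor k n N) :=
  ((List.range e).map (opJM n N Q q)).prod

end Hecke

/-! ### `e`-Hecke triples and the action of the `e`-Hecke algebras -/

section Triples

variable (k : Type u) [Field k]

/-- A finite-dimensional module over `S_q^A(n;e)` for some `n ≥ 1` (a degree `e` representation of
`U_q(𝔤𝔩_n)`). -/
structure EMod (q : kˣ) (e : ℕ) where
  n : ℕ
  n_pos : 0 < n
  carrier : Type u
  [addCommGroup : AddCommGroup carrier]
  [module : Module k carrier]
  [finite : FiniteDimensional k carrier]
  ρ : schur k n q e →ₐ[k] Module.End k carrier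

attribute [instance] EMod.addCommGroup EMod.module EMod.finite

variable {k} {q : kˣ} {e : ℕ}

namespace EMod

variable (V W : EMod k q e)

/-- `S_q^A(n;e)^{⊗d} ⊆ End((V_n^{⊗e})^{⊗d})` acts on `V^{⊗d}` when `V` is an `S_q^A(n;e)`-module.
The operators on `V_n^{⊗N}`, `N = de`, are regarded as operators on `(V_n^{⊗e})^{⊗d}`. -/
def tensorRep (d : ℕ) :
    Module.End k (TPow k (VTensor k V.n e) d) →ₗ[k] Module.End k (TPow k V.carrier d) :=
  tensorExt (Subalgebra.toSubmodule (schur k V.n q e)) V.ρ.toLinearMap d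

/-- The permutation of the tensor factors `i` and `i + 1` of `M^{⊗d}` (counted from `1`; the
identity unless `1 ≤ i ≤ d - 1`). -/
def flip (M : Type u) [AddCommGroup M] [Module k M] (d i : ℕ) : Module.End k (TPow k M d) :=
  if h : 1 ≤ i ∧ i < d then
    (PiTensorProduct.reindex k (fun _ : Fin d => M)
      (Equiv.swap ⟨i - 1, by omega⟩ ⟨i, h.2⟩)).toLinearMap
  else 1

/-- `(P ⊗ 1) T_{w_i}` on `(V_n^{⊗e})^{⊗d}`, where `P` is the flip of the `i`-th and `(i+1)`-st
factor: the universal `R`-matrix of the `i`-th and `(i+1)`-st factor, an element of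
`S_q^A(n;e)^{⊗d}`. -/
def universalR (k : Type u) [Field k] (q : kˣ) (n e d i : ℕ) :
    Module.End k (TPow k (VTensor k n e) d) :=
  flip (VTensor k n e) d i * regroupHom rfl (opTw n (d * e) q e i)

/-- `T_{w_0}` on `(V_n^{⊗e})^{⊗d}`: the universal `K`-matrix in the first factor, an element of
`S_q^A(n;e)^{⊗d}`. -/
def universalK (k : Type u) [Field k] (Q q : kˣ) (n e d : ℕ) :
    Module.End k (TPow k (VTensor k n e) d) :=
  regroupHom rfl (opTw0 n (d * e) Q q e)

/-- The operator `(R_V)_{i,i+1}` on `V^{⊗d}`, by which `T_{w_i}` (`1 ≤ i ≤ d - 1`) acts: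
the universal `R`-matrix followed by the flip. For `V = V_n^{⊗e}` it is `T_{w_i}` itself. -/
def opRV (d i : ℕ) : Module.End k (TPow k V.carrier d) :=
  flip V.carrier d i * V.tensorRep d (universalR k q V.n e d i)

/-- The operator `(K_V)_1` on `V^{⊗d}`, by which `T_{w_0}` acts. -/
def opKV (Q : kˣ) (d : ℕ) : Module.End k (TPow k V.carrier d) :=
  V.tensorRep d (universalK k Q q V.n e d)

/-- The space `Hom_H(V^{⊗d}, W^{⊗d})`, where `H` is the type A `e`-Hecke algebra `H_q^A(d,e)` if
`τ = none`, and the type B `e`-Hecke algebra `H_{Q,q}^B(d,e)` if `τ = some Q`: the linear maps that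
commute with the action of the generators `T_{w_i}` of `H`. -/
def homSpace (τ : Option kˣ) (d : ℕ) :
    Submodule k (TPow k V.carrier d →ₗ[k] TPow k W.carrier d) where
  carrier := {x | (∀ i, 1 ≤ i → i < d → x ∘ₗ V.opRV d i = W.opRV d i ∘ₗ x) ∧
    ∀ Q ∈ τ, x ∘ₗ V.opKV Q d = W.opKV Q d ∘ₗ x}
  add_mem' hx hy := ⟨fun i h1 h2 => by
      rw [LinearMap.add_comp, LinearMap.comp_add, hx.1 i h1 h2, hy.1 i h1 h2],
    fun Q hQ => by rw [LinearMap.add_comp, LinearMap.comp_add, hx.2 Q hQ, hy.2 Q hQ]⟩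
  zero_mem' := ⟨fun i _ _ => by rw [LinearMap.zero_comp, LinearMap.comp_zero],
    fun Q _ => by rw [LinearMap.zero_comp, LinearMap.comp_zero]⟩
  smul_mem' r x hx := ⟨fun i h1 h2 => by
      rw [LinearMap.smul_comp, LinearMap.comp_smul, hx.1 i h1 h2],
    fun Q hQ => by rw [LinearMap.smul_comp, LinearMap.comp_smul, hx.2 Q hQ]⟩

variable {V W}

theorem id_mem_homSpace (τ : Option kˣ) (d : ℕ) : LinearMap.id ∈ homSpace V V τ d :=
  ⟨fun _ _ _ => rfl, fun _ _ => rfl⟩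

theorem comp_mem_homSpace {X : EMod k q e} {τ : Option kˣ} {d : ℕ}
    {y : TPow k W.carrier d →ₗ[k] TPow k X.carrier d}
    {x : TPow k V.carrier d →ₗ[k] TPow k W.carrier d}
    (hy : y ∈ homSpace W X τ d) (hx : x ∈ homSpace V W τ d) : y ∘ₗ x ∈ homSpace V X τ d :=
  ⟨fun i h1 h2 => by
      rw [LinearMap.comp_assoc, hx.1 i h1 h2, ← LinearMap.comp_assoc, hy.1 i h1 h2,
        LinearMap.comp_assoc],
    fun Q hQ => by
      rw [LinearMap.comp_assoc, hx.2 Q hQ, ← LinearMap.comp_assoc, hy.2 Q hQ,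
        LinearMap.comp_assoc]⟩

end EMod

end Triples

/-! ### The categories `C_{d,e}` and their representations -/

section Categories

variable (k : Type u) [Field k]

/-- The objects of the category `C^A_{d,e}` (`τ = none`), respectively `C^B_{d,e}` with parameters
`Q, q` (`τ = some Q`). -/
structure DivCat (τ : Option kˣ) (q : kˣ) (d e : ℕ) where
  toEMod : EMod k q e

variable {k} {τ : Option kˣ} {q : kˣ} {d e : ℕ}

instance : Category (DivCat k τ q d e) where
  Hom V W := EMod.homSpace V.toEMod W.toEMod τ d
  id _ := ⟨LinearMap.id, EMod.id_mem_homSpace τ d⟩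
  comp x y := ⟨y.1 ∘ₗ x.1, EMod.comp_mem_homSpace y.2 x.2⟩

instance : Preadditive (DivCat k τ q d e) where
  homGroup V W := inferInstanceAs (AddCommGroup (EMod.homSpace V.toEMod W.toEMod τ d))
  add_comp _ _ _ x y z := Subtype.ext (LinearMap.comp_add x.1 y.1 z.1)
  comp_add _ _ _ x y z := Subtype.ext (LinearMap.add_comp x.1 z.1 y.1)

instance : Linear k (DivCat k τ q d e) where
  homModule V W := inferInstanceAs (Module k (EMod.homSpace V.toEMod W.toEMod τ d))
  smul_comp _ _ _ r x y := Subtype.ext (LinearMap.comp_smul y.1 r x.1)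
  comp_smul _ _ _ x r y := Subtype.ext (LinearMap.smul_comp r y.1 x.1)

variable (k) in
/-- `mod_Λ`: the category of `k`-linear functors from `Λ` to finite-dimensional vector spaces. -/
abbrev ModCat (Λ : Type*) [Category Λ] [Preadditive Λ] [Linear k Λ] :=
  ObjectProperty.FullSubcategory
    (fun F : Λ ⥤ FGModuleCat.{u} k => F.Additive ∧ F.Linear k)

variable (k τ q d e) in
/-- The category of quantum polynomial functors `AP_q^{d,e}` (for `τ = none`), respectively
`P_{Q,q}^{d,e}` (for `τ = some Q`). -/
abbrev Pol := ModCat k (DivCat k τ q d e)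

end Categories

/-! ### Composition of homogeneous polynomial functors -/

section Composition

variable {k : Type u} [Field k] {τ : Option kˣ} {q : kˣ}

/-- The value `F(V)`. -/
abbrev ev {d e : ℕ} (F : Pol k τ q d e) (V : EMod k q e) : FGModuleCat.{u} k := F.obj.obj ⟨V⟩

/-- The linear map `F : Hom_H(V^{⊗d}, W^{⊗d}) → Hom_k(F(V), F(W))`. -/
def evHom {d e : ℕ} (F : Pol k τ q d e) (V W : EMod k q e) :
    EMod.homSpace V W τ d →ₗ[k] (ev F V →ₗ[k] ev F W) where
  toFun x := (F.obj.map (X := ⟨V⟩) (Y := ⟨W⟩) x).hom.hom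
  map_add' x y := by
    have := F.property.1
    exact congrArg (fun f => f.hom.hom) (F.obj.map_add (X := ⟨V⟩) (Y := ⟨W⟩) (f := x) (g := y))
  map_smul' r x := by
    have := F.property.1
    have := F.property.2
    exact congrArg (fun f => f.hom.hom) (F.obj.map_smul (X := ⟨V⟩) (Y := ⟨W⟩) r x)

/-- The component `F(V) → F'(V)` of a morphism `f : F → F'`. -/
def evApp {d e : ℕ} {F F' : Pol k τ q d e} (f : F ⟶ F') (V : EMod k q e) :
    ev F V →ₗ[k] ev F' V :=
  (f.hom.app ⟨V⟩).hom.hom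

/-- For an `S_q^A(n;e)`-module `V` and an operator `s` on `V_n^{⊗N}`, `N = de`, that lies in
`S_q^A(n;N) ⊆ S_q^A(n;e)^{⊗d}`: the action of `s` on `V^{⊗d}`. -/
def inducedOp {N d e : ℕ} (hN : N = d * e) (V : EMod k q e) :
    Module.End k (VTensor k V.n N) →ₗ[k] Module.End k (TPow k V.carrier d) :=
  V.tensorRep d ∘ₗ (regroupHom hN).toLinearMap

variable (k q) in
/-- The statement that the constructions involving `R`-matrices, `K`-matrices and the action of
`S_q^A(n;de)` on `V^{⊗d}` are well defined: the universal `R`- and `K`-matrices lie in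
`S_q^A(n;e)^{⊗d}`, one has `S_q^A(n;de) ⊆ S_q^A(n;e)^{⊗d}`, and for every `S_q^A(n;e)`-module `V`
this makes `V^{⊗d}` an `S_q^A(n;de)`-module on which `S_q^A(n;de)` acts by endomorphisms that commute
with the action of `H_q^A(d,e)`. -/
structure InducedActionWellDefined : Prop where
  universalR_mem : ∀ n e d i : ℕ, 0 < n → 1 ≤ i → i < d →
    IsTensor (Subalgebra.toSubmodule (schur k n q e)) d (EMod.universalR k q n e d i)
  universalK_mem : ∀ (Q : kˣ) (n e d : ℕ), 0 < n →
    IsTensor (Subalgebra.toSubmodule (schur k n q e)) d (EMod.universalK k Q q n e d)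
  schur_mem : ∀ {N d e : ℕ} (hN : N = d * e) (n : ℕ), 0 < n → ∀ s ∈ schur k n q N,
    IsTensor (Subalgebra.toSubmodule (schur k n q e)) d (regroupHom hN s)
  inducedOp_mem : ∀ {N d e : ℕ} (hN : N = d * e) (V : EMod k q e), ∀ s ∈ schur k V.n q N,
    inducedOp hN V s ∈ EMod.homSpace V V none d
  inducedOp_one : ∀ {N d e : ℕ} (hN : N = d * e) (V : EMod k q e), inducedOp hN V 1 = 1
  inducedOp_mul : ∀ {N d e : ℕ} (hN : N = d * e) (V : EMod k q e),
    ∀ s ∈ schur k V.n q N, ∀ t ∈ schur k V.n q N,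
      inducedOp hN V (s * t) = inducedOp hN V s * inducedOp hN V t

/-- For `G ∈ AP_q^{d,e}` and an `S_q^A(n;e)`-module `V`, the `S_q^A(n;de)`-module `G(V)`:
`s ∈ S_q^A(n;de)` acts by `G` applied to the action of `s` on `V^{⊗d}`. -/
def act (h : InducedActionWellDefined k q) {N d e : ℕ} (hN : N = d * e)
    (G : Pol k none q d e) (V : EMod k q e) : EMod k q N where
  n := V.n
  n_pos := V.n_pos
  carrier := ev G V
  ρ := AlgHom.ofLinearMap
    (evHom G V V ∘ₗ
      ((inducedOp hN V ∘ₗ (Subalgebra.toSubmodule (schur k V.n q N)).subtype).codRestrict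
        (EMod.homSpace V V none d) fun s => h.inducedOp_mem hN V s.1 s.2))
    (by
      have : evHom G V V ⟨LinearMap.id, EMod.id_mem_homSpace none d⟩ = LinearMap.id :=
        congrArg (fun f => f.hom.hom) (G.obj.map_id ⟨V⟩)
      refine Eq.trans (congrArg (evHom G V V) (Subtype.ext ?_)) this
      exact h.inducedOp_one hN V)
    (fun s t => by
      have : ∀ x y : EMod.homSpace V V none d,
          evHom G V V ⟨x.1 ∘ₗ y.1, EMod.comp_mem_homSpace x.2 y.2⟩ =
            evHom G V V x ∘ₗ evHom G V V y := fun x y =>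
        congrArg (fun f => f.hom.hom) (G.obj.map_comp (X := ⟨V⟩) (Y := ⟨V⟩) (Z := ⟨V⟩) y x)
      refine Eq.trans (congrArg (evHom G V V) (Subtype.ext ?_)) (this _ _)
      exact h.inducedOp_mul hN V s.1 s.2 t.1 t.2)

/-- The map `Ψ`, `x_1 ⊗ ⋯ ⊗ x_a ↦ G(x_1) ⊗ ⋯ ⊗ G(x_a)`, from maps `V^{⊗ad} → W^{⊗ad}` (in the
subspace `Hom_{H_q^A(d,e)}(V^{⊗d}, W^{⊗d})^{⊗a}`) to maps `G(V)^{⊗a} → G(W)^{⊗a}`. -/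
def psi {c a d e : ℕ} (hc : c = a * d) (G : Pol k none q d e) (V W : EMod k q e) :
    (TPow k V.carrier c →ₗ[k] TPow k W.carrier c) →ₗ[k]
      (TPow k (ev G V) a →ₗ[k] TPow k (ev G W) a) :=
  tensorExt (EMod.homSpace V W none d) (evHom G V W) a ∘ₗ (regroupHom hc).toLinearMap

/-- The statement that composition is well defined: for `G ∈ AP_q^{d,e}`, every
`x ∈ Hom_{H(ad,e)}(V^{⊗ad}, W^{⊗ad})` can be written as a sum of `x_1 ⊗ ⋯ ⊗ x_a` with
`x_i ∈ Hom_{H_q^A(d,e)}(V^{⊗d}, W^{⊗d})`, the map `Ψ` takes values in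
`Hom_{H(a,de)}(G(V)^{⊗a}, G(W)^{⊗a})` and is compatible with composition of morphisms; moreover
for a morphism `g : G → G'` the maps `g_V^{⊗a}` belong to `Hom_{H(a,de)}(G(V)^{⊗a}, G'(V)^{⊗a})` and
are compatible with `Ψ`. Here `H` is the `e`-Hecke algebra of type A or B (according to `τ`). -/
structure CompositionWellDefined (h : InducedActionWellDefined k q) : Prop where
  isTensor : ∀ (τ : Option kˣ) {c a d e : ℕ} (hc : c = a * d) (V W : EMod k q e),
    ∀ x ∈ EMod.homSpace V W τ c, IsTensor (EMod.homSpace V W none d) a (regroupHom hc x)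
  psi_mem : ∀ (τ : Option kˣ) {c a d e b : ℕ} (hc : c = a * d) (hb : b = d * e)
    (G : Pol k none q d e) (V W : EMod k q e), ∀ x ∈ EMod.homSpace V W τ c,
    psi hc G V W x ∈ EMod.homSpace (act h hb G V) (act h hb G W) τ a
  psi_id : ∀ {c a d e : ℕ} (hc : c = a * d) (G : Pol k none q d e) (V : EMod k q e),
    psi hc G V V LinearMap.id = LinearMap.id
  psi_comp : ∀ (τ : Option kˣ) {c a d e : ℕ} (hc : c = a * d) (G : Pol k none q d e)
    (V W X : EMod k q e), ∀ x ∈ EMod.homSpace V W τ c, ∀ y ∈ EMod.homSpace W X τ c,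
    psi hc G V X (y ∘ₗ x) = psi hc G W X y ∘ₗ psi hc G V W x
  map_mem : ∀ (τ : Option kˣ) (a : ℕ) {d e b : ℕ} (hb : b = d * e) {G G' : Pol k none q d e}
    (g : G ⟶ G') (V : EMod k q e),
    (PiTensorProduct.map fun _ : Fin a => evApp g V) ∈
      EMod.homSpace (act h hb G V) (act h hb G' V) τ a
  psi_naturality : ∀ (τ : Option kˣ) {c a d e : ℕ} (hc : c = a * d) {G G' : Pol k none q d e}
    (g : G ⟶ G') (V W : EMod k q e), ∀ x ∈ EMod.homSpace V W τ c,
    (PiTensorProduct.map fun _ : Fin a => evApp g W) ∘ₗ psi hc G V W x =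
      psi hc G' V W x ∘ₗ PiTensorProduct.map fun _ : Fin a => evApp g V

variable {h : InducedActionWellDefined k q} (H : CompositionWellDefined h)

/-- The functor underlying the composite `F ∘ G`. -/
def compFunctor {c a d e b : ℕ} (hc : c = a * d) (hb : b = d * e) (F : Pol k τ q a b)
    (G : Pol k none q d e) : DivCat k τ q c e ⥤ FGModuleCat.{u} k where
  obj V := ev F (act h hb G V.toEMod)
  map {V W} x := F.obj.map (X := ⟨act h hb G V.toEMod⟩) (Y := ⟨act h hb G W.toEMod⟩)
    ⟨psi hc G V.toEMod W.toEMod x.1, H.psi_mem τ hc hb G V.toEMod W.toEMod x.1 x.2⟩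
  map_id V := by
    refine Eq.trans (congrArg _ (Subtype.ext ?_)) (F.obj.map_id _)
    exact H.psi_id hc G V.toEMod
  map_comp {V W X} x y := by
    rw [← F.obj.map_comp]
    refine congrArg _ (Subtype.ext ?_)
    exact H.psi_comp τ hc G V.toEMod W.toEMod X.toEMod x.1 x.2 y.1 y.2

/-- The composite `F ∘ G` of `F ∈ P_{Q,q}^{a,de}` (or `F ∈ AP_q^{a,de}`) and `G ∈ AP_q^{d,e}`:
on objects `(F ∘ G)(V) = F(G(V))`, on morphisms `(F ∘ G)(x) = F(Ψ(x))`. -/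
def comp {c a d e b : ℕ} (hc : c = a * d) (hb : b = d * e) (F : Pol k τ q a b)
    (G : Pol k none q d e) : Pol k τ q c e where
  obj := compFunctor H hc hb F G
  property := by
    have := F.property.1
    have := F.property.2
    refine ⟨⟨fun {V W x y} => ?_⟩, ⟨fun {V W} x r => ?_⟩⟩
    · dsimp only [compFunctor]
      refine Eq.trans (congrArg F.obj.map (Subtype.ext ?_)) F.obj.map_add
      exact map_add (psi hc G V.toEMod W.toEMod) x.1 y.1
    · dsimp only [compFunctor]
      refine Eq.trans (congrArg F.obj.map (Subtype.ext ?_)) (F.obj.map_smul r _)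
      exact map_smul (psi hc G V.toEMod W.toEMod) r x.1

/-- For `g : G → G'`, the morphism `g_V^{⊗a} : G(V) → G'(V)` in the category `C_{a,b}`. -/
def tpowHom {d e b : ℕ} (hb : b = d * e) (a : ℕ) {G G' : Pol k none q d e} (g : G ⟶ G')
    (V : EMod k q e) : (⟨act h hb G V⟩ : DivCat k τ q a b) ⟶ ⟨act h hb G' V⟩ :=
  ⟨PiTensorProduct.map fun _ : Fin a => evApp g V, H.map_mem τ a hb g V⟩

theorem tpowHom_id {d e b : ℕ} (hb : b = d * e) (a : ℕ) (G : Pol k none q d e) (V : EMod k q e) :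
    tpowHom (τ := τ) H hb a (𝟙 G) V = 𝟙 _ :=
  Subtype.ext PiTensorProduct.map_id

theorem tpowHom_comp {d e b : ℕ} (hb : b = d * e) (a : ℕ) {G G' G'' : Pol k none q d e}
    (g : G ⟶ G') (g' : G' ⟶ G'') (V : EMod k q e) :
    tpowHom (τ := τ) H hb a (g ≫ g') V = tpowHom H hb a g V ≫ tpowHom H hb a g' V :=
  Subtype.ext
    (PiTensorProduct.map_comp (fun _ : Fin a => evApp g' V) fun _ => evApp g V)

/-- The morphism `F ∘ G → F' ∘ G'` induced by `f : F → F'` and `g : G → G'`, with components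
`F(G(V)) → F(G'(V)) → F'(G'(V))`. -/
def compMap {c a d e b : ℕ} (hc : c = a * d) (hb : b = d * e) {F F' : Pol k τ q a b}
    {G G' : Pol k none q d e} (f : F ⟶ F') (g : G ⟶ G') :
    comp H hc hb F G ⟶ comp H hc hb F' G' :=
  ObjectProperty.homMk
    { app V := F.obj.map (tpowHom H hb a g V.toEMod) ≫ f.hom.app ⟨act h hb G' V.toEMod⟩
      naturality V W x := by
        dsimp only [comp, compFunctor]
        rw [Category.assoc, ← f.hom.naturality, ← Category.assoc, ← Category.assoc,
          ← F.obj.map_comp, ← F.obj.map_comp]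
        congr 2
        refine Subtype.ext ?_
        exact H.psi_naturality τ hc g V.toEMod W.toEMod x.1 x.2 }

theorem compMap_id {c a d e b : ℕ} (hc : c = a * d) (hb : b = d * e) (F : Pol k τ q a b)
    (G : Pol k none q d e) : compMap H hc hb (𝟙 F) (𝟙 G) = 𝟙 (comp H hc hb F G) := by
  apply ObjectProperty.hom_ext
  ext V : 2
  refine (Category.comp_id _).trans ?_
  exact (congrArg F.obj.map (tpowHom_id H hb a G V.toEMod)).trans (F.obj.map_id _)

theorem compMap_comp {c a d e b : ℕ} (hc : c = a * d) (hb : b = d * e)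
    {F F' F'' : Pol k τ q a b} {G G' G'' : Pol k none q d e} (f : F ⟶ F') (f' : F' ⟶ F'')
    (g : G ⟶ G') (g' : G' ⟶ G'') :
    compMap H hc hb (f ≫ f') (g ≫ g') = compMap H hc hb f g ≫ compMap H hc hb f' g' := by
  apply ObjectProperty.hom_ext
  ext V : 2
  refine (congrArg (fun y => F.obj.map y ≫ (f.hom.app _ ≫ f'.hom.app _))
    (tpowHom_comp H hb a g g' V.toEMod)).trans ?_
  refine Eq.trans ?_ (Category.assoc _ _ _).symm
  refine (congrArg (fun y => y ≫ (f.hom.app _ ≫ f'.hom.app _)) (F.obj.map_comp _ _)).trans ?_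
  refine (Category.assoc _ _ _).trans ?_
  exact congrArg (fun y => F.obj.map (tpowHom H hb a g V.toEMod) ≫ y)
    (f.hom.naturality_assoc _ _)

end Composition

/-! ### The identity functor, direct sums, vanishing -/

section Sums

variable {k : Type u} [Field k]

/-- The identity functor `Id ∈ AP_q^{1,e}`: `V ↦ V` on objects, and
`Hom(V^{⊗1}, W^{⊗1}) = Hom(V, W)` on morphisms. The degree is a number `d` with `d = 1`. -/
def idPol {q : kˣ} {d : ℕ} (hd : d = 1) (e : ℕ) : Pol k none q d e :=
  let ε (V : EMod k q e) : TPow k V.carrier d ≃ₗ[k] V.carrier :=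
    haveI : Subsingleton (Fin d) := by subst hd; infer_instance
    PiTensorProduct.subsingletonEquiv (R := k) (s := fun _ => V.carrier) (⟨0, by omega⟩ : Fin d)
  { obj :=
      { obj V := FGModuleCat.of k V.toEMod.carrier
        map {V W} x := FGModuleCat.ofHom ((ε V.toEMod).arrowCongr (ε W.toEMod) x.1)
        map_id V := by
          apply FGModuleCat.hom_ext
          exact LinearEquiv.conj_id (ε V.toEMod)
        map_comp {V W X} x y := by
          apply FGModuleCat.hom_ext
          exact LinearEquiv.arrowCongr_comp (ε V.toEMod) (ε W.toEMod) (ε X.toEMod) x.1 y.1 }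
    property := by
      refine ⟨⟨fun {V W x y} => ?_⟩, ⟨fun {V W} x r => ?_⟩⟩
      · apply FGModuleCat.hom_ext
        exact map_add ((ε V.toEMod).arrowCongr (ε W.toEMod)) x.1 y.1
      · apply FGModuleCat.hom_ext
        exact map_smul ((ε V.toEMod).arrowCongr (ε W.toEMod)) r x.1 }

variable {Λ : Type*} [Category Λ] [Preadditive Λ] [Linear k Λ]

/-- A representation is zero if all its values are zero. -/
def Vanishes (F : ModCat k Λ) : Prop := ∀ X : Λ, Subsingleton (F.obj.obj X)

open scoped DirectSum in
/-- The direct sum of a finite family of representations. -/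
def dsum {ι : Type} [Finite ι] (F : ι → ModCat k Λ) : ModCat k Λ where
  obj :=
    { obj X := FGModuleCat.of k (⨁ i, ((F i).obj.obj X : Type u))
      map x := FGModuleCat.ofHom (DirectSum.lmap fun i => ((F i).obj.map x).hom.hom)
      map_id X := by
        apply FGModuleCat.hom_ext
        refine LinearMap.ext fun v => DFinsupp.ext fun i => ?_
        exact congrArg (fun f => f.hom.hom ((v : ⨁ i, ((F i).obj.obj X : Type u)) i))
          ((F i).obj.map_id X)
      map_comp x y := by
        apply FGModuleCat.hom_ext
        refine LinearMap.ext fun v => DFinsupp.ext fun i => ?_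
        exact congrArg (fun f => f.hom.hom ((v : ⨁ i, ((F i).obj.obj _ : Type u)) i))
          ((F i).obj.map_comp x y) }
  property := by
    have h1 := fun i => (F i).property.1
    have h2 := fun i => (F i).property.2
    refine ⟨⟨fun {X Y x y} => ?_⟩, ⟨fun {X Y} x r => ?_⟩⟩
    · apply FGModuleCat.hom_ext
      refine LinearMap.ext fun v => DFinsupp.ext fun i => ?_
      exact congrArg (fun f => f.hom.hom ((v : ⨁ i, ((F i).obj.obj X : Type u)) i))
        ((F i).obj.map_add (f := x) (g := y))
    · apply FGModuleCat.hom_ext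
      refine LinearMap.ext fun v => DFinsupp.ext fun i => ?_
      exact congrArg (fun f => f.hom.hom ((v : ⨁ i, ((F i).obj.obj X : Type u)) i))
        ((F i).obj.map_smul r x)

open scoped DirectSum in
/-- The morphism of direct sums induced by a family of morphisms. -/
def dsumMap {ι : Type} [Finite ι] {F F' : ι → ModCat k Λ} (f : ∀ i, F i ⟶ F' i) :
    dsum F ⟶ dsum F' :=
  ObjectProperty.homMk
    { app X := FGModuleCat.ofHom (DirectSum.lmap fun i => ((f i).hom.app X).hom.hom)
      naturality X Y x := by
        apply FGModuleCat.hom_ext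
        refine LinearMap.ext fun v => DFinsupp.ext fun i => ?_
        let w : ⨁ i, ((F i).obj.obj X : Type u) := v
        exact congrArg (fun g => g.hom.hom (w i)) ((f i).hom.naturality x) }

theorem dsumMap_id {ι : Type} [Finite ι] (F : ι → ModCat k Λ) :
    dsumMap (fun i => 𝟙 (F i)) = 𝟙 (dsum F) := by
  apply ObjectProperty.hom_ext
  ext X : 2
  exact FGModuleCat.hom_ext DirectSum.lmap_id

theorem dsumMap_comp {ι : Type} [Finite ι] {F F' F'' : ι → ModCat k Λ} (f : ∀ i, F i ⟶ F' i)
    (f' : ∀ i, F' i ⟶ F'' i) :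
    dsumMap (fun i => f i ≫ f' i) = dsumMap f ≫ dsumMap f' := by
  apply ObjectProperty.hom_ext
  ext X : 2
  exact FGModuleCat.hom_ext (DirectSum.lmap_comp _ _)

theorem exists_not_vanishes_of_dsum {ι : Type} [Finite ι] (F : ι → ModCat k Λ)
    (h : ¬ Vanishes (dsum F)) : ∃ i, ¬ Vanishes (F i) := by
  by_contra! hF
  refine h fun X => ⟨fun v w => DFinsupp.ext fun i => ?_⟩
  exact (hF i X).elim _ _

theorem not_vanishes_of_comp {τ : Option kˣ} {q : kˣ} {h : InducedActionWellDefined k q}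
    (H : CompositionWellDefined h) {c a d e b : ℕ} (hc : c = a * d) (hb : b = d * e) (ha : 0 < a)
    (F : Pol k τ q a b) (G : Pol k none q d e) (hFG : ¬ Vanishes (comp H hc hb F G)) :
    ¬ Vanishes F ∧ ¬ Vanishes G := by
  refine ⟨fun hF => hFG fun V => hF _, fun hG => hFG fun V => ?_⟩
  have := F.property.1
  have hV : Subsingleton (act h hb G V.toEMod).carrier := hG ⟨V.toEMod⟩
  have hz : ∀ t : TPow k (act h hb G V.toEMod).carrier a, t = 0 := fun t => by
    induction t using PiTensorProduct.induction_on with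
    | smul_tprod r f =>
      rw [(PiTensorProduct.tprod k).map_coord_zero ⟨0, ha⟩ (Subsingleton.elim _ _), smul_zero]
    | add x y hx hy => rw [hx, hy, add_zero]
  have h0 : 𝟙 (⟨act h hb G V.toEMod⟩ : DivCat k τ q a b) = 0 :=
    Subtype.ext (LinearMap.ext fun t => hz _)
  have h1 : 𝟙 (F.obj.obj ⟨act h hb G V.toEMod⟩) = 0 := by
    rw [← F.obj.map_id, h0, F.obj.map_zero]
  exact ⟨fun v w => (congrArg (fun f => f.hom.hom v) h1).trans
    (congrArg (fun f => f.hom.hom w) h1).symm⟩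

end Sums

/-! ### Families of polynomial functors of all degrees, and the extended composition -/

section Graded

variable {k : Type u} [Field k]

/-- The zero object of `mod_Λ`. -/
def zeroPol {Λ : Type*} [Category Λ] [Preadditive Λ] [Linear k Λ] : ModCat k Λ :=
  dsum fun i : Empty => i.elim

theorem vanishes_zeroPol {Λ : Type*} [Category Λ] [Preadditive Λ] [Linear k Λ] :
    Vanishes (zeroPol : ModCat k Λ) := by
  by_contra h
  obtain ⟨i, -⟩ := exists_not_vanishes_of_dsum _ h
  exact i.elim

variable (k) in
/-- Families `(F_{d,e})` of polynomial functors of all degrees `d ≥ 1` and all `e ≥ 1`, with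
families of morphisms: the product of the categories `AP_q^{d,e}` (`τ = none`), respectively
`P_{Q,q}^{d,e}` (`τ = some Q`). -/
abbrev Fam (τ : Option kˣ) (q : kˣ) := ∀ p : ℕ+ × ℕ+, Pol k τ q p.1 p.2

variable {τ : Option kˣ} {q : kˣ}

/-- The factorizations `c = a d`, as pairs `(a, d)`. -/
abbrev Factorization (c : ℕ+) : Type := {p : ℕ+ × ℕ+ // c = p.1 * p.2}

instance (c : ℕ+) : Finite (Factorization c) := by
  have h : Set.Finite {p : ℕ+ × ℕ+ | c = p.1 * p.2} := by
    refine ((Set.finite_Iic c).prod (Set.finite_Iic c)).subset ?_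
    rintro ⟨a, d⟩ (rfl : c = a * d)
    exact ⟨PNat.le_of_dvd (dvd_mul_right a d), PNat.le_of_dvd (dvd_mul_left d a)⟩
  exact h.to_subtype

namespace Factorization

variable {c : ℕ+} (p : Factorization c)

/-- The first factor. -/
abbrev a : ℕ+ := p.1.1

/-- The second factor. -/
abbrev d : ℕ+ := p.1.2

theorem coe_eq : (c : ℕ) = p.a * p.d :=
  (congrArg PNat.val p.2).trans (PNat.mul_coe _ _)

end Factorization

section

variable {h : InducedActionWellDefined k q} (H : CompositionWellDefined h)

/-- The composite of families: `(F ∘ G)_{c,e} = ⨁_{c = a d} F_{a,de} ∘ G_{d,e}`. That is, composites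
of homogeneous components `F_{a,b}` and `G_{d,e}` with `b ≠ de` are zero. -/
def famComp (F : Fam k τ q) (G : Fam k none q) : Fam k τ q := fun s =>
  dsum fun p : Factorization s.1 =>
    comp H p.coe_eq (PNat.mul_coe p.d s.2) (F (p.a, p.d * s.2)) (G (p.d, s.2))

/-- Composition of families on morphisms. -/
def famCompMap {F F' : Fam k τ q} {G G' : Fam k none q} (f : F ⟶ F') (g : G ⟶ G') :
    famComp H F G ⟶ famComp H F' G' := fun s =>
  dsumMap fun p : Factorization s.1 =>
    compMap H p.coe_eq (PNat.mul_coe p.d s.2) (f (p.a, p.d * s.2)) (g (p.d, s.2))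

theorem famCompMap_id (F : Fam k τ q) (G : Fam k none q) :
    famCompMap H (𝟙 F) (𝟙 G) = 𝟙 (famComp H F G) := by
  funext s
  refine Eq.trans ?_ (dsumMap_id _)
  exact congrArg dsumMap (funext fun p => compMap_id H _ _ _ _)

theorem famCompMap_comp {F F' F'' : Fam k τ q} {G G' G'' : Fam k none q} (f : F ⟶ F')
    (f' : F' ⟶ F'') (g : G ⟶ G') (g' : G' ⟶ G'') :
    famCompMap H (f ≫ f') (g ≫ g') = famCompMap H f g ≫ famCompMap H f' g' := by
  funext s
  refine Eq.trans ?_ (dsumMap_comp _ _)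
  exact congrArg dsumMap (funext fun p => compMap_comp H _ _ _ _ _ _)

theorem exists_of_famComp (F : Fam k τ q) (G : Fam k none q) (s : ℕ+ × ℕ+)
    (hs : ¬ Vanishes (famComp H F G s)) : ∃ a d : ℕ+, s.1 = a * d ∧
      ¬ Vanishes (F (a, d * s.2)) ∧ ¬ Vanishes (G (d, s.2)) := by
  obtain ⟨p, hp⟩ := exists_not_vanishes_of_dsum _ hs
  exact ⟨p.a, p.d, p.2, not_vanishes_of_comp H _ _ p.a.pos _ _ hp⟩

end

/-- The identity functors `Id ∈ AP_q^{1,e}`, `e ≥ 1`, as a family. -/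
def idFam : Fam k none q := fun s =>
  if h : (s.1 : ℕ) = 1 then idPol h s.2 else zeroPol

variable (k q) in
/-- The category of extended type A polynomial functors: families `(G_{d,e})` with `G_{d,e}` in
`AP_q^{d,e}` such that for every `e` there is at most one `d` with `G_{d,e} ≠ 0`. -/
abbrev AEP := ObjectProperty.FullSubcategory fun G : Fam k none q =>
  ∀ e d d' : ℕ+, ¬ Vanishes (G (d, e)) → ¬ Vanishes (G (d', e)) → d = d'

variable (k) in
/-- The category of extended type B polynomial functors, the direct sum of the categories
`P_{Q,q}^{d,e}`: families `(F_{d,e})` with `F_{d,e}` in `P_{Q,q}^{d,e}` of which only finitely many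
are nonzero. -/
abbrev EP (Q q : kˣ) := ObjectProperty.FullSubcategory fun F : Fam k (some Q) q =>
  {s | ¬ Vanishes (F s)}.Finite

namespace AEP

variable {h : InducedActionWellDefined k q} (H : CompositionWellDefined h)

/-- The family of all identity functors. -/
def unit : AEP k q where
  obj := idFam
  property := by
    have key : ∀ d e : ℕ+, ¬ Vanishes (idFam (k := k) (q := q) (d, e)) → d = 1 := by
      intro d e hd
      by_contra h1
      refine hd ?_
      rw [idFam, dif_neg (fun h => h1 (PNat.coe_eq_one_iff.1 h))]
      exact vanishes_zeroPol
    exact fun e d d' hd hd' => (key d e hd).trans (key d' e hd').symm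

/-- The composition `(F, G) ↦ F ∘ G` of extended type A polynomial functors. -/
def comp : AEP k q × AEP k q ⥤ AEP k q where
  obj X :=
    { obj := famComp H X.1.obj X.2.obj
      property := fun e c c' hc hc' => by
        obtain ⟨a, d, rfl, hF, hG⟩ := exists_of_famComp H _ _ _ hc
        obtain ⟨a', d', rfl, hF', hG'⟩ := exists_of_famComp H _ _ _ hc'
        obtain rfl := X.2.property e d d' hG hG'
        obtain rfl := X.1.property _ a a' hF hF'
        rfl }
  map f := ObjectProperty.homMk (famCompMap H f.1.hom f.2.hom)
  map_id X := ObjectProperty.hom_ext _ (famCompMap_id H _ _)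
  map_comp f g := ObjectProperty.hom_ext _ (famCompMap_comp H _ _ _ _)

end AEP

namespace EP

variable {Q : kˣ} {h : InducedActionWellDefined k q} (H : CompositionWellDefined h)

/-- The composition `(F, G) ↦ F ∘ G` of extended type B and type A polynomial functors. -/
def comp : EP k Q q × AEP k q ⥤ EP k Q q where
  obj X :=
    { obj := famComp H X.1.obj X.2.obj
      property := by
        have hfin := X.1.property
        refine (hfin.biUnion (t := fun t => Set.Iic (t.1 * t.2) ×ˢ Set.Iic t.2)
          fun t _ => (Set.finite_Iic _).prod (Set.finite_Iic _)).subset ?_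
        rintro ⟨c, e⟩ hc
        obtain ⟨a, d, hcad, hF, -⟩ := exists_of_famComp H _ _ _ hc
        obtain rfl : c = a * d := hcad
        refine Set.mem_biUnion (x := (a, d * e)) hF ⟨?_, ?_⟩
        · exact PNat.le_of_dvd ⟨e, (mul_assoc a d e).symm⟩
        · exact PNat.le_of_dvd (dvd_mul_left e d) }
  map f := ObjectProperty.homMk (famCompMap H f.1.hom f.2.hom)
  map_id X := ObjectProperty.hom_ext _ (famCompMap_id H _ _)
  map_comp f g := ObjectProperty.hom_ext _ (famCompMap_comp H _ _ _ _)

end EP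

end Graded

open scoped MonoidalCategory MonoidalCategory.MonoidalRightAction in
/-- The functor `B × A ⥤ B` underlying a right action of a monoidal category `A` on `B`. -/
def rightActionFunctor (A B : Type*) [Category A] [Category B] [MonoidalCategory A]
    [MonoidalCategory.MonoidalRightAction A B] : B × A ⥤ B where
  obj X := X.1 ⊙ᵣ X.2
  map f := f.1 ⊙ᵣₘ f.2
  map_id X := by simp [MonoidalCategory.MonoidalRightAction.actionHom_def]
  map_comp f g := MonoidalCategory.MonoidalRightAction.actionHom_comp f.1 g.1 f.2 g.2

end QPoly

end

noncomputable section

namespace QPoly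

/-! ### Tensor powers of linear relations between Hom-spaces -/

section TensorCalculus

open PiTensorProduct

variable {k : Type u} [Field k] {M N P M' N' P' M'' N'' : Type u}
  [AddCommGroup M] [Module k M] [AddCommGroup N] [Module k N] [AddCommGroup P] [Module k P]
  [AddCommGroup M'] [Module k M'] [AddCommGroup N'] [Module k N'] [AddCommGroup P'] [Module k P']
  [AddCommGroup M''] [Module k M''] [AddCommGroup N''] [Module k N'']

/-! Every assertion reduces to identities between Hecke operators on `V_n^{⊗N}`, together with a way
to transport them to an arbitrary module `V` and from there to `G(V)`.

Membership in tensor powers. For finite-dimensional spaces `Hom(M^{⊗d}, N^{⊗d})` is `Hom(M,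
N)^{⊗d}`, and a map that intertwines given operators in each tensor factor separately lies in the
`d`-th tensor power of any subspace containing all intertwiners (`isTensor_of_intertwining`). Hence
an operator on `V_n^{⊗de}` that commutes with every `T_l` inside a block of length `e` lies in
`S_q^A(n;e)^{⊗d}`. The braid relations show that `T_{w_i}` carries the generators of a block to
those of the exchanged block (`opTw_mul_opT`), and that `T_{w_0}`, a product of Jucys-Murphy
elements, commutes with them (`opTw0_commute_opT`). The same criterion, applied to block exchanges
inside a group of `d` factors, decomposes the morphisms on `V^{⊗ad}` into tensors
(`isTensor_homSpace`).

Transport. Maps defined on tensors are handled as relations: `tpowCorr Γ d` is spanned by pairs of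
pure tensors with factors related by `Γ`. It is compatible with composition, regrouping and
permutation of factors, and for the graph of a linear map on a subspace it is functional
(`tpowCorr_corr_unique`). The predicate `Lifts` keeps track of an additional permutation of the
factors; by `Lifts.unique`, operators that agree on `(V_n^{⊗e})^{⊗d}` and carry the same permutation
act in the same way on `V^{⊗d}`.

The map `Ψ`. The exchange of two blocks of length `de` is a `d × d` rectangle of exchanges of blocks
of length `e` (`rectProd_mul`), and `T_{w_0}` for length `de` is the product of the first `d`
Jucys-Murphy elements formed from the generators for length `e` (`jmProd_mul`). A map that commutes
with the generators on `V^{⊗ad}` commutes with these products, and under `G` they correspond to the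
generators on `G(V)^{⊗a}` (`opRV_act`, `opKV_act`, `psi_mem_homSpace`). Since `Ψ` for `G ∘ K` is the
composite of the two maps `Ψ` (`psi_comp_pol`), the homogeneous associator is `F` applied to an
identity map.

Families. The associator and unitors are defined on the summands `F_{a,y} ∘ G_{d,d'e} ∘ K_{d',e}`,
and naturality, pentagon and triangle are checked there. As `F` need not preserve direct sums of
modules, invertibility of the associator is a separate matter: it holds because for each `e` at most
one `G_{d,e}` and at most one `K_{d,e}` is nonzero, which leaves a single summand
(`Fam.isIso_assoc`). -/

theorem map_comp_const {d : ℕ} (v : Fin d → (N →ₗ[k] P)) (u : Fin d → (M →ₗ[k] N)) :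
    map (fun i => v i ∘ₗ u i) = map v ∘ₗ map u :=
  map_comp _ _

/-- The `d`-th tensor power of a linear relation `Γ` between `Hom(M, N)` and `Hom(M', N')`. -/
def tpowCorr (Γ : Submodule k ((M →ₗ[k] N) × (M' →ₗ[k] N'))) (d : ℕ) :
    Submodule k ((TPow k M d →ₗ[k] TPow k N d) × (TPow k M' d →ₗ[k] TPow k N' d)) :=
  Submodule.span k {p | ∃ u : Fin d → (M →ₗ[k] N) × (M' →ₗ[k] N'), (∀ i, u i ∈ Γ) ∧
    (map (fun i => (u i).1), map (fun i => (u i).2)) = p}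

/-- The graph of a linear map defined on a subspace. -/
def corr (U : Submodule k (M →ₗ[k] N)) (φ : U →ₗ[k] (M' →ₗ[k] N')) :
    Submodule k ((M →ₗ[k] N) × (M' →ₗ[k] N')) :=
  LinearMap.range (U.subtype.prod φ)

theorem mem_corr {U : Submodule k (M →ₗ[k] N)} {φ : U →ₗ[k] (M' →ₗ[k] N')}
    {x : M →ₗ[k] N} {y : M' →ₗ[k] N'} : (x, y) ∈ corr U φ ↔ ∃ h : x ∈ U, φ ⟨x, h⟩ = y := by
  constructor
  · rintro ⟨⟨u, hu⟩, h⟩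
    obtain ⟨rfl, rfl⟩ := Prod.mk.inj (show (u, φ ⟨u, hu⟩) = (x, y) from h)
    exact ⟨hu, rfl⟩
  · rintro ⟨h, rfl⟩
    exact ⟨⟨x, h⟩, rfl⟩

section

variable {Γ : Submodule k ((M →ₗ[k] N) × (M' →ₗ[k] N'))} {d : ℕ}

theorem map_mem_tpowCorr {u : Fin d → (M →ₗ[k] N)} {u' : Fin d → (M' →ₗ[k] N')}
    (h : ∀ i, (u i, u' i) ∈ Γ) : (map u, map u') ∈ tpowCorr Γ d :=
  Submodule.subset_span ⟨fun i => (u i, u' i), h, rfl⟩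

theorem tpowCorr_induction {p : (TPow k M d →ₗ[k] TPow k N d) → (TPow k M' d →ₗ[k] TPow k N' d) → Prop}
    (hmap : ∀ u u', (∀ i, (u i, u' i) ∈ Γ) → p (map u) (map u')) (hzero : p 0 0)
    (hadd : ∀ x x' y y', p x x' → p y y' → p (x + y) (x' + y'))
    (hsmul : ∀ (r : k) x x', p x x' → p (r • x) (r • x'))
    {x : TPow k M d →ₗ[k] TPow k N d} {x' : TPow k M' d →ₗ[k] TPow k N' d}
    (h : (x, x') ∈ tpowCorr Γ d) : p x x' := by
  refine Submodule.span_induction (p := fun q _ => p q.1 q.2) ?_ hzero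
    (fun x y _ _ => hadd _ _ _ _) (fun r x _ => hsmul r _ _) h
  rintro _ ⟨u, hu, rfl⟩
  exact hmap _ _ hu

/-- On pure tensors the relation is the defining formula of `tensorExt`, and both conditions are
closed under linear combinations. The choice hidden in `tensorExt` is thereby replaced by a relation
that is stable under composition and regrouping. -/
theorem mem_tpowCorr_corr [FiniteDimensional k M] [FiniteDimensional k N]
    {U : Submodule k (M →ₗ[k] N)} {φ : U →ₗ[k] (M' →ₗ[k] N')} {d : ℕ}
    {x : TPow k M d →ₗ[k] TPow k N d} {y : TPow k M' d →ₗ[k] TPow k N' d} :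
    (x, y) ∈ tpowCorr (corr U φ) d ↔ IsTensor U d x ∧ tensorExt U φ d x = y := by
  constructor
  · refine tpowCorr_induction (p := fun x y => IsTensor U d x ∧ tensorExt U φ d x = y)
      (fun u u' hu => ?_) ⟨Submodule.zero_mem _, map_zero _⟩
      (fun x x' y y' hx hy => ⟨Submodule.add_mem _ hx.1 hy.1, by rw [map_add, hx.2, hy.2]⟩)
      (fun r x x' hx => ⟨Submodule.smul_mem _ r hx.1, by rw [map_smul, hx.2]⟩)
    choose h h' using fun i => mem_corr.1 (hu i)
    have key : ofTensors U d (tprod k fun i => ⟨u i, h i⟩) = PiTensorProduct.map u := by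
      simp [ofTensors, piTensorHomMap_tprod_eq_map]
    refine ⟨⟨_, key⟩, ?_⟩
    rw [← key, tensorExt_ofTensors, map_tprod, piTensorHomMap_tprod_eq_map]
    exact congrArg _ (funext h')
  · rintro ⟨⟨t, rfl⟩, rfl⟩
    rw [tensorExt_ofTensors]
    induction t using PiTensorProduct.induction_on with
    | smul_tprod r v =>
      simp only [map_smul]
      refine Submodule.smul_mem _ r (?_ : (_, _) ∈ _)
      simp only [ofTensors, LinearMap.comp_apply, map_tprod, piTensorHomMap_tprod_eq_map]
      exact map_mem_tpowCorr fun i => ⟨v i, rfl⟩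
    | add x y hx hy =>
      simp only [map_add]
      exact Submodule.add_mem _ hx hy

/-- Functionality rests on the injectivity of `ofTensors`, where finite dimension enters. Later
equalities between maps defined on tensors are obtained by relating both sides to the same element.
-/
theorem tpowCorr_corr_unique [FiniteDimensional k M] [FiniteDimensional k N]
    {U : Submodule k (M →ₗ[k] N)} {φ : U →ₗ[k] (M' →ₗ[k] N')} {d : ℕ}
    {x : TPow k M d →ₗ[k] TPow k N d} {y y' : TPow k M' d →ₗ[k] TPow k N' d}
    (h : (x, y) ∈ tpowCorr (corr U φ) d) (h' : (x, y') ∈ tpowCorr (corr U φ) d) : y = y' :=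
  (mem_tpowCorr_corr.1 h).2.symm.trans (mem_tpowCorr_corr.1 h').2

/-- Composition is bilinear and takes place factor by factor on pure tensors, so compatibility in a
single factor suffices. -/
theorem tpowCorr_comp {Γ' : Submodule k ((N →ₗ[k] P) × (N' →ₗ[k] P'))}
    {Γ'' : Submodule k ((M →ₗ[k] P) × (M' →ₗ[k] P'))}
    (H : ∀ x x' y y', (x, x') ∈ Γ → (y, y') ∈ Γ' → (y ∘ₗ x, y' ∘ₗ x') ∈ Γ'')
    {x : TPow k M d →ₗ[k] TPow k N d} {x' : TPow k M' d →ₗ[k] TPow k N' d}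
    {y : TPow k N d →ₗ[k] TPow k P d} {y' : TPow k N' d →ₗ[k] TPow k P' d}
    (hx : (x, x') ∈ tpowCorr Γ d) (hy : (y, y') ∈ tpowCorr Γ' d) :
    (y ∘ₗ x, y' ∘ₗ x') ∈ tpowCorr Γ'' d := by
  revert y y'
  refine tpowCorr_induction (p := fun x x' => ∀ {y y'}, (y, y') ∈ tpowCorr Γ' d →
    (y ∘ₗ x, y' ∘ₗ x') ∈ tpowCorr Γ'' d) (fun u u' hu y y' hy => ?_) ?_ ?_ ?_ hx
  · refine tpowCorr_induction (p := fun y y' => (y ∘ₗ PiTensorProduct.map u,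
      y' ∘ₗ PiTensorProduct.map u') ∈ tpowCorr Γ'' d) (fun v v' hv => ?_) ?_ ?_ ?_ hy
    · rw [← map_comp, ← map_comp]
      exact map_mem_tpowCorr fun i => H _ _ _ _ (hu i) (hv i)
    · simp only [LinearMap.zero_comp]
      exact Submodule.zero_mem _
    · intro x x' y y' h h'
      simp only [LinearMap.add_comp]
      exact Submodule.add_mem _ h h'
    · intro r x x' h
      simp only [LinearMap.smul_comp]
      exact Submodule.smul_mem _ r h
  · intro y y' _
    simp only [LinearMap.comp_zero]
    exact Submodule.zero_mem _
  · intro x x' z z' h h' y y' hy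
    simp only [LinearMap.comp_add]
    exact Submodule.add_mem _ (h hy) (h' hy)
  · intro r x x' h y y' hy
    simp only [LinearMap.comp_smul]
    exact Submodule.smul_mem _ r (h hy)

/-- Tensor powers are compatible with composition of relations. -/
theorem tpowCorr_factor {Γ₁ : Submodule k ((M →ₗ[k] N) × (M'' →ₗ[k] N''))}
    {Γ₂ : Submodule k ((M'' →ₗ[k] N'') × (M' →ₗ[k] N'))}
    (H : ∀ x z, (x, z) ∈ Γ → ∃ y, (x, y) ∈ Γ₁ ∧ (y, z) ∈ Γ₂)
    {x : TPow k M d →ₗ[k] TPow k N d} {z : TPow k M' d →ₗ[k] TPow k N' d}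
    (hx : (x, z) ∈ tpowCorr Γ d) : ∃ y, (x, y) ∈ tpowCorr Γ₁ d ∧ (y, z) ∈ tpowCorr Γ₂ d := by
  refine tpowCorr_induction (p := fun x z => ∃ y, (x, y) ∈ tpowCorr Γ₁ d ∧
    (y, z) ∈ tpowCorr Γ₂ d) (fun u u' hu => ?_) ?_ ?_ ?_ hx
  · choose v hv hv' using fun i => H _ _ (hu i)
    exact ⟨_, map_mem_tpowCorr hv, map_mem_tpowCorr hv'⟩
  · exact ⟨0, Submodule.zero_mem _, Submodule.zero_mem _⟩
  · rintro x x' y y' ⟨z, h1, h2⟩ ⟨z', h1', h2'⟩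
    exact ⟨z + z', Submodule.add_mem _ h1 h1', Submodule.add_mem _ h2 h2'⟩
  · rintro r x x' ⟨z, h1, h2⟩
    exact ⟨r • z, Submodule.smul_mem _ r h1, Submodule.smul_mem _ r h2⟩

/-- Multilinear maps send spans into the span of the image. -/
theorem multilinear_mem_of_mem_span {ι E F : Type*} [Fintype ι] [DecidableEq ι] [AddCommGroup E]
    [Module k E] [AddCommGroup F] [Module k F] (f : MultilinearMap k (fun _ : ι => E) F) (S : Set E)
    (W : Submodule k F) (h : ∀ v : ι → E, (∀ i, v i ∈ S) → f v ∈ W) (v : ι → E)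
    (hv : ∀ i, v i ∈ Submodule.span k S) : f v ∈ W := by
  -- Induction on the set of coordinates that may lie in the span, while the remaining ones still
  -- lie in `S`.
  suffices ∀ (s : Finset ι) (v : ι → E), (∀ i ∈ s, v i ∈ Submodule.span k S) →
      (∀ i ∉ s, v i ∈ S) → f v ∈ W from
    this Finset.univ v (fun i _ => hv i) (fun i hi => absurd (Finset.mem_univ i) hi)
  intro s
  induction s using Finset.induction_on with
  | empty => exact fun v _ hv => h v fun i => hv i (Finset.notMem_empty i)
  | insert b s hb ih =>
    intro v hv hv'
    have key : ∀ w ∈ Submodule.span k S, f (Function.update v b w) ∈ W := by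
      intro w hw
      induction hw using Submodule.span_induction with
      | mem w hw =>
        refine ih _ (fun i hi => ?_) (fun i hi => ?_)
        · rw [Function.update_of_ne (by rintro rfl; exact hb hi)]
          exact hv i (Finset.mem_insert_of_mem hi)
        · by_cases h : i = b
          · subst h; rwa [Function.update_self]
          · rw [Function.update_of_ne h]
            exact hv' i (by simp [h, hi])
      | zero => rw [f.map_update_zero]; exact W.zero_mem
      | add x y _ _ hx hy => rw [f.map_update_add]; exact W.add_mem hx hy
      | smul r x _ hx => rw [f.map_update_smul]; exact W.smul_mem r hx
    simpa using key (v b) (hv b (Finset.mem_insert_self b s))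

/-- A pair of pure tensors is multilinear in the tuple of pairs of factors, so generators of the
relation suffice. This is needed when the relation is itself a tensor power. -/
theorem tpowCorr_induction_span {S : Set ((M →ₗ[k] N) × (M' →ₗ[k] N'))}
    (W : Submodule k ((TPow k M d →ₗ[k] TPow k N d) × (TPow k M' d →ₗ[k] TPow k N' d)))
    (h : ∀ u u', (∀ i, (u i, u' i) ∈ S) → (map u, map u') ∈ W) :
    tpowCorr (Submodule.span k S) d ≤ W := by
  refine Submodule.span_le.2 ?_
  rintro _ ⟨u, hu, rfl⟩
  let f : MultilinearMap k (fun _ : Fin d => (M →ₗ[k] N) × (M' →ₗ[k] N'))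
      ((TPow k M d →ₗ[k] TPow k N d) × (TPow k M' d →ₗ[k] TPow k N' d)) :=
    ((mapMultilinear k (fun _ : Fin d => M) (fun _ => N)).compLinearMap
        fun _ => LinearMap.fst k _ _).prod
      ((mapMultilinear k (fun _ : Fin d => M') (fun _ => N')).compLinearMap
        fun _ => LinearMap.snd k _ _)
  exact multilinear_mem_of_mem_span f S W (fun v hv => h _ _ hv) u hu

theorem regroup_map {c a d : ℕ} (hc : c = a * d) (u : Fin c → (M →ₗ[k] N)) :
    regroupHom hc (map u) = map fun i => map fun j => u (blockIdx hc (i, j)) := by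
  rw [regroupHom]
  refine (LinearEquiv.eq_symm_apply _).1 ?_
  refine PiTensorProduct.ext (MultilinearMap.ext fun v => ?_)
  apply (regroup k N hc).injective
  simp [LinearEquiv.arrowCongr_symm_apply, regroup_tprod]

theorem tpowCorr_tpowCorr_le {c a d : ℕ} (hc : c = a * d) :
    tpowCorr (tpowCorr Γ d) a ≤ (tpowCorr Γ c).map ((regroupHom hc).toLinearMap.prodMap
      (regroupHom hc).toLinearMap) := by
  refine tpowCorr_induction_span _ fun u u' hu => ?_
  have hu' : ∀ i, ∃ w w', (∀ j, (w j, w' j) ∈ Γ) ∧ u i = map w ∧ u' i = map w' := fun i => by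
    obtain ⟨v, hv, hv'⟩ := hu i
    obtain ⟨h1, h2⟩ := Prod.mk.inj hv'
    exact ⟨_, _, hv, h1.symm, h2.symm⟩
  choose w w' hw h1 h2 using hu'
  refine ⟨(PiTensorProduct.map fun l => w ((blockIdx hc).symm l).1 ((blockIdx hc).symm l).2,
    PiTensorProduct.map fun l => w' ((blockIdx hc).symm l).1 ((blockIdx hc).symm l).2),
    map_mem_tpowCorr fun l => hw _ _, ?_⟩
  rw [LinearMap.prodMap_apply, LinearEquiv.coe_coe, LinearEquiv.coe_coe, regroup_map, regroup_map,
    funext h1, funext h2]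
  simp only [Equiv.symm_apply_apply]

/-- A pure tensor of pure tensors is, up to regrouping, a pure tensor with `ad` factors. This passes
between `V^{⊗ad}` and `(V^{⊗d})^{⊗a}` without evaluating `tensorExt`. -/
theorem regroupHom_mem_tpowCorr {c a d : ℕ} (hc : c = a * d)
    {x : TPow k M c →ₗ[k] TPow k N c} {y : TPow k M' c →ₗ[k] TPow k N' c} :
    (regroupHom hc x, regroupHom hc y) ∈ tpowCorr (tpowCorr Γ d) a ↔ (x, y) ∈ tpowCorr Γ c := by
  constructor
  · intro h
    obtain ⟨⟨x', y'⟩, hp, h⟩ := tpowCorr_tpowCorr_le hc h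
    simp only [LinearMap.prodMap_apply, LinearEquiv.coe_coe, Prod.mk.injEq,
      EmbeddingLike.apply_eq_iff_eq] at h
    rwa [← h.1, ← h.2]
  · intro h
    have hle : tpowCorr Γ c ≤ (tpowCorr (tpowCorr Γ d) a).comap
        ((regroupHom hc).toLinearMap.prodMap (regroupHom hc).toLinearMap) := by
      refine Submodule.span_le.2 ?_
      rintro _ ⟨u, hu, rfl⟩
      rw [SetLike.mem_coe, Submodule.mem_comap, LinearMap.prodMap_apply, LinearEquiv.coe_coe,
        LinearEquiv.coe_coe, regroup_map, regroup_map]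
      exact map_mem_tpowCorr fun i => map_mem_tpowCorr fun j => hu _
    have h' := hle h
    rwa [Submodule.mem_comap, LinearMap.prodMap_apply, LinearEquiv.coe_coe,
      LinearEquiv.coe_coe] at h'

end

/-! ### Permutation of tensor factors -/

variable (k M) in
/-- The permutation of the tensor factors of `M^{⊗d}`. -/
def permOp {d : ℕ} : Equiv.Perm (Fin d) →* Module.End k (TPow k M d) where
  toFun σ := (reindex k (fun _ => M) σ).toLinearMap
  map_one' := PiTensorProduct.ext (MultilinearMap.ext fun v => by
    simp only [LinearMap.compMultilinearMap_apply, LinearEquiv.coe_coe]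
    exact reindex_tprod (s := fun _ => M) 1 v)
  map_mul' σ τ := PiTensorProduct.ext (MultilinearMap.ext fun v => by
    simp only [LinearMap.compMultilinearMap_apply, LinearEquiv.coe_coe, Module.End.mul_apply]
    have h : ∀ (ρ : Equiv.Perm (Fin d)) (w : Fin d → M), reindex k (fun _ => M) ρ (tprod k w) =
        tprod k fun i => w (ρ.symm i) := fun ρ w => reindex_tprod (s := fun _ => M) ρ w
    rw [h]
    exact ((congrArg _ (h τ v)).trans (h σ _)).symm)

theorem permOp_tprod {d : ℕ} (σ : Equiv.Perm (Fin d)) (v : Fin d → M) :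
    permOp k M σ (tprod k v) = tprod k fun i => v (σ.symm i) :=
  reindex_tprod (s := fun _ => M) σ v

theorem map_comp_permOp {d : ℕ} (σ : Equiv.Perm (Fin d)) (u : Fin d → (M →ₗ[k] N)) :
    map u ∘ₗ permOp k M σ = permOp k N σ ∘ₗ map fun i => u (σ i) :=
  PiTensorProduct.ext (MultilinearMap.ext fun v => by simp [permOp_tprod])

theorem permOp_conj_map {d : ℕ} (σ : Equiv.Perm (Fin d)) (u : Fin d → (M →ₗ[k] N)) :
    permOp k N σ⁻¹ ∘ₗ map u ∘ₗ permOp k M σ = map fun i => u (σ i) := by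
  rw [map_comp_permOp, ← LinearMap.comp_assoc]
  change (permOp k N σ⁻¹ * permOp k N σ) ∘ₗ _ = _
  rw [← map_mul, inv_mul_cancel, map_one]
  rfl

/-- Conjugation with a permutation only renumbers the factors of a pure tensor, and all factors are
subject to the same relation. -/
theorem permOp_conj_mem_tpowCorr {Γ : Submodule k ((M →ₗ[k] N) × (M' →ₗ[k] N'))} {d : ℕ}
    (σ : Equiv.Perm (Fin d)) {x : TPow k M d →ₗ[k] TPow k N d}
    {y : TPow k M' d →ₗ[k] TPow k N' d} (h : (x, y) ∈ tpowCorr Γ d) :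
    (permOp k N σ⁻¹ ∘ₗ x ∘ₗ permOp k M σ, permOp k N' σ⁻¹ ∘ₗ y ∘ₗ permOp k M' σ) ∈
      tpowCorr Γ d := by
  refine tpowCorr_induction (p := fun x y => (permOp k N σ⁻¹ ∘ₗ x ∘ₗ permOp k M σ,
    permOp k N' σ⁻¹ ∘ₗ y ∘ₗ permOp k M' σ) ∈ tpowCorr Γ d) (fun u u' hu => ?_) ?_ ?_ ?_ h
  · rw [permOp_conj_map, permOp_conj_map]
    exact map_mem_tpowCorr fun i => hu _
  · simp only [LinearMap.zero_comp, LinearMap.comp_zero]; exact Submodule.zero_mem _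
  · intro x x' y y' h h'
    simp only [LinearMap.add_comp, LinearMap.comp_add]; exact Submodule.add_mem _ h h'
  · intro r x x' h
    simp only [LinearMap.smul_comp, LinearMap.comp_smul]; exact Submodule.smul_mem _ r h

/-! ### Operators in a single tensor factor -/

theorem map_update_id_comp {d : ℕ} (b : Fin d) (f g : Module.End k M) :
    map (Function.update (fun _ => LinearMap.id) b (f * g)) =
      map (Function.update (fun _ : Fin d => (LinearMap.id : M →ₗ[k] M)) b f) ∘ₗ
        map (Function.update (fun _ => LinearMap.id) b g) := by
  rw [← map_comp]
  congr 1
  funext i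
  by_cases h : i = b
  · subst h; simp only [Function.update_self]; rfl
  · simp only [Function.update_of_ne h]; rfl

/-- The operator `f` in the tensor factor `b` of `M^{⊗d}`, as a linear function of `f`. -/
def insLinear {d : ℕ} (b : Fin d) : Module.End k M →ₗ[k] Module.End k (TPow k M d) where
  toFun f := map (Function.update (fun _ => LinearMap.id) b f)
  map_add' _ _ := PiTensorProduct.map_update_add _ _ _ _
  map_smul' _ _ := PiTensorProduct.map_update_smul _ _ _ _

/-- The operator `f` in the tensor factor `b` of `M^{⊗d}`. -/
def ins {d : ℕ} (b : Fin d) : Module.End k M →ₐ[k] Module.End k (TPow k M d) :=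
  AlgHom.ofLinearMap (insLinear b)
    (by
      change map (Function.update (fun _ => LinearMap.id) b LinearMap.id) = LinearMap.id
      rw [Function.update_eq_self_iff.2 rfl, map_id])
    (map_update_id_comp b)

theorem ins_tprod {d : ℕ} (b : Fin d) (f : Module.End k M) (v : Fin d → M) :
    ins b f (tprod k v) = tprod k (Function.update v b (f (v b))) := by
  refine (map_tprod _ _).trans (congrArg _ (funext fun i => ?_))
  by_cases h : i = b
  · subst h; simp
  · simp [Function.update_of_ne h]

theorem ins_mem_tpowCorr {Γ : Submodule k ((M →ₗ[k] M) × (M' →ₗ[k] M'))} {d : ℕ}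
    (hid : (LinearMap.id, LinearMap.id) ∈ Γ) {f : M →ₗ[k] M} {g : M' →ₗ[k] M'} (h : (f, g) ∈ Γ)
    (b : Fin d) : (ins b f, ins b g) ∈ tpowCorr Γ d := by
  refine map_mem_tpowCorr fun i => ?_
  by_cases hi : i = b
  · subst hi; simpa using h
  · simpa [Function.update_of_ne hi] using hid

/-! ### A criterion for lying in a tensor power of a space of intertwiners -/

section

variable {E : Type u} [AddCommGroup E] [Module k E] [FiniteDimensional k E]

/-- Contraction of all tensor factors except `b` with coordinate functionals. -/
def contract {d : ℕ} (b : Fin d) (p : Fin d → Fin (Module.finrank k E)) : TPow k E d →ₗ[k] E :=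
  ∑ i, (((Basis.piTensorProduct fun _ : Fin d => Module.finBasis k E).coord
    (Function.update p b i)).smulRight (Module.finBasis k E i))

theorem contract_tprod {d : ℕ} (b : Fin d) (p : Fin d → Fin (Module.finrank k E))
    (v : Fin d → E) : contract b p (tprod k v) =
      (∏ j ∈ Finset.univ.erase b, (Module.finBasis k E).repr (v j) (p j)) • v b := by
  conv_rhs => rw [← (Module.finBasis k E).sum_repr (v b), Finset.smul_sum]
  simp only [contract, LinearMap.sum_apply, LinearMap.smulRight_apply, Module.Basis.coord_apply,
    Basis.piTensorProduct_repr_tprod_apply]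
  refine Finset.sum_congr rfl fun i _ => ?_
  rw [smul_smul, ← Finset.mul_prod_erase _ _ (Finset.mem_univ b), Function.update_self, mul_comm]
  congr 2
  refine Finset.prod_congr rfl fun j hj => ?_
  rw [Function.update_of_ne (Finset.ne_of_mem_erase hj)]

theorem contract_ins {d : ℕ} (b : Fin d) (p : Fin d → Fin (Module.finrank k E))
    (g : Module.End k E) (t : TPow k E d) : contract b p (ins b g t) = g (contract b p t) := by
  induction t using PiTensorProduct.induction_on with
  | smul_tprod r v =>
    rw [map_smul, map_smul, map_smul, map_smul, ins_tprod, contract_tprod, contract_tprod, map_smul,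
      Function.update_self]
    congr 2
    refine Finset.prod_congr rfl fun j hj => ?_
    rw [Function.update_of_ne (Finset.ne_of_mem_erase hj)]
  | add x y hx hy => simp only [map_add, hx, hy]

/-- The coordinate of the tensor at `p` is the coordinate `p b` of its contraction along `p`. -/
theorem eq_of_contract_eq {d : ℕ} (b : Fin d) {t t' : TPow k E d}
    (h : ∀ p, contract b p t = contract b p t') : t = t' := by
  refine (Basis.piTensorProduct fun _ : Fin d => Module.finBasis k E).ext_elem fun p => ?_
  have key : ∀ t, (Module.finBasis k E).repr (contract b p t) (p b) =
      (Basis.piTensorProduct fun _ : Fin d => Module.finBasis k E).repr t p := by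
    intro t
    simp only [contract, LinearMap.sum_apply, LinearMap.smulRight_apply, Module.Basis.coord_apply,
      map_sum, map_smul, Module.Basis.repr_self, Finsupp.finsetSum_apply, Finsupp.smul_apply,
      Finsupp.single_apply, smul_eq_mul, mul_ite, mul_one, mul_zero, Finset.sum_ite_eq',
      Finset.mem_univ, if_true, Function.update_eq_self]
  rw [← key, ← key, h]

/-- Contracting all factors but `b` leaves a vector killed by all `g s`, hence a vector of `U`. So a
projection onto `U` applied in factor `b` fixes `t`; doing this in every factor exhibits `t` as an
element of `U^{⊗d}`. -/
theorem mem_range_map_subtype {ι : Type*} (U : Submodule k E) (g : ι → Module.End k E)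
    (hU : ∀ x, (∀ s, g s x = 0) → x ∈ U) {d : ℕ} (t : TPow k E d)
    (ht : ∀ (b : Fin d) s, ins b (g s) t = 0) :
    t ∈ LinearMap.range (map fun _ : Fin d => U.subtype) := by
  obtain ⟨p, hp⟩ := U.subtype.exists_leftInverse_of_injective (by simp)
  have hfix : ∀ b : Fin d, ins b (U.subtype ∘ₗ p) t = t := fun b => by
    refine eq_of_contract_eq b fun r => ?_
    have : contract b r t ∈ U := hU _ fun s => by rw [← contract_ins, ht, map_zero]
    rw [contract_ins]
    exact congrArg Subtype.val (LinearMap.congr_fun hp ⟨contract b r t, this⟩)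
  -- The projection is inserted one factor at a time; `s` is the set of factors already treated.
  have hall : ∀ s : Finset (Fin d),
      map (fun i => if i ∈ s then U.subtype ∘ₗ p else LinearMap.id) t = t := by
    intro s
    induction s using Finset.induction_on with
    | empty => simp [map_id]
    | insert b s hb ih =>
      have e : map (fun i => if i ∈ insert b s then U.subtype ∘ₗ p else LinearMap.id) =
          ins b (U.subtype ∘ₗ p) ∘ₗ map (fun i => if i ∈ s then U.subtype ∘ₗ p else LinearMap.id) := by
        refine Eq.trans (congrArg map (funext fun i => ?_)) (map_comp_const
          (Function.update (fun _ => LinearMap.id) b (U.subtype ∘ₗ p))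
          (fun i => if i ∈ s then U.subtype ∘ₗ p else LinearMap.id))
        by_cases hi : i = b
        · subst hi; simp [hb]
        · simp [hi]
      rw [e, LinearMap.comp_apply, ih, hfix]
  refine ⟨map (fun _ => p) t, ?_⟩
  rw [← LinearMap.comp_apply, ← map_comp_const]
  conv_rhs => rw [← hall Finset.univ]
  simp only [Finset.mem_univ, if_true]

end

/-- Both sides have dimension `(dim M · dim N)^d`, so injectivity is enough. -/
theorem piTensorHomMap_surjective [FiniteDimensional k M] [FiniteDimensional k N] (d : ℕ) :
    Function.Surjective
      (PiTensorProduct.piTensorHomMap : TPow k (M →ₗ[k] N) d →ₗ[k] _ →ₗ[k] TPow k N d) := by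
  have hfr : ∀ (E : Type u) [AddCommGroup E] [Module k E] [FiniteDimensional k E],
      Module.finrank k (TPow k E d) = Module.finrank k E ^ d := fun E _ _ _ => by
    rw [Module.finrank_eq_card_basis (Basis.piTensorProduct fun _ : Fin d => Module.finBasis k E)]
    simp
  have hfin : ∀ (E : Type u) [AddCommGroup E] [Module k E] [FiniteDimensional k E],
      FiniteDimensional k (TPow k E d) := fun E _ _ _ =>
    (Basis.piTensorProduct fun _ : Fin d => Module.finBasis k E).finiteDimensional_of_finite
  have := hfin M
  have := hfin N
  have := hfin (M →ₗ[k] N)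
  refine (LinearMap.injective_iff_surjective_of_finrank_eq_finrank ?_).1
    (piTensorHomMap_injective d)
  rw [hfr, Module.finrank_linearMap, Module.finrank_linearMap, hfr, hfr, mul_pow]

/-- Write `x` as an element `t` of `Hom(M, N)^{⊗d}`. Intertwining `f s` and `g s` in factor `b`
means that the operator `u ↦ u f_s - g_s u`, placed in factor `b`, kills `t`. The common kernel of
these operators on `Hom(M, N)` lies in `U`, so `mem_range_map_subtype` applies. -/
theorem isTensor_of_intertwining [FiniteDimensional k M] [FiniteDimensional k N] {ι : Type*}
    (U : Submodule k (M →ₗ[k] N)) (f : ι → Module.End k M) (g : ι → Module.End k N)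
    (hU : ∀ x, (∀ s, x ∘ₗ f s = g s ∘ₗ x) → x ∈ U) {d : ℕ} (x : TPow k M d →ₗ[k] TPow k N d)
    (hx : ∀ (b : Fin d) s, x ∘ₗ ins b (f s) = ins b (g s) ∘ₗ x) : IsTensor U d x := by
  obtain ⟨t, rfl⟩ := piTensorHomMap_surjective d x
  let ad : ι → Module.End k (M →ₗ[k] N) := fun s =>
    { toFun u := u ∘ₗ f s - g s ∘ₗ u
      map_add' u v := by rw [LinearMap.add_comp, LinearMap.comp_add]; abel
      map_smul' r u := by
        rw [LinearMap.smul_comp, LinearMap.comp_smul, ← smul_sub]; rfl }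
  have hins : ∀ (b : Fin d) (s : ι) (t : TPow k (M →ₗ[k] N) d),
      piTensorHomMap (ins b (ad s) t) =
        piTensorHomMap t ∘ₗ ins b (f s) - ins b (g s) ∘ₗ piTensorHomMap t := by
    intro b s t
    induction t using PiTensorProduct.induction_on with
    | smul_tprod r v =>
      have h : piTensorHomMap (ins b (ad s) (tprod k v)) =
          piTensorHomMap (tprod k v) ∘ₗ ins b (f s) - ins b (g s) ∘ₗ piTensorHomMap (tprod k v) := by
        refine PiTensorProduct.ext (MultilinearMap.ext fun w => ?_)
        have h1 : (fun i => (Function.update v b (ad s (v b)) i) (w i)) =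
            Function.update (fun i => v i (w i)) b (v b (f s (w b)) - g s (v b (w b))) := by
          funext i
          by_cases h : i = b
          · subst h; simp [ad]
          · simp [Function.update_of_ne h]
        have h2 : (fun i => v i (Function.update w b (f s (w b)) i)) =
            Function.update (fun i => v i (w i)) b (v b (f s (w b))) := by
          funext i
          by_cases h : i = b
          · subst h; simp
          · simp [Function.update_of_ne h]
        simp only [LinearMap.compMultilinearMap_apply, LinearMap.sub_apply, LinearMap.comp_apply,
          piTensorHomMap_tprod_tprod, ins_tprod]
        rw [h1, h2, MultilinearMap.map_update_sub]
      rw [map_smul, map_smul, map_smul, h, smul_sub, LinearMap.smul_comp, LinearMap.comp_smul]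
    | add x y hx hy =>
      simp only [map_add, hx, hy, LinearMap.add_comp, LinearMap.comp_add]; abel
  obtain ⟨t', rfl⟩ := mem_range_map_subtype U ad
    (fun x h => hU x fun s => sub_eq_zero.1 (h s)) t fun b s => by
      apply piTensorHomMap_injective d
      rw [hins, hx b s, sub_self, map_zero]
  exact ⟨t', rfl⟩

end TensorCalculus

/-! ### Braid relations for the Hecke generators -/

section FormalRelations

variable {k : Type u} [Field k] {X E : Type*} [LinearOrder X] [AddCommGroup E] [Module k E]

/-- Here `f x y z` stands for a basis word with letters `x`, `y`, `z` in three chosen positions. The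
operators see only the relative order of the letters, so a case analysis suffices; `hc` is the
quadratic relation, later used with `c = q⁻¹` and `e = q⁻¹ - q`. -/
theorem formal_braid (c e : k) (hc : c * c = 1 + e * c) (f : X → X → X → E) (A B : Module.End k E)
    (hA : ∀ x y z, A (f x y z) = if x = y then c • f x y z else if x < y then f y x z
      else f y x z + e • f x y z)
    (hB : ∀ x y z, B (f x y z) = if y = z then c • f x y z else if y < z then f x z y
      else f x z y + e • f x y z) (x y z : X) :
    A (B (A (f x y z))) = B (A (B (f x y z))) := by
  rcases lt_trichotomy x y with h1 | h1 | h1 <;> rcases lt_trichotomy y z with h2 | h2 | h2 <;>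
  rcases lt_trichotomy x z with h3 | h3 | h3 <;>
  first
  | (exfalso; order)
  | (subst_vars
     simp only [map_add, map_smul, ne_of_lt, ne_of_gt, not_lt_of_gt, if_true, if_false, *]
     try (match_scalars <;> grind))

theorem formal_commute (c e : k) (f : X → X → X → X → E) (A B : Module.End k E)
    (hA : ∀ x y z w, A (f x y z w) = if x = y then c • f x y z w else if x < y then f y x z w
      else f y x z w + e • f x y z w)
    (hB : ∀ x y z w, B (f x y z w) = if z = w then c • f x y z w else if z < w then f x y w z
      else f x y w z + e • f x y z w) (x y z w : X) :
    A (B (f x y z w)) = B (A (f x y z w)) := by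
  rcases lt_trichotomy x y with h1 | h1 | h1 <;> rcases lt_trichotomy z w with h2 | h2 | h2 <;>
  (subst_vars
   simp only [map_add, map_smul, ne_of_lt, ne_of_gt, not_lt_of_gt, if_true, if_false, *]
   try module)

theorem formal_commute_reflection (c e C E' : k) (r : X → X) (f : X → X → X → E)
    (A K : Module.End k E)
    (hK : ∀ x y z, K (f x y z) = if r x = x then C • f x y z else if r x < x then f (r x) y z
      else f (r x) y z + E' • f x y z)
    (hA : ∀ x y z, A (f x y z) = if y = z then c • f x y z else if y < z then f x z y
      else f x z y + e • f x y z) (x y z : X) :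
    A (K (f x y z)) = K (A (f x y z)) := by
  rcases lt_trichotomy (r x) x with h1 | h1 | h1 <;> rcases lt_trichotomy y z with h2 | h2 | h2 <;>
  (subst_vars
   simp only [map_add, map_smul, ne_of_lt, ne_of_gt, not_lt_of_gt, if_true, if_false, *]
   try module)

-- The case analysis runs over the comparisons of `x` and `y` with each other and with the mirror
-- images `r x` and `r y`. Both quadratic relations are needed.
set_option maxHeartbeats 2000000 in
theorem formal_reflection_braid (c e C E' : k) (hc : c * c = 1 + e * c) (hC : C * C = 1 + E' * C)
    (r : X → X) (hr : ∀ x, r (r x) = x) (hlt : ∀ x y, x < y → r y < r x)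
    (f : X → X → E) (A K : Module.End k E)
    (hK : ∀ x y, K (f x y) = if r x = x then C • f x y else if r x < x then f (r x) y
      else f (r x) y + E' • f x y)
    (hA : ∀ x y, A (f x y) = if x = y then c • f x y else if x < y then f y x
      else f y x + e • f x y) (x y : X) :
    K (A (K (A (f x y)))) = A (K (A (K (f x y)))) := by
  -- Each comparison is recorded together with its mirror image under `r`, so that every condition
  -- met during simplification is decided by a hypothesis.
  have h1 : (x < y ∧ r y < r x) ∨ y = x ∨ (y < x ∧ r x < r y) := by
    rcases lt_trichotomy x y with h | h | h
    exacts [Or.inl ⟨h, hlt _ _ h⟩, Or.inr (Or.inl h.symm), Or.inr (Or.inr ⟨h, hlt _ _ h⟩)]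
  have h2 : (x < r y ∧ y < r x) ∨ (r y = x ∧ r x = y) ∨ (r y < x ∧ r x < y) := by
    rcases lt_trichotomy x (r y) with h | h | h
    · exact Or.inl ⟨h, by simpa [hr] using hlt _ _ h⟩
    · exact Or.inr (Or.inl ⟨h.symm, by rw [h, hr]⟩)
    · exact Or.inr (Or.inr ⟨h, by simpa [hr] using hlt _ _ h⟩)
  have hrx := hr x
  have hry := hr y
  rcases h1 with ⟨h1, h1'⟩ | h1 | ⟨h1, h1'⟩ <;> rcases h2 with ⟨h2, h2'⟩ | ⟨h2, h2'⟩ | ⟨h2, h2'⟩ <;>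
  rcases lt_trichotomy (r x) x with h3 | h3 | h3 <;>
  rcases lt_trichotomy (r y) y with h4 | h4 | h4 <;>
  first
  | (exfalso; order)
  | (simp only [map_add, map_smul, ne_of_lt, ne_of_gt, not_lt_of_gt, if_true, if_false, *]
     try (match_scalars <;> grind))

end FormalRelations

/-! ### The relations for `R_q` and `K_Q` on tensor space -/

section Operators

variable {k : Type u} [Field k] {n N : ℕ}

theorem opR_vBasis (q : kˣ) (i j : Fin N) (a : Fin N → Fin n) :
    opR q i j (vBasis k a) = if a i = a j then (↑q⁻¹ : k) • vBasis k a
      else if a i < a j then vBasis k (a ∘ Equiv.swap i j)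
      else vBasis k (a ∘ Equiv.swap i j) + ((↑q⁻¹ : k) - q) • vBasis k a :=
  Module.Basis.constr_basis _ _ _ _

theorem opK_vBasis (Q : kˣ) (i : Fin N) (a : Fin N → Fin n) :
    opK Q i (vBasis k a) = if (a i).rev = a i then (↑Q⁻¹ : k) • vBasis k a
      else if (a i).rev < a i then vBasis k (Function.update a i (a i).rev)
      else vBasis k (Function.update a i (a i).rev) + ((↑Q⁻¹ : k) - Q) • vBasis k a :=
  Module.Basis.constr_basis _ _ _ _

theorem inv_mul_inv_units (q : kˣ) : (↑q⁻¹ : k) * ↑q⁻¹ = 1 + ((↑q⁻¹ : k) - q) * ↑q⁻¹ := by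
  rw [sub_mul, Units.mul_inv]; ring

/-- If the word `w x y` has letters `x`, `y` in positions `i`, `j`, then `R_q` acts by the formula
defining it. -/
theorem opR_word (q : kˣ) {i j : Fin N} (w : Fin n → Fin n → Fin N → Fin n)
    (hi : ∀ x y, w x y i = x) (hj : ∀ x y, w x y j = y)
    (hw : ∀ x y x' y' l, l ≠ i → l ≠ j → w x y l = w x' y' l) (x y : Fin n) :
    opR q i j (vBasis k (w x y)) = if x = y then (↑q⁻¹ : k) • vBasis k (w x y)
      else if x < y then vBasis k (w y x)
      else vBasis k (w y x) + ((↑q⁻¹ : k) - q) • vBasis k (w x y) := by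
  have h : w x y ∘ Equiv.swap i j = w y x := by
    funext l
    by_cases hli : l = i
    · subst hli; simp [hi, hj]
    · by_cases hlj : l = j
      · subst hlj; simp [hi, hj]
      · rw [Function.comp_apply, Equiv.swap_apply_of_ne_of_ne hli hlj, hw _ _ y x l hli hlj]
  rw [opR_vBasis, hi, hj, h]

theorem opK_word (Q : kˣ) {i : Fin N} (w : Fin n → Fin N → Fin n)
    (hi : ∀ x, w x i = x) (hw : ∀ x x' l, l ≠ i → w x l = w x' l) (x : Fin n) :
    opK Q i (vBasis k (w x)) = if x.rev = x then (↑Q⁻¹ : k) • vBasis k (w x)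
      else if x.rev < x then vBasis k (w x.rev)
      else vBasis k (w x.rev) + ((↑Q⁻¹ : k) - Q) • vBasis k (w x) := by
  have h : Function.update (w x) i x.rev = w x.rev := by
    funext l
    by_cases hli : l = i
    · subst hli; simp [hi]
    · rw [Function.update_of_ne hli, hw _ x.rev l hli]
  rw [opK_vBasis, hi, h]

theorem opR_braid (q : kˣ) {i j l : Fin N} (hij : i ≠ j) (hjl : j ≠ l) (hil : i ≠ l) :
    (opR q i j * opR q j l * opR q i j : Module.End k (VTensor k n N)) =
      opR q j l * opR q i j * opR q j l := by
  refine (vBasis k).ext fun a => ?_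
  -- `w x y z` is the word `a` with its letters in positions `i`, `j`, `l` replaced; on such words
  -- the operators have the shape required by `formal_braid`.
  let w : Fin n → Fin n → Fin n → Fin N → Fin n := fun x y z =>
    Function.update (Function.update (Function.update a i x) j y) l z
  have ha : w (a i) (a j) (a l) = a := by simp [w]
  rw [← ha]
  simp only [Module.End.mul_apply]
  refine formal_braid (↑q⁻¹ : k) ((↑q⁻¹ : k) - q) (inv_mul_inv_units q)
    (fun x y z => vBasis k (w x y z)) _ _ ?_ ?_ _ _ _
  · intro x y z
    refine opR_word q (fun x y => w x y z) ?_ ?_ ?_ x y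
    all_goals grind
  · intro x y z
    refine opR_word q (fun y z => w x y z) ?_ ?_ ?_ y z
    all_goals grind

theorem opR_commute (q : kˣ) {i j l m : Fin N} (hij : i ≠ j) (hlm : l ≠ m) (hil : i ≠ l)
    (him : i ≠ m) (hjl : j ≠ l) (hjm : j ≠ m) :
    Commute (opR q i j : Module.End k (VTensor k n N)) (opR q l m) := by
  refine (vBasis k).ext fun a => ?_
  let w : Fin n → Fin n → Fin n → Fin n → Fin N → Fin n := fun x y z t =>
    Function.update (Function.update (Function.update (Function.update a i x) j y) l z) m t
  have ha : w (a i) (a j) (a l) (a m) = a := by simp [w]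
  rw [← ha]
  simp only [Module.End.mul_apply]
  refine formal_commute (↑q⁻¹ : k) ((↑q⁻¹ : k) - q)
    (fun x y z t => vBasis k (w x y z t)) _ _ ?_ ?_ _ _ _ _
  · intro x y z t
    refine opR_word q (fun x y => w x y z t) ?_ ?_ ?_ x y
    all_goals grind
  · intro x y z t
    refine opR_word q (fun z t => w x y z t) ?_ ?_ ?_ z t
    all_goals grind

theorem opR_opK_commute (Q q : kˣ) {i j l : Fin N} (hij : i ≠ j) (hjl : j ≠ l) (hil : i ≠ l) :
    Commute (opR q j l : Module.End k (VTensor k n N)) (opK Q i) := by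
  refine (vBasis k).ext fun a => ?_
  let w : Fin n → Fin n → Fin n → Fin N → Fin n := fun x y z =>
    Function.update (Function.update (Function.update a i x) j y) l z
  have ha : w (a i) (a j) (a l) = a := by simp [w]
  rw [← ha]
  simp only [Module.End.mul_apply]
  refine formal_commute_reflection (↑q⁻¹ : k) ((↑q⁻¹ : k) - q) (↑Q⁻¹ : k) ((↑Q⁻¹ : k) - Q) Fin.rev
    (fun x y z => vBasis k (w x y z)) _ _ ?_ ?_ _ _ _
  · intro x y z
    refine opK_word Q (fun x => w x y z) ?_ ?_ x
    all_goals grind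
  · intro x y z
    refine opR_word q (fun y z => w x y z) ?_ ?_ ?_ y z
    all_goals grind

theorem opR_opK_braid (Q q : kˣ) {i j : Fin N} (hij : i ≠ j) :
    (opK Q i * opR q i j * opK Q i * opR q i j : Module.End k (VTensor k n N)) =
      opR q i j * opK Q i * opR q i j * opK Q i := by
  refine (vBasis k).ext fun a => ?_
  let w : Fin n → Fin n → Fin N → Fin n := fun x y =>
    Function.update (Function.update a i x) j y
  have ha : w (a i) (a j) = a := by simp [w]
  rw [← ha]
  simp only [Module.End.mul_apply]
  refine formal_reflection_braid (↑q⁻¹ : k) ((↑q⁻¹ : k) - q) (↑Q⁻¹ : k) ((↑Q⁻¹ : k) - Q)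
    (inv_mul_inv_units q) (inv_mul_inv_units Q) Fin.rev Fin.rev_rev
    (fun x y h => Fin.rev_lt_rev.2 h) (fun x y => vBasis k (w x y)) _ _ ?_ ?_ _ _
  · intro x y
    refine opK_word Q (fun x => w x y) ?_ ?_ x
    all_goals grind
  · intro x y
    refine opR_word q (fun x y => w x y) ?_ ?_ ?_ x y
    all_goals grind

theorem opT_eq (q : kˣ) {i : ℕ} (h1 : 1 ≤ i) (h2 : i < N) :
    opT n N q i = opR q ⟨i - 1, by omega⟩ ⟨i, h2⟩ := dif_pos ⟨h1, h2⟩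

theorem opT_eq_one (q : kˣ) {i : ℕ} (h : ¬ (1 ≤ i ∧ i < N)) : opT n N q i = 1 := dif_neg h

theorem opT_braid (q : kˣ) {i : ℕ} (h1 : 1 ≤ i) (h2 : i + 1 < N) :
    (opT n N q i * opT n N q (i + 1) * opT n N q i : Module.End k _) =
      opT n N q (i + 1) * opT n N q i * opT n N q (i + 1) := by
  rw [opT_eq q h1 (by omega), opT_eq q (by omega) h2]
  exact opR_braid q (by simp only [ne_eq, Fin.ext_iff]; omega)
    (by simp only [ne_eq, Fin.ext_iff]; omega) (by simp only [ne_eq, Fin.ext_iff]; omega)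

/-- Generators with index out of range are the identity, so far commutation carries no range
condition into the braid-monoid arguments. -/
theorem opT_commute (q : kˣ) {i j : ℕ} (h : i + 2 ≤ j) :
    Commute (opT n N q i : Module.End k _) (opT n N q j) := by
  by_cases hi : 1 ≤ i ∧ i < N
  · by_cases hj : 1 ≤ j ∧ j < N
    · rw [opT_eq q hi.1 hi.2, opT_eq q hj.1 hj.2]
      apply opR_commute <;> simp only [ne_eq, Fin.ext_iff] <;> omega
    · rw [opT_eq_one q hj]; exact Commute.one_right _
  · rw [opT_eq_one q hi]; exact Commute.one_left _

theorem opT0_commute (Q q : kˣ) {j : ℕ} (h : 2 ≤ j) :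
    Commute (opT0 n N Q : Module.End k _) (opT n N q j) := by
  by_cases hj : 1 ≤ j ∧ j < N
  · rw [opT_eq q hj.1 hj.2, opT0, dif_pos (by omega)]
    symm
    apply opR_opK_commute <;> simp only [ne_eq, Fin.ext_iff] <;> omega
  · rw [opT_eq_one q hj]; exact Commute.one_right _

theorem opT0_braid (Q q : kˣ) (h : 1 < N) :
    (opT0 n N Q * opT n N q 1 * opT0 n N Q * opT n N q 1 : Module.End k _) =
      opT n N q 1 * opT0 n N Q * opT n N q 1 * opT0 n N Q := by
  rw [opT_eq q le_rfl h, opT0, dif_pos (by omega)]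
  exact opR_opK_braid Q q (by simp [Fin.ext_iff])

end Operators

/-! ### Block permutations in braid monoids -/

section Braid

variable {G : Type*} [Monoid G]

/-- `T_m T_{m+1} ⋯ T_{m+s-1}`. -/
def colProd (T : ℕ → G) (s m : ℕ) : G := ((List.range s).map fun l => T (m + l)).prod

/-- `T_m T_{m-1} ⋯ T_{m-r+1}`. -/
def rowProd (T : ℕ → G) (r m : ℕ) : G := ((List.range r).map fun j => T (m - j)).prod

/-- The product of the `T_{m-j+l}`, `0 ≤ j < r`, `0 ≤ l < s`, row by row: a lift of the permutation
that exchanges a block of length `s` and a block of length `r`. -/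
def rectProd (T : ℕ → G) (r s m : ℕ) : G := ((List.range r).map fun j => colProd T s (m - j)).prod

/-- `T_i ⋯ T_1 T_0 T_1 ⋯ T_i`. -/
def jmElt (T : ℕ → G) (t : G) : ℕ → G
  | 0 => t
  | i + 1 => T (i + 1) * jmElt T t i * T (i + 1)

theorem list_prod_range_succ (f : ℕ → G) (s : ℕ) :
    ((List.range (s + 1)).map f).prod = ((List.range s).map f).prod * f s := by
  simp [List.range_succ]

theorem commute_list_prod_range {x : G} {f : ℕ → G} {s : ℕ} (h : ∀ l < s, Commute x (f l)) :
    Commute x ((List.range s).map f).prod := by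
  induction s with
  | zero => simp
  | succ s ih =>
    rw [list_prod_range_succ]
    exact (ih fun l hl => h l (by omega)).mul_right (h s (by omega))

variable {T : ℕ → G}

theorem colProd_zero (m : ℕ) : colProd T 0 m = 1 := rfl

theorem rowProd_zero (m : ℕ) : rowProd T 0 m = 1 := rfl

theorem rectProd_zero (s m : ℕ) : rectProd T 0 s m = 1 := rfl

theorem colProd_succ (s m : ℕ) : colProd T (s + 1) m = colProd T s m * T (m + s) :=
  list_prod_range_succ _ _

theorem rowProd_succ (r m : ℕ) : rowProd T (r + 1) m = rowProd T r m * T (m - r) :=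
  list_prod_range_succ _ _

theorem rectProd_succ (r s m : ℕ) :
    rectProd T (r + 1) s m = rectProd T r s m * colProd T s (m - r) :=
  list_prod_range_succ _ _

theorem rectProd_zero_right (r m : ℕ) : rectProd T r 0 m = 1 := by
  induction r with
  | zero => rfl
  | succ r ih => rw [rectProd_succ, ih, colProd_zero, one_mul]

theorem rectProd_add_left (r r' s m : ℕ) :
    rectProd T (r + r') s m = rectProd T r s m * rectProd T r' s (m - r) := by
  induction r' with
  | zero => simp [rectProd_zero]
  | succ r' ih => rw [← add_assoc, rectProd_succ, ih, rectProd_succ, mul_assoc, Nat.sub_sub]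

theorem rectProd_one (s m : ℕ) : rectProd T 1 s m = colProd T s m := by
  simp [rectProd, List.range_succ]

section Far

variable (far : ∀ i j, i + 2 ≤ j → Commute (T i) (T j))
include far

theorem commute_colProd {s m x : ℕ} (h : x + 2 ≤ m ∨ m + s + 1 ≤ x) :
    Commute (T x) (colProd T s m) :=
  commute_list_prod_range fun l hl => by
    rcases h with h | h
    · exact far _ _ (by omega)
    · exact (far _ _ (by omega)).symm

theorem commute_rowProd {r m x : ℕ} (hr : r ≤ m) (h : x + r + 1 ≤ m ∨ m + 2 ≤ x) :
    Commute (T x) (rowProd T r m) :=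
  commute_list_prod_range fun l hl => by
    rcases h with h | h
    · exact far _ _ (by omega)
    · exact (far _ _ (by omega)).symm

theorem commute_rectProd {r s m x : ℕ} (hr : r ≤ m) (h : x + r + 1 ≤ m ∨ m + s + 1 ≤ x) :
    Commute (T x) (rectProd T r s m) :=
  commute_list_prod_range fun l hl => commute_colProd far (by omega)

/-- Lets the rectangle grow by a column instead of a row. Passing from one reading order to the
other only exchanges generators whose indices differ by at least two. -/
theorem rectProd_succ_right {r s m : ℕ} (hr : r ≤ m) :
    rectProd T r (s + 1) m = rectProd T r s m * rowProd T r (m + s) := by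
  induction r with
  | zero => simp [rectProd_zero, rowProd_zero]
  | succ r ih =>
    have h : Commute (colProd T s (m - r)) (rowProd T r (m + s)) :=
      commute_list_prod_range fun l hl => (commute_colProd far (by omega)).symm
    rw [rectProd_succ, ih (by omega), colProd_succ, rectProd_succ, rowProd_succ,
      show m - r + s = m + s - r by omega]
    simp only [mul_assoc]
    rw [← mul_assoc (rowProd T r (m + s)), ← h.eq, mul_assoc]

theorem rectProd_add_right {r s s' m : ℕ} (hr : r ≤ m) :
    rectProd T r (s + s') m = rectProd T r s m * rectProd T r s' (m + s) := by
  induction s' with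
  | zero => rw [rectProd_zero_right, mul_one, add_zero]
  | succ s' ih =>
    rw [← add_assoc, rectProd_succ_right far hr, ih, rectProd_succ_right far (by omega), mul_assoc,
      add_assoc]

theorem rectProd_eq_rowProd {r s m : ℕ} (hr : r ≤ m) :
    rectProd T r s m = ((List.range s).map fun l => rowProd T r (m + l)).prod := by
  induction s with
  | zero =>
    exact rectProd_zero_right r m
  | succ s ih => rw [rectProd_succ_right far hr, ih, list_prod_range_succ]

/-- Block permutations of blocks of blocks. -/
theorem rectProd_mul {d d' e m : ℕ} (hd : d ≤ m) :
    rectProd T (d * e) (d' * e) (e * m) =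
      rectProd (fun i => rectProd T e e (e * i)) d d' m := by
  -- One strip of height `e`: squares of width `e` are appended one after the other. The outer
  -- induction then stacks `d` such strips.
  have hcol : ∀ d' m, 1 ≤ m →
      rectProd T e (d' * e) (e * m) = colProd (fun i => rectProd T e e (e * i)) d' m := by
    intro d' m hm
    have hem : e ≤ e * m := Nat.le_mul_of_pos_right e hm
    induction d' with
    | zero =>
      rw [zero_mul, rectProd_eq_rowProd far hem]; rfl
    | succ d' ih =>
      rw [Nat.succ_mul, rectProd_add_right far hem, ih, colProd_succ,
        mul_add, mul_comm e d']
  induction d with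
  | zero => rw [zero_mul, rectProd_zero, rectProd_zero]
  | succ d ih =>
    rw [Nat.succ_mul, rectProd_add_left, ih (by omega), rectProd_succ, ← hcol _ _ (by omega),
      Nat.mul_sub, mul_comm d e]

end Far

section Moves

variable {N : ℕ} (far : ∀ i j, i + 2 ≤ j → Commute (T i) (T j))
  (braid : ∀ i, 1 ≤ i → i + 1 < N → T i * T (i + 1) * T i = T (i + 1) * T i * T (i + 1))
include far braid

/-- `T_x` commutes to the left until it meets `T_x T_{x+1}`; there `T_x T_{x+1} T_x` becomes
`T_{x+1} T_x T_{x+1}`, and the new leading `T_{x+1}` commutes with everything before it. -/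
theorem colProd_mul {s m x : ℕ} (hm : 1 ≤ m) (hN : m + s ≤ N) (h1 : m ≤ x) (h2 : x + 1 < m + s) :
    colProd T s m * T x = T (x + 1) * colProd T s m := by
  induction s with
  | zero => omega
  | succ s ih =>
    rw [colProd_succ]
    by_cases h : x + 1 < m + s
    · rw [mul_assoc, ← (far x (m + s) (by omega)).eq, ← mul_assoc, ih (by omega) h, mul_assoc]
    · obtain ⟨s, rfl⟩ : ∃ t, s = t + 1 := ⟨s - 1, by omega⟩
      obtain rfl : x = m + s := by omega
      have hc : Commute (T (m + s + 1)) (colProd T s m) := commute_colProd far (by omega)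
      rw [colProd_succ, ← add_assoc, mul_assoc, mul_assoc, ← mul_assoc (T (m + s)),
        braid _ (by omega) (by omega), ← mul_assoc, ← mul_assoc, ← mul_assoc, ← mul_assoc, ← hc.eq]

theorem rowProd_mul {r m x : ℕ} (hN : m < N) (h1 : m + 2 ≤ x + r) (h2 : x ≤ m)
    (hr : r ≤ m) : rowProd T r m * T x = T (x - 1) * rowProd T r m := by
  induction r with
  | zero => omega
  | succ r ih =>
    rw [rowProd_succ]
    by_cases h : m + 2 ≤ x + r
    · rw [mul_assoc, (far (m - r) x (by omega)).eq, ← mul_assoc, ih h (by omega), mul_assoc]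
    · obtain ⟨r, rfl⟩ : ∃ t, r = t + 1 := ⟨r - 1, by omega⟩
      obtain ⟨y, rfl⟩ : ∃ y, x = y + 1 := ⟨x - 1, by omega⟩
      have hc : Commute (T y) (rowProd T r m) := commute_rowProd far (by omega) (by omega)
      rw [rowProd_succ, show m - r = y + 1 by omega, show m - (r + 1) = y by omega, mul_assoc,
        mul_assoc, ← mul_assoc (T (y + 1)), ← braid _ (by omega) (by omega), ← mul_assoc,
        ← mul_assoc, ← mul_assoc, ← mul_assoc, Nat.add_sub_cancel, ← hc.eq]

/-- Each of the `r` factors `colProd` raises the index by one. -/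
theorem rectProd_mul_low {r s m x : ℕ} (hr : r ≤ m) (hN : m + s ≤ N) (h1 : m < x + r)
    (h2 : x + r + 1 ≤ m + s) : rectProd T r s m * T x = T (x + r) * rectProd T r s m := by
  induction r generalizing x with
  | zero => simp [rectProd_zero]
  | succ r ih =>
    rw [rectProd_succ, mul_assoc, colProd_mul far braid (by omega) (by omega) (by omega) (by omega),
      ← mul_assoc, ih (by omega) (by omega) (by omega), mul_assoc, add_right_comm, add_assoc]

/-- Each of the `s` factors `rowProd` lowers the index by one. -/
theorem rectProd_mul_high {r s m x : ℕ} (hr : r ≤ m) (hN : m + s ≤ N) (h1 : m + s < x + r)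
    (h2 : x + 1 ≤ m + s) : rectProd T r s m * T x = T (x - s) * rectProd T r s m := by
  induction s generalizing x with
  | zero =>
    rw [rectProd_eq_rowProd far hr]
    simp
  | succ s ih =>
    rw [rectProd_succ_right far hr, mul_assoc,
      rowProd_mul far braid (by omega) (by omega) (by omega) (by omega), ← mul_assoc,
      ih (by omega) (by omega) (by omega), mul_assoc, Nat.sub_sub, add_comm 1 s]

variable {t : G} (far0 : ∀ j, 2 ≤ j → Commute t (T j))
include far0

omit braid in
theorem jmElt_commute_far {i j : ℕ} (h : i + 2 ≤ j) : Commute (jmElt T t i) (T j) := by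
  induction i with
  | zero => exact far0 j h
  | succ i ih =>
    have := far (i + 1) j h
    exact (this.mul_left (ih (by omega))).mul_left this

/-- For `i + 1 < j` the outer generators of the Jucys-Murphy element commute with `T_i` and
induction applies. For `j = i + 1`, two braid moves carry `T_i` through `T_{i+1} T_i J T_i T_{i+1}`,
because the inner element `J` commutes with `T_{i+1}`. -/
theorem jmElt_commute_low {i j : ℕ} (hi : 1 ≤ i) (hij : i < j) (hj : j < N) :
    Commute (T i) (jmElt T t j) := by
  induction j with
  | zero => omega
  | succ j ih =>
    by_cases h : i < j
    · have := far i (j + 1) (by omega)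
      exact (this.mul_right (ih h (by omega))).mul_right this
    · obtain ⟨i, rfl⟩ : ∃ l, i = l + 1 := ⟨i - 1, by omega⟩
      obtain rfl : j = i + 1 := by omega
      have hb := braid (i + 1) hi hj
      have hJ : Commute (jmElt T t i) (T (i + 1 + 1)) := jmElt_commute_far far far0 le_rfl
      change T (i + 1) * (T (i + 1 + 1) * (T (i + 1) * jmElt T t i * T (i + 1)) * T (i + 1 + 1)) =
        (T (i + 1 + 1) * (T (i + 1) * jmElt T t i * T (i + 1)) * T (i + 1 + 1)) * T (i + 1)
      generalize T (i + 1) = a at *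
      generalize T (i + 1 + 1) = b at *
      generalize jmElt T t i = J at *
      calc a * (b * (a * J * a) * b) = (a * b * a) * J * (a * b) := by simp only [mul_assoc]
        _ = b * a * (b * J) * (a * b) := by rw [hb]; simp only [mul_assoc]
        _ = b * a * J * (b * a * b) := by rw [← hJ.eq]; simp only [mul_assoc]
        _ = _ := by rw [← hb]; simp only [mul_assoc]

/-- The type B braid relation propagates from `T_0` to all Jucys-Murphy elements: ordinary braid
moves reduce the relation for the next element to that for the previous one. -/
theorem jmElt_braid (hB : 1 < N → t * T 1 * t * T 1 = T 1 * t * T 1 * t) {i : ℕ} (hi : i + 1 < N) :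
    jmElt T t i * T (i + 1) * jmElt T t i * T (i + 1) =
      T (i + 1) * jmElt T t i * T (i + 1) * jmElt T t i := by
  induction i with
  | zero => exact hB hi
  | succ i ih =>
    have hb := braid (i + 1) (by omega) hi
    have hJ : Commute (jmElt T t i) (T (i + 1 + 1)) := jmElt_commute_far far far0 le_rfl
    have ih := ih (by omega)
    change (T (i + 1) * jmElt T t i * T (i + 1)) * T (i + 1 + 1) *
      (T (i + 1) * jmElt T t i * T (i + 1)) * T (i + 1 + 1) =
      T (i + 1 + 1) * (T (i + 1) * jmElt T t i * T (i + 1)) * T (i + 1 + 1) *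
      (T (i + 1) * jmElt T t i * T (i + 1))
    generalize T (i + 1) = a at *
    generalize T (i + 1 + 1) = b at *
    generalize jmElt T t i = J at *
    calc (a * J * a) * b * (a * J * a) * b = a * J * (a * b * a) * J * (a * b) := by
          simp only [mul_assoc]
      _ = a * (J * b) * a * (b * J) * (a * b) := by rw [hb]; simp only [mul_assoc]
      _ = a * (b * J) * a * (J * b) * (a * b) := by rw [hJ.eq]
      _ = a * b * J * a * J * (b * a * b) := by simp only [mul_assoc]
      _ = a * b * (J * a * J * a) * (b * a) := by rw [← hb]; simp only [mul_assoc]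
      _ = (a * b * a) * J * a * J * (b * a) := by rw [ih]; simp only [mul_assoc]
      _ = b * a * (b * J) * a * (J * b) * a := by rw [hb]; simp only [mul_assoc]
      _ = b * a * (J * b) * a * (b * J) * a := by rw [hJ.eq]
      _ = b * a * J * (b * a * b) * J * a := by simp only [mul_assoc]
      _ = _ := by rw [← hb]; simp only [mul_assoc]

/-- `T_i` commutes with every factor except `J_{i-1}` and `J_i`. Their product is `J_{i-1} T_i
J_{i-1} T_i`, which commutes with `T_i` by `jmElt_braid`. -/
theorem commute_jmProd (hB : 1 < N → t * T 1 * t * T 1 = T 1 * t * T 1 * t) {i e : ℕ} (hi : 1 ≤ i)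
    (hie : i < e) (he : e ≤ N) :
    Commute (T i) ((List.range e).map (jmElt T t)).prod := by
  induction e with
  | zero => omega
  | succ e ih =>
    rw [list_prod_range_succ]
    by_cases h : i < e
    · exact (ih h (by omega)).mul_right (jmElt_commute_low far braid far0 hi h (by omega))
    · obtain ⟨i, rfl⟩ : ∃ l, i = l + 1 := ⟨i - 1, by omega⟩
      obtain rfl : e = i + 1 := by omega
      rw [list_prod_range_succ, mul_assoc]
      refine Commute.mul_right (commute_list_prod_range fun l hl =>
        (jmElt_commute_far far far0 (by omega)).symm) ?_
      have hr := jmElt_braid far braid far0 hB (show i + 1 < N by omega)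
      change T (i + 1) * (jmElt T t i * (T (i + 1) * jmElt T t i * T (i + 1))) =
        (jmElt T t i * (T (i + 1) * jmElt T t i * T (i + 1))) * T (i + 1)
      simp only [← mul_assoc] at hr ⊢
      rw [hr]

/-- In `J_{j+1} = T_{j+1} J_j T_{j+1}` the left generators are collected on the left in increasing
order and the right ones on the right in decreasing order; they commute with the Jucys-Murphy
elements they have to pass. -/
theorem jmProd_succ {p s : ℕ} (hN : p + s < N) :
    ((List.range s).map fun l => jmElt T t (p + 1 + l)).prod =
      colProd T s (p + 1) * ((List.range s).map fun l => jmElt T t (p + l)).prod *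
        rowProd T s (p + s) := by
  induction s with
  | zero => simp [colProd_zero, rowProd_zero]
  | succ s ih =>
    have h1 : Commute (T (p + 1 + s)) ((List.range s).map fun l => jmElt T t (p + l)).prod :=
      commute_list_prod_range fun l hl =>
        (jmElt_commute_far (i := p + l) (j := p + 1 + s) far far0 (by omega)).symm
    have h2 : Commute (jmElt T t (p + 1 + s)) (rowProd T s (p + s)) :=
      commute_list_prod_range fun l hl =>
        (jmElt_commute_low (i := p + s - l) (j := p + 1 + s) far braid far0 (by omega) (by omega) (by omega)).symm
    have h3 : rowProd T (s + 1) (p + (s + 1)) = T (p + 1 + s) * rowProd T s (p + s) := by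
      rw [rowProd, List.range_succ_eq_map, List.map_cons, List.prod_cons, List.map_map, rowProd]
      congr 2
      · omega
      · refine List.map_congr_left fun l _ => ?_
        simp only [Function.comp_apply]
        congr 1; omega
    have h4 : jmElt T t (p + 1 + s) = T (p + 1 + s) * jmElt T t (p + s) * T (p + 1 + s) := by
      rw [add_right_comm]; rfl
    rw [list_prod_range_succ, list_prod_range_succ, ih (by omega), colProd_succ, h3, mul_assoc,
      ← h2.eq, h4]
    generalize T (p + 1 + s) = a at *
    simp only [mul_assoc]
    rw [← mul_assoc a (((List.range s).map fun l => jmElt T t (p + l)).prod), h1.eq]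
    simp only [mul_assoc]

/-- Iterating the shift by one `r` times turns the rows and columns of generators into rectangles.
-/
theorem jmProd_add {p r s : ℕ} (hN : p + r + s ≤ N) :
    ((List.range s).map fun l => jmElt T t (p + r + l)).prod =
      rectProd T r s (p + r) * ((List.range s).map fun l => jmElt T t (p + l)).prod *
        rectProd T s r (p + s) := by
  induction r with
  | zero =>
    rw [rectProd_eq_rowProd (r := s) far (by omega)]
    simp [rectProd_zero]
  | succ r ih =>
    rw [← add_assoc, jmProd_succ far braid far0 (by omega), ih (by omega),
      rectProd_succ_right (r := s) far (by omega), add_comm r 1, rectProd_add_left, rectProd_one,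
      Nat.add_sub_cancel, add_right_comm p r s]
    simp only [mul_assoc]

/-- With `r = s = e`, `jmProd_add` says that the product over the next block of indices arises by
multiplying on both sides with a block exchange. This is the recursion defining `jmElt` for the
block generators, so `T_{w_0}` for length `de` is expressed through the generators for length `e`.
-/
theorem jmProd_mul {d e : ℕ} (hN : d * e ≤ N) :
    ((List.range (d * e)).map (jmElt T t)).prod =
      ((List.range d).map (jmElt (fun i => rectProd T e e (e * i))
        ((List.range e).map (jmElt T t)).prod)).prod := by
  have key : ∀ j < d, ((List.range e).map fun l => jmElt T t (e * j + l)).prod =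
      jmElt (fun i => rectProd T e e (e * i)) ((List.range e).map (jmElt T t)).prod j := by
    intro j hj
    induction j with
    | zero => simp [jmElt]
    | succ j ih =>
      have : (j + 1) * e + e ≤ d * e := by
        rw [← Nat.succ_mul]; exact Nat.mul_le_mul_right e hj
      have hc : e * j + e = (j + 1) * e := by rw [← Nat.mul_succ, mul_comm]
      rw [jmElt, ← ih (by omega)]
      have h := jmProd_add far braid far0 (p := e * j) (r := e) (s := e) (by omega)
      simpa only [Nat.mul_succ] using h
  clear hN
  induction d with
  | zero => simp
  | succ d ih =>
    rw [list_prod_range_succ, ← ih fun j hj => key j (by omega), ← key d (by omega), Nat.succ_mul,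
      List.range_add, List.map_append, List.prod_append, List.map_map, mul_comm d e]
    rfl

end Moves

end Braid

/-! ### Block permutations -/

/-- The transposition of `i - 1` and `i` in `Fin c` (the identity unless `1 ≤ i < c`). -/
def adjSwap (c i : ℕ) : Equiv.Perm (Fin c) :=
  if h : 1 ≤ i ∧ i < c then Equiv.swap ⟨i - 1, by omega⟩ ⟨i, h.2⟩ else 1

theorem adjSwap_val {c i : ℕ} (h1 : 1 ≤ i) (h2 : i < c) (x : Fin c) :
    (adjSwap c i x : ℕ) = if (x : ℕ) = i - 1 then i else if (x : ℕ) = i then i - 1 else x := by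
  rw [adjSwap, dif_pos ⟨h1, h2⟩, Equiv.swap_apply_def]
  simp only [Fin.ext_iff]
  split_ifs <;> rfl

theorem colProd_adjSwap_val {c s m : ℕ} (hm : 1 ≤ m) (hN : m + s ≤ c) (x : Fin c) :
    (colProd (adjSwap c) s m x : ℕ) = if m ≤ (x : ℕ) + 1 ∧ (x : ℕ) + 1 < m + s then (x : ℕ) + 1
      else if (x : ℕ) + 1 = m + s then m - 1 else x := by
  induction s generalizing x with
  | zero =>
    rw [colProd_zero, Equiv.Perm.one_apply]
    split_ifs <;> omega
  | succ s ih =>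
    rw [colProd_succ, Equiv.Perm.mul_apply, ih (by omega), adjSwap_val (by omega) (by omega)]
    split_ifs <;> omega

theorem rectProd_adjSwap_val {c r s m : ℕ} (hr : r ≤ m) (hN : m + s ≤ c) (x : Fin c) :
    (rectProd (adjSwap c) r s m x : ℕ) = if m ≤ (x : ℕ) + r ∧ x + r < m + s then (x : ℕ) + r
      else if m + s ≤ (x : ℕ) + r ∧ x < m + s then (x : ℕ) - s else x := by
  induction r generalizing x with
  | zero =>
    rw [rectProd_zero, Equiv.Perm.one_apply]
    split_ifs <;> omega
  | succ r ih =>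
    rw [rectProd_succ, Equiv.Perm.mul_apply, ih (by omega), colProd_adjSwap_val (by omega) (by omega)]
    split_ifs <;> omega

theorem blockIdx_val {c a d : ℕ} (h : c = a * d) (i : Fin a) (j : Fin d) :
    (blockIdx h (i, j) : ℕ) = j + d * i := rfl

theorem rectProd_adjSwap_blockIdx {c a d i : ℕ} (h : c = a * d) (h1 : 1 ≤ i) (h2 : i < a)
    (x : Fin a) (y : Fin d) : rectProd (adjSwap c) d d (d * i) (blockIdx h (x, y)) =
      blockIdx h (adjSwap a i x, y) := by
  have hi : d * i + d ≤ c := by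
    rw [h, ← Nat.mul_succ, mul_comm]; exact Nat.mul_le_mul_right d h2
  have hd : d ≤ d * i := Nat.le_mul_of_pos_right d h1
  have hy := y.2
  apply Fin.ext
  rw [rectProd_adjSwap_val hd hi, blockIdx_val, blockIdx_val, adjSwap_val h1 h2]
  rcases lt_trichotomy (x : ℕ) i with hx | hx | hx
  · by_cases hx' : (x : ℕ) = i - 1
    · have e : d * i = d * x + d := by rw [← Nat.mul_succ]; congr 1; omega
      rw [if_pos ⟨by omega, by omega⟩, if_pos hx']
      omega
    · have e : d * (x + 2) ≤ d * i := Nat.mul_le_mul_left d (by omega)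
      rw [mul_add] at e
      rw [if_neg (by omega), if_neg (by omega), if_neg hx', if_neg (by omega)]
  · subst hx
    rw [if_neg (by omega), if_pos ⟨by omega, by omega⟩, if_neg (by omega), if_pos rfl, Nat.mul_sub]
    omega
  · have e : d * (i + 1) ≤ d * x := Nat.mul_le_mul_left d hx
    rw [mul_add] at e
    rw [if_neg (by omega), if_neg (by omega), if_neg (by omega), if_neg (by omega)]

/-! ### Operators in blocks of tensor factors -/

section Blocks

open PiTensorProduct

variable {k : Type u} [Field k] {M N P : Type u} [AddCommGroup M] [Module k M]
  [AddCommGroup N] [Module k N] [AddCommGroup P] [Module k P]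

theorem regroupHom_eq_iff {c a d : ℕ} (h : c = a * d) {x : TPow k M c →ₗ[k] TPow k N c}
    {y : TPow k (TPow k M d) a →ₗ[k] TPow k (TPow k N d) a} :
    regroupHom h x = y ↔ ∀ v : Fin c → M,
      regroup k N h (x (tprod k v)) = y (regroup k M h (tprod k v)) := by
  constructor
  · rintro rfl v
    simp [regroupHom]
  · intro H
    rw [← LinearEquiv.eq_symm_apply]
    refine PiTensorProduct.ext (MultilinearMap.ext fun v => ?_)
    apply (regroup k N h).injective
    rw [LinearMap.compMultilinearMap_apply, H]
    simp [regroupHom, LinearEquiv.arrowCongr_symm_apply]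

theorem regroupHom_comp {c a d : ℕ} (h : c = a * d) (y : TPow k N c →ₗ[k] TPow k P c)
    (x : TPow k M c →ₗ[k] TPow k N c) :
    regroupHom h (y ∘ₗ x) = regroupHom h y ∘ₗ regroupHom h x :=
  LinearEquiv.arrowCongr_comp _ _ _ _ _

theorem regroupHom_id {c a d : ℕ} (h : c = a * d) :
    regroupHom (k := k) (M := M) h LinearMap.id = LinearMap.id :=
  LinearEquiv.conj_id _

/-- `regroupHom` on endomorphisms, as an isomorphism of monoids. -/
def regroupEnd {c a d : ℕ} (h : c = a * d) :
    Module.End k (TPow k M c) ≃* Module.End k (TPow k (TPow k M d) a) where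
  toEquiv := (regroupHom h).toEquiv
  map_mul' x y := regroupHom_comp h x y

theorem regroupEnd_apply {c a d : ℕ} (h : c = a * d) (x : Module.End k (TPow k M c)) :
    regroupEnd h x = regroupHom h x := rfl

theorem blockIdx_assoc {c a d d' x y : ℕ} (h1 : c = x * d') (h2 : x = a * d) (h3 : c = a * y)
    (h4 : y = d * d') (i : Fin a) (j : Fin d) (l : Fin d') :
    blockIdx h1 (blockIdx h2 (i, j), l) = blockIdx h3 (i, blockIdx h4 (j, l)) := by
  apply Fin.ext
  simp only [blockIdx_val]
  subst h4
  ring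

theorem regroup_regroup {c a d d' x y : ℕ} (h1 : c = x * d') (h2 : x = a * d) (h3 : c = a * y)
    (h4 : y = d * d') (t : TPow k M c) :
    regroup k (TPow k M d') h2 (regroup k M h1 t) =
      map (fun _ => (regroup k M h4).toLinearMap) (regroup k M h3 t) := by
  induction t using PiTensorProduct.induction_on with
  | smul_tprod r v =>
    simp only [map_smul, regroup_tprod, map_tprod, LinearEquiv.coe_coe]
    congr 2
    funext i
    congr 1
    funext j
    congr 1
    funext l
    rw [blockIdx_assoc h1 h2 h3 h4]
  | add s t hs ht => simp only [map_add, hs, ht]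

/-- Conjugation with an isomorphism in every tensor factor. -/
def congrHom {M' N' : Type u} [AddCommGroup M'] [Module k M'] [AddCommGroup N'] [Module k N']
    (f : M ≃ₗ[k] M') (g : N ≃ₗ[k] N') (a : ℕ) :
    (TPow k M a →ₗ[k] TPow k N a) ≃ₗ[k] (TPow k M' a →ₗ[k] TPow k N' a) :=
  (PiTensorProduct.congr fun _ => f).arrowCongr (PiTensorProduct.congr fun _ => g)

theorem congrHom_map {M' N' : Type u} [AddCommGroup M'] [Module k M'] [AddCommGroup N']
    [Module k N'] (f : M ≃ₗ[k] M') (g : N ≃ₗ[k] N') {a : ℕ} (u : Fin a → (M →ₗ[k] N)) :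
    congrHom f g a (map u) = map fun i => f.arrowCongr g (u i) := by
  refine PiTensorProduct.ext (MultilinearMap.ext fun v => ?_)
  simp only [congrHom, LinearMap.compMultilinearMap_apply, LinearEquiv.arrowCongr_apply,
    congr_symm_tprod, map_tprod, congr_tprod]

theorem congrHom_ins {M' : Type u} [AddCommGroup M'] [Module k M'] (f : M ≃ₗ[k] M') {a : ℕ}
    (b : Fin a) (x : Module.End k M) :
    congrHom f f a (ins b x) = ins b (f.arrowCongr f x : Module.End k M') := by
  refine (congrHom_map f f _).trans (congrArg map (funext fun i => ?_))
  by_cases h : i = b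
  · subst h; simp
  · simp only [Function.update_of_ne h]
    exact LinearEquiv.conj_id f

theorem arrowCongr_arrowCongr {M' M'' N' N'' : Type u} [AddCommGroup M'] [Module k M']
    [AddCommGroup M''] [Module k M''] [AddCommGroup N'] [Module k N'] [AddCommGroup N'']
    [Module k N''] (e : M ≃ₗ[k] M') (e' : M' ≃ₗ[k] M'') (f : N ≃ₗ[k] N') (f' : N' ≃ₗ[k] N'')
    (z : M →ₗ[k] N) :
    e'.arrowCongr f' (e.arrowCongr f z) = (e.trans e').arrowCongr (f.trans f') z := rfl

/-- Both sides are conjugation with the same identification of `M^{⊗add'}` with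
`((M^{⊗d'})^{⊗d})^{⊗a}`. -/
theorem regroupHom_regroupHom {c a d d' x y : ℕ} (h1 : c = x * d') (h2 : x = a * d)
    (h3 : c = a * y) (h4 : y = d * d') (z : TPow k M c →ₗ[k] TPow k N c) :
    regroupHom h2 (regroupHom h1 z) =
      congrHom (regroup k M h4) (regroup k N h4) a (regroupHom h3 z) := by
  have key : ∀ (L : Type u) [AddCommGroup L] [Module k L], (regroup k L h1).trans
      (regroup k (TPow k L d') h2) = (regroup k L h3).trans
        (PiTensorProduct.congr fun _ => regroup k L h4) := by
    intro L _ _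
    refine LinearEquiv.ext fun t => ?_
    rw [LinearEquiv.trans_apply, regroup_regroup h1 h2 h3 h4]
    rfl
  rw [regroupHom, regroupHom, arrowCongr_arrowCongr, key, key, ← arrowCongr_arrowCongr]
  rfl

theorem permOp_mul_ins {d : ℕ} (σ : Equiv.Perm (Fin d)) (b : Fin d) (f : Module.End k M) :
    permOp k M σ * ins b f = ins (σ b) f * permOp k M σ := by
  refine PiTensorProduct.ext (MultilinearMap.ext fun v => ?_)
  simp only [LinearMap.compMultilinearMap_apply, Module.End.mul_apply, ins_tprod, permOp_tprod,
    Equiv.symm_apply_apply]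
  congr 1
  funext i
  by_cases h : i = σ b
  · subst h; simp
  · rw [Function.update_of_ne h, Function.update_of_ne fun h' => h (by rw [← h']; simp)]

theorem flip_eq (d i : ℕ) : EMod.flip (k := k) M d i = permOp k M (adjSwap d i) := by
  rw [EMod.flip, adjSwap]
  split_ifs
  · rfl
  · exact (map_one _).symm

theorem adjSwap_inv (c i : ℕ) : (adjSwap c i)⁻¹ = adjSwap c i := by
  rw [adjSwap]
  split_ifs
  · exact Equiv.swap_inv _ _
  · exact inv_one

theorem adjSwap_adjSwap {c : ℕ} (i : ℕ) (x : Fin c) : adjSwap c i (adjSwap c i x) = x := by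
  have h := (adjSwap c i).symm_apply_apply x
  rwa [show (adjSwap c i).symm = adjSwap c i from adjSwap_inv c i] at h

theorem flip_mul_flip (d i : ℕ) : EMod.flip (k := k) M d i * EMod.flip M d i = 1 := by
  rw [flip_eq, ← map_mul]
  conv_lhs => enter [2, 1]; rw [← adjSwap_inv]
  rw [inv_mul_cancel, map_one]

theorem regroupHom_permOp {c a d : ℕ} (h : c = a * d) (σ : Equiv.Perm (Fin c))
    (τ : Equiv.Perm (Fin a)) (hστ : ∀ i j, σ (blockIdx h (i, j)) = blockIdx h (τ i, j)) :
    regroupHom h (permOp k M σ) = permOp k (TPow k M d) τ := by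
  rw [regroupHom_eq_iff]
  intro v
  rw [permOp_tprod, regroup_tprod, regroup_tprod, permOp_tprod]
  congr 1
  funext i
  congr 1
  funext j
  congr 1
  rw [Equiv.symm_apply_eq, hστ, Equiv.apply_symm_apply]

theorem regroupHom_rectProd_adjSwap {c a d i : ℕ} (h : c = a * d) (h1 : 1 ≤ i) (h2 : i < a) :
    regroupHom h (permOp k M (rectProd (adjSwap c) d d (d * i))) =
      permOp k (TPow k M d) (adjSwap a i) :=
  regroupHom_permOp h _ _ (rectProd_adjSwap_blockIdx h h1 h2)

theorem adjSwap_blockIdx {c a d i : ℕ} (h : c = a * d) (h1 : 1 ≤ i) (h2 : i < d) (b x : Fin a)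
    (y : Fin d) : adjSwap c (d * b + i) (blockIdx h (x, y)) =
      blockIdx h (x, if x = b then adjSwap d i y else y) := by
  have hb : d * b + d ≤ c := by
    rw [h, ← Nat.mul_succ, mul_comm]; exact Nat.mul_le_mul_right d b.2
  have hy := y.2
  apply Fin.ext
  rw [adjSwap_val (by omega) (by omega), blockIdx_val, blockIdx_val]
  split_ifs with h3 h4 h5 h6 <;> try rw [adjSwap_val h1 h2]
  · subst h4; rw [if_pos (by omega)]; omega
  · exfalso
    rcases lt_or_gt_of_ne (fun h => h4 (Fin.ext h) : (x : ℕ) ≠ b) with hx | hx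
    · have := Nat.mul_le_mul_left d (Nat.succ_le_of_lt hx); rw [Nat.mul_succ] at this; omega
    · have := Nat.mul_le_mul_left d (Nat.succ_le_of_lt hx); rw [Nat.mul_succ] at this; omega
  · subst h6; rw [if_neg (by omega), if_pos (by omega)]; omega
  · exfalso
    rcases lt_or_gt_of_ne (fun h => h6 (Fin.ext h) : (x : ℕ) ≠ b) with hx | hx
    · have := Nat.mul_le_mul_left d (Nat.succ_le_of_lt hx); rw [Nat.mul_succ] at this; omega
    · have := Nat.mul_le_mul_left d (Nat.succ_le_of_lt hx); rw [Nat.mul_succ] at this; omega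
  · rename_i h7
    subst h7; rw [if_neg (by omega), if_neg (by omega)]
  · rfl

theorem regroupHom_adjSwap {c a d i : ℕ} (h : c = a * d) (h1 : 1 ≤ i) (h2 : i < d) (b : Fin a) :
    regroupHom h (permOp k M (adjSwap c (d * b + i))) =
      ins b (permOp k M (adjSwap d i)) := by
  rw [regroupHom_eq_iff]
  intro v
  rw [permOp_tprod, regroup_tprod, regroup_tprod, ins_tprod, permOp_tprod]
  congr 1
  funext x
  by_cases hx : x = b
  · subst hx
    rw [Function.update_self]
    congr 1
    funext y
    congr 1
    rw [Equiv.symm_apply_eq, adjSwap_blockIdx h h1 h2, if_pos rfl, Equiv.apply_symm_apply]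
  · rw [Function.update_of_ne hx]
    congr 1
    funext y
    congr 1
    rw [Equiv.symm_apply_eq, adjSwap_blockIdx h h1 h2, if_neg hx]

end Blocks

/-! ### Hecke operators and the block structure of tensor space -/

section HeckeBlocks

open PiTensorProduct

variable {k : Type u} [Field k] {n : ℕ}

theorem vBasis_apply {N : ℕ} (w : Fin N → Fin n) :
    vBasis k w = tprod k fun i => Pi.basisFun k (Fin n) (w i) :=
  Basis.piTensorProduct_apply _ _

theorem regroup_vBasis {c a d : ℕ} (h : c = a * d) (w : Fin c → Fin n) :
    regroup k (Fin n → k) h (vBasis k w) =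
      tprod k fun b => vBasis k fun j => w (blockIdx h (b, j)) := by
  rw [vBasis_apply, regroup_tprod]
  simp only [vBasis_apply]

theorem regroupHom_opR {c a d : ℕ} (h : c = a * d) (q : kˣ) (b : Fin a) (i j : Fin d) :
    regroupHom h (opR q (blockIdx h (b, i)) (blockIdx h (b, j)) : Module.End k (VTensor k n c)) =
      ins b (opR q i j) := by
  suffices (regroup k (Fin n → k) h).toLinearMap ∘ₗ
      opR q (blockIdx h (b, i)) (blockIdx h (b, j)) =
      ins b (opR q i j) ∘ₗ (regroup k (Fin n → k) h).toLinearMap by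
    rw [regroupHom_eq_iff]
    exact fun v => LinearMap.congr_fun this _
  refine (vBasis k).ext fun w => ?_
  let v : Fin a → VTensor k n d := fun x => vBasis k fun y => w (blockIdx h (x, y))
  -- `L` inserts a vector into factor `b` and is linear, so the three cases in the definition of
  -- `R_q` can be compared through it term by term.
  let L := (PiTensorProduct.tprod k).toLinearMap v b
  have hL : ∀ t, PiTensorProduct.tprod k (Function.update v b t) = L t := fun t => rfl
  have h1 : regroup k (Fin n → k) h (vBasis k w) = L (v b) := by
    rw [← hL, Function.update_eq_self, regroup_vBasis]
  have h2 : regroup k (Fin n → k) h (vBasis k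
      (w ∘ Equiv.swap (blockIdx h (b, i)) (blockIdx h (b, j)))) =
      L (vBasis k ((fun y => w (blockIdx h (b, y))) ∘ Equiv.swap i j)) := by
    rw [← hL, regroup_vBasis]
    congr 1
    funext x
    by_cases hx : x = b
    · subst hx
      rw [Function.update_self]
      congr 1
      funext y
      simp only [Function.comp_apply]
      congr 1
      simp only [Equiv.swap_apply_def, EmbeddingLike.apply_eq_iff_eq, Prod.mk.injEq, true_and]
      split_ifs <;> rfl
    · rw [Function.update_of_ne hx]
      congr 1
      funext y
      rw [Function.comp_apply, Equiv.swap_apply_of_ne_of_ne] <;> simp [hx]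
  simp only [LinearMap.comp_apply, LinearEquiv.coe_coe]
  conv_rhs => rw [regroup_vBasis, ins_tprod]
  change _ = PiTensorProduct.tprod k (Function.update v b (opR q i j (v b)))
  rw [hL, opR_vBasis, opR_vBasis]
  split_ifs
  · rw [map_smul, map_smul, h1]
  · exact h2
  · rw [map_add, map_add, map_smul, map_smul, h1, h2]

theorem regroupHom_opT {c a d l : ℕ} (h : c = a * d) (q : kˣ) (b : Fin a) (h1 : 1 ≤ l)
    (h2 : l < d) : regroupHom h (opT n c q (d * b + l)) = ins b (opT n d q l) := by
  have hb : d * b + d ≤ c := by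
    rw [h, ← Nat.mul_succ, mul_comm]; exact Nat.mul_le_mul_right d b.2
  rw [opT_eq q h1 h2, ← regroupHom_opR h, opT_eq q (by omega) (by omega)]
  congr 2 <;> apply Fin.ext <;> rw [blockIdx_val] <;> simp only <;> omega

theorem opTw_eq (N : ℕ) (q : kˣ) (e i : ℕ) :
    opTw n N q e i = rectProd (opT (k := k) n N q) e e (e * i) := rfl

theorem opJM_eq (N : ℕ) (Q q : kˣ) : opJM n N Q q = jmElt (opT (k := k) n N q) (opT0 n N Q) := by
  funext i
  induction i with
  | zero => rfl
  | succ i ih => rw [opJM, ih]; rfl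

theorem opTw0_eq (N : ℕ) (Q q : kˣ) (e : ℕ) : opTw0 n N Q q e =
    ((List.range e).map (jmElt (opT (k := k) n N q) (opT0 n N Q))).prod := by
  rw [opTw0, opJM_eq]

theorem map_rectProd {G G' F : Type*} [Monoid G] [Monoid G'] [FunLike F G G']
    [MonoidHomClass F G G'] (f : F) (T : ℕ → G) (r s m : ℕ) :
    f (rectProd T r s m) = rectProd (fun i => f (T i)) r s m := by
  simp only [rectProd, colProd, map_list_prod, List.map_map, Function.comp_def]

theorem rectProd_congr {G : Type*} [Monoid G] {T T' : ℕ → G} {r s m m' : ℕ}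
    (h : ∀ j < r, ∀ l < s, T (m - j + l) = T' (m' - j + l)) :
    rectProd T r s m = rectProd T' r s m' := by
  unfold rectProd colProd
  congr 1
  refine List.map_congr_left fun j hj => ?_
  congr 1
  refine List.map_congr_left fun l hl => ?_
  exact h j (List.mem_range.1 hj) l (List.mem_range.1 hl)

theorem map_jmProd {G G' F : Type*} [Monoid G] [Monoid G'] [FunLike F G G']
    [MonoidHomClass F G G'] (f : F) (T : ℕ → G) (t : G) (s : ℕ) :
    f ((List.range s).map (jmElt T t)).prod =
      ((List.range s).map (jmElt (fun i => f (T i)) (f t))).prod := by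
  have h : ∀ i, f (jmElt T t i) = jmElt (fun i => f (T i)) (f t) i := fun i => by
    induction i with
    | zero => rfl
    | succ i ih => rw [jmElt, map_mul, map_mul, ih]; rfl
  rw [map_list_prod, List.map_map]
  congr 1
  exact List.map_congr_left fun i _ => h i

/-- Type A block exchange inside a block of blocks. -/
theorem regroupHom_opTw {N N' a d e i : ℕ} (hN : N = a * N') (hN' : N' = d * e) (q : kˣ) (b : Fin a)
    (h1 : 1 ≤ i) (h2 : i < d) :
    regroupHom hN (opTw n N q e (d * b + i)) = ins b (opTw (k := k) n N' q e i) := by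
  have hie : e * i + e ≤ N' := by
    rw [hN', ← Nat.mul_succ, mul_comm]; exact Nat.mul_le_mul_right e h2
  have hei : e ≤ e * i := Nat.le_mul_of_pos_right e h1
  rw [opTw_eq, opTw_eq, ← regroupEnd_apply, map_rectProd, map_rectProd]
  refine rectProd_congr fun j hj l hl => ?_
  rw [regroupEnd_apply, ← regroupHom_opT hN q b (by omega) (by omega)]
  congr 2
  subst hN'
  rw [mul_add, ← mul_assoc, mul_comm e d]
  omega

/-- With blocks counted from `0`, generators in block `i - 1` are raised by `e`, those in block `i`
are lowered by `e`, and those of the other blocks are too far away to interact. -/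
theorem opTw_mul_opT {d e i l : ℕ} (q : kˣ) (b : Fin d) (hi : 1 ≤ i) (hid : i < d) (hl : 1 ≤ l)
    (hle : l < e) : (opTw n (d * e) q e i : Module.End k _) * opT n (d * e) q (e * b + l) =
      opT n (d * e) q (e * (adjSwap d i b : Fin d) + l) * opTw n (d * e) q e i := by
  have far : ∀ i j, i + 2 ≤ j → Commute (opT (k := k) n (d * e) q i) (opT n (d * e) q j) :=
    fun i j => opT_commute q
  have braid := fun i (h : 1 ≤ i) (h' : i + 1 < d * e) => opT_braid (k := k) (n := n) q h h'
  have hei : e ≤ e * i := Nat.le_mul_of_pos_right e hi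
  have hN : e * i + e ≤ d * e := by
    rw [← Nat.mul_succ, mul_comm]; exact Nat.mul_le_mul_right e hid
  rw [opTw_eq, adjSwap_val hi hid]
  split_ifs with h h
  · obtain ⟨i, rfl⟩ : ∃ m, i = m + 1 := ⟨i - 1, by omega⟩
    rw [h, Nat.add_sub_cancel]
    rw [Nat.mul_succ] at *
    rw [rectProd_mul_low far braid (by omega) (by omega) (by omega) (by omega)]
    congr 2
    omega
  · obtain ⟨i, rfl⟩ : ∃ m, i = m + 1 := ⟨i - 1, by omega⟩
    rw [h, Nat.add_sub_cancel]
    rw [Nat.mul_succ] at *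
    rw [rectProd_mul_high far braid (by omega) (by omega) (by omega) (by omega)]
    congr 2
    omega
  · refine (commute_rectProd far hei ?_).symm.eq
    rcases lt_or_gt_of_ne h with h' | h'
    · have := Nat.mul_le_mul_left e (show (b : ℕ) + 2 ≤ i by omega)
      rw [mul_add] at this
      left; omega
    · have := Nat.mul_le_mul_left e (show i + 1 ≤ (b : ℕ) by omega)
      rw [mul_add] at this
      right; omega

/-- In the first block this is `commute_jmProd`. Generators of later blocks have index at least `e +
1`, whereas `T_{w_0}` involves only indices below `e`. -/
theorem opTw0_commute_opT {d e l : ℕ} (Q q : kˣ) (b : Fin d) (hl : 1 ≤ l) (hle : l < e) :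
    Commute (opTw0 n (d * e) Q q e : Module.End k _) (opT n (d * e) q (e * b + l)) := by
  have far : ∀ i j, i + 2 ≤ j → Commute (opT (k := k) n (d * e) q i) (opT n (d * e) q j) :=
    fun i j => opT_commute q
  have braid := fun i (h : 1 ≤ i) (h' : i + 1 < d * e) => opT_braid (k := k) (n := n) q h h'
  have far0 : ∀ j, 2 ≤ j → Commute (opT0 (k := k) n (d * e) Q) (opT n (d * e) q j) :=
    fun j => opT0_commute Q q
  rw [opTw0_eq]
  symm
  by_cases hb : (b : ℕ) = 0
  · rw [hb, mul_zero, zero_add]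
    exact commute_jmProd far braid far0 (opT0_braid Q q) hl hle
      (Nat.le_mul_of_pos_left e (by have := b.2; omega))
  · have := Nat.le_mul_of_pos_right e (Nat.pos_of_ne_zero hb)
    exact commute_list_prod_range fun i hi =>
      (jmElt_commute_far (i := i) (j := e * b + l) far far0 (by omega)).symm

/-- `S_q^A(n;e)` is the space of self-intertwiners of the `T_l`, so the intertwining criterion
applies; indices `l` out of range contribute only the identity. -/
theorem isTensor_schur {q : kˣ} {d e : ℕ} (x : Module.End k (TPow k (VTensor k n e) d))
    (h : ∀ (b : Fin d) l, 1 ≤ l → l < e → Commute x (ins b (opT n e q l))) :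
    IsTensor (Subalgebra.toSubmodule (schur k n q e)) d x := by
  refine isTensor_of_intertwining _ (opT n e q) (opT n e q) (fun y hy => ?_) x fun b l => ?_
  · rw [Subalgebra.mem_toSubmodule, schur, Subalgebra.mem_centralizer_iff]
    rintro _ ⟨l, rfl⟩
    exact (hy l).symm
  · by_cases hl : 1 ≤ l ∧ l < e
    · exact h b l hl.1 hl.2
    · rw [opT_eq_one q hl, map_one]; rfl

theorem commute_of_mem_schur {q : kˣ} {e : ℕ} {s : Module.End k (VTensor k n e)}
    (hs : s ∈ schur k n q e) (l : ℕ) : Commute (opT n e q l) s := by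
  rw [schur, Subalgebra.mem_centralizer_iff] at hs
  exact hs _ ⟨l, rfl⟩

/-- `T_{w_i}` moves the generators of one block to another and the flip moves them back, so the
product commutes with the generators inside each block. -/
theorem universalR_isTensor (q : kˣ) (n e d i : ℕ) (h1 : 1 ≤ i) (h2 : i < d) :
    IsTensor (Subalgebra.toSubmodule (schur k n q e)) d (EMod.universalR k q n e d i) := by
  refine isTensor_schur _ fun b l hl hle => ?_
  have h := congrArg (regroupEnd rfl) (opTw_mul_opT (k := k) (n := n) q b h1 h2 hl hle)
  simp only [map_mul, regroupEnd_apply, regroupHom_opT rfl q _ hl hle] at h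
  change _ * _ = _ * _
  rw [EMod.universalR, flip_eq, mul_assoc, h, ← mul_assoc, permOp_mul_ins, mul_assoc]
  congr 3
  exact adjSwap_adjSwap i b

theorem universalK_isTensor (Q q : kˣ) (n e d : ℕ) :
    IsTensor (Subalgebra.toSubmodule (schur k n q e)) d (EMod.universalK k Q q n e d) := by
  refine isTensor_schur _ fun b l hl hle => ?_
  have h := congrArg (regroupEnd rfl) (opTw0_commute_opT (k := k) (n := n) Q q b hl hle).eq
  simp only [map_mul, regroupEnd_apply, regroupHom_opT rfl q _ hl hle] at h
  exact h

theorem isTensor_of_mem_schur {q : kˣ} {N d e : ℕ} (hN : N = d * e) {s : Module.End k (VTensor k n N)}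
    (hs : s ∈ schur k n q N) :
    IsTensor (Subalgebra.toSubmodule (schur k n q e)) d (regroupHom hN s) := by
  refine isTensor_schur _ fun b l hl hle => ?_
  have h := congrArg (regroupEnd hN) (commute_of_mem_schur hs (e * b + l)).symm.eq
  simp only [map_mul, regroupEnd_apply, regroupHom_opT hN q _ hl hle] at h
  exact h

end HeckeBlocks

/-! ### Transfer of Hecke relations to modules, and the induced action -/

section Induced

open PiTensorProduct

variable {k : Type u} [Field k] {q : kˣ} {e : ℕ}

theorem regroupHom_mul {M : Type u} [AddCommGroup M] [Module k M] {c a d : ℕ} (h : c = a * d)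
    (x y : Module.End k (TPow k M c)) :
    regroupHom h (x * y) = (regroupHom h x * regroupHom h y : Module.End k (TPow k (TPow k M d) a)) :=
  regroupHom_comp h x y

/-- The graph of the action of `S_q^A(n;e)` on a module. -/
def EMod.graph (V : EMod k q e) :
    Submodule k (Module.End k (VTensor k V.n e) × Module.End k V.carrier) :=
  corr (Subalgebra.toSubmodule (schur k V.n q e)) V.ρ.toLinearMap

theorem mem_graph {V : EMod k q e} {s : Module.End k (VTensor k V.n e)}
    {t : Module.End k V.carrier} : (s, t) ∈ V.graph ↔ ∃ h : s ∈ schur k V.n q e, V.ρ ⟨s, h⟩ = t :=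
  mem_corr

theorem one_mem_graph (V : EMod k q e) : (LinearMap.id, LinearMap.id) ∈ V.graph :=
  mem_graph.2 ⟨one_mem _, map_one V.ρ⟩

theorem mul_mem_graph (V : EMod k q e) (x : Module.End k (VTensor k V.n e))
    (x' : Module.End k V.carrier) (y : Module.End k (VTensor k V.n e))
    (y' : Module.End k V.carrier) (hx : (x, x') ∈ V.graph) (hy : (y, y') ∈ V.graph) :
    (y ∘ₗ x, y' ∘ₗ x') ∈ V.graph := by
  obtain ⟨h, rfl⟩ := mem_graph.1 hx
  obtain ⟨h', rfl⟩ := mem_graph.1 hy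
  exact mem_graph.2 ⟨mul_mem h' h, map_mul V.ρ ⟨y, h'⟩ ⟨x, h⟩⟩

theorem mem_tpow_graph {V : EMod k q e} {d : ℕ} {x : Module.End k (TPow k (VTensor k V.n e) d)}
    {y : Module.End k (TPow k V.carrier d)} : (x, y) ∈ tpowCorr V.graph d ↔
      IsTensor (Subalgebra.toSubmodule (schur k V.n q e)) d x ∧ V.tensorRep d x = y :=
  mem_tpowCorr_corr

theorem mul_mem_tpow_graph {V : EMod k q e} {d : ℕ} {x x' : Module.End k (TPow k (VTensor k V.n e) d)}
    {y y' : Module.End k (TPow k V.carrier d)} (h : (x, y) ∈ tpowCorr V.graph d)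
    (h' : (x', y') ∈ tpowCorr V.graph d) : (x * x', y * y') ∈ tpowCorr V.graph d :=
  tpowCorr_comp (mul_mem_graph V) h' h

theorem one_mem_tpow_graph (V : EMod k q e) (d : ℕ) :
    ((1 : Module.End k (TPow k (VTensor k V.n e) d)), (1 : Module.End k (TPow k V.carrier d))) ∈
      tpowCorr V.graph d := by
  have := map_mem_tpowCorr (Γ := V.graph) (d := d) (u := fun _ => LinearMap.id)
    (u' := fun _ => LinearMap.id) fun _ => one_mem_graph V
  rwa [map_id, map_id] at this

/-- `T` is the product of the permutation `σ` and an element of `S_q^A(n;e)^{⊗d}`, and `S` is the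
product of `σ` and the action of that element on `V^{⊗d}`. -/
def Lifts (V : EMod k q e) {d : ℕ} (σ : Equiv.Perm (Fin d))
    (T : Module.End k (TPow k (VTensor k V.n e) d)) (S : Module.End k (TPow k V.carrier d)) : Prop :=
  (permOp k _ σ⁻¹ * T, permOp k _ σ⁻¹ * S) ∈ tpowCorr V.graph d

namespace Lifts

variable {V : EMod k q e} {d : ℕ} {σ τ : Equiv.Perm (Fin d)}
  {T T' : Module.End k (TPow k (VTensor k V.n e) d)} {S S' : Module.End k (TPow k V.carrier d)}

theorem one_iff : Lifts V 1 T S ↔ (T, S) ∈ tpowCorr V.graph d := by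
  rw [Lifts, inv_one, map_one, map_one, one_mul, one_mul]

theorem one : Lifts V (1 : Equiv.Perm (Fin d)) 1 1 := one_iff.2 (one_mem_tpow_graph V d)

theorem mul (h : Lifts V σ T S) (h' : Lifts V τ T' S') : Lifts V (σ * τ) (T * T') (S * S') := by
  -- Uses `(στ)⁻¹ T T' = (τ⁻¹ (σ⁻¹ T) τ) (τ⁻¹ T')`, where conjugation with `τ` preserves the tensor
  -- power of the graph.
  have h1 := mul_mem_tpow_graph (permOp_conj_mem_tpowCorr τ h) h'
  have key : ∀ (E : Type u) [AddCommGroup E] [Module k E] (x y : Module.End k (TPow k E d)),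
      (permOp k E τ⁻¹ * ((permOp k E σ⁻¹ * x) * permOp k E τ)) * (permOp k E τ⁻¹ * y) =
        permOp k E (σ * τ)⁻¹ * (x * y) := fun E _ _ x y => by
    rw [mul_inv_rev, map_mul]
    simp only [mul_assoc]
    rw [← mul_assoc (permOp k E τ), ← map_mul, mul_inv_cancel, map_one, one_mul]
  have h2 := key _ T T'
  have h3 := key _ S S'
  rw [Lifts, ← h2, ← h3]
  exact h1

/-- The transfer principle: if two products of generators agree on `(V_n^{⊗e})^{⊗d}` and carry the
same permutation, then the corresponding products on `V^{⊗d}` agree. -/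
theorem unique (h : Lifts V σ T S) (h' : Lifts V σ T S') : S = S' := by
  have h1 := tpowCorr_corr_unique h h'
  have h2 := congrArg (permOp k _ σ * ·) h1
  simpa only [← mul_assoc, ← map_mul, mul_inv_cancel, map_one, one_mul] using h2

theorem list_prod {σ : ℕ → Equiv.Perm (Fin d)} {T : ℕ → Module.End k (TPow k (VTensor k V.n e) d)}
    {S : ℕ → Module.End k (TPow k V.carrier d)} {s : ℕ} (h : ∀ l < s, Lifts V (σ l) (T l) (S l)) :
    Lifts V ((List.range s).map σ).prod ((List.range s).map T).prod ((List.range s).map S).prod := by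
  induction s with
  | zero => exact one
  | succ s ih =>
    rw [list_prod_range_succ, list_prod_range_succ, list_prod_range_succ]
    exact (ih fun l hl => h l (by omega)).mul (h s (by omega))

theorem rectProd {σ : ℕ → Equiv.Perm (Fin d)} {T : ℕ → Module.End k (TPow k (VTensor k V.n e) d)}
    {S : ℕ → Module.End k (TPow k V.carrier d)} {r s m : ℕ}
    (h : ∀ j < r, ∀ l < s, Lifts V (σ (m - j + l)) (T (m - j + l)) (S (m - j + l))) :
    Lifts V (QPoly.rectProd σ r s m) (QPoly.rectProd T r s m) (QPoly.rectProd S r s m) :=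
  list_prod fun j hj => list_prod fun l hl => h j hj l hl

end Lifts

theorem lifts_opRV (V : EMod k q e) {N d i : ℕ} (hN : N = d * e) (h1 : 1 ≤ i) (h2 : i < d) :
    Lifts V (adjSwap d i) (regroupHom hN (opTw V.n N q e i)) (V.opRV d i) := by
  subst hN
  have h := mem_tpow_graph.2 ⟨universalR_isTensor q V.n e d i h1 h2, rfl⟩
  rw [Lifts, adjSwap_inv, ← flip_eq, ← flip_eq, EMod.opRV, ← mul_assoc, flip_mul_flip, one_mul]
  exact h

theorem lifts_opKV (V : EMod k q e) (Q : kˣ) {N d : ℕ} (hN : N = d * e) :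
    Lifts V 1 (regroupHom hN (opTw0 V.n N Q q e)) (V.opKV Q d) := by
  subst hN
  exact Lifts.one_iff.2 (mem_tpow_graph.2 ⟨universalK_isTensor Q q V.n e d, rfl⟩)

theorem inducedOp_spec {N d e : ℕ} (hN : N = d * e) (V : EMod k q e)
    {s : Module.End k (VTensor k V.n N)} (hs : s ∈ schur k V.n q N) :
    (regroupHom hN s, inducedOp hN V s) ∈ tpowCorr V.graph d :=
  mem_tpow_graph.2 ⟨isTensor_of_mem_schur hN hs, rfl⟩

theorem opTw_mul_of_mem_schur {n N i : ℕ} {s : Module.End k (VTensor k n N)}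
    (hs : s ∈ schur k n q N) : Commute s (opTw n N q e i) :=
  commute_list_prod_range fun _ _ => commute_list_prod_range fun _ _ =>
    (commute_of_mem_schur hs _).symm

/-- An element of the Schur algebra commutes with every `T_l`, hence with `T_{w_i}` on tensor space.
Both products carry the permutation of `T_{w_i}`, so uniqueness of lifts moves the commutation to
`V^{⊗d}`. -/
theorem inducedOp_mem_homSpace {N d e : ℕ} (hN : N = d * e) (V : EMod k q e)
    {s : Module.End k (VTensor k V.n N)} (hs : s ∈ schur k V.n q N) :
    inducedOp hN V s ∈ EMod.homSpace V V none d := by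
  refine ⟨fun i h1 h2 => ?_, fun Q hQ => by cases hQ⟩
  have hS := Lifts.one_iff.2 (inducedOp_spec hN V hs)
  have hR := lifts_opRV V hN h1 h2
  have h := congrArg (regroupEnd hN) (opTw_mul_of_mem_schur (e := e) (i := i) hs).eq
  simp only [map_mul, regroupEnd_apply] at h
  have h3 := hS.mul hR
  have h4 := hR.mul hS
  rw [one_mul, h] at h3
  rw [mul_one] at h4
  exact h3.unique h4

theorem inducedActionWellDefined (k : Type u) [Field k] (q : kˣ) : InducedActionWellDefined k q where
  universalR_mem n e d i _ h1 h2 := universalR_isTensor q n e d i h1 h2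
  universalK_mem Q n e d _ := universalK_isTensor Q q n e d
  schur_mem hN _ _ _ hs := isTensor_of_mem_schur hN hs
  inducedOp_mem hN V _ hs := inducedOp_mem_homSpace hN V hs
  inducedOp_one hN V := by
    have h := inducedOp_spec hN V (one_mem (schur k V.n q _))
    rw [← regroupEnd_apply, map_one] at h
    exact tpowCorr_corr_unique h (one_mem_tpow_graph V _)
  inducedOp_mul hN V s hs t ht := by
    have h := inducedOp_spec hN V (mul_mem hs ht)
    rw [← regroupEnd_apply, map_mul] at h
    exact tpowCorr_corr_unique h
      (mul_mem_tpow_graph (inducedOp_spec hN V hs) (inducedOp_spec hN V ht))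

/-! ### Composition is well defined -/

theorem regroupHom_regroupHom_opTw {n c a d N b i : ℕ} (hc : c = a * d) (hb : b = d * e)
    (hN : N = c * e) (x : Fin a) (h1 : 1 ≤ i) (h2 : i < d) :
    regroupHom hc (regroupHom hN (opTw n N q e (d * x + i))) =
      ins x (regroupHom (k := k) hb (opTw n b q e i) : Module.End k _) := by
  have hN' : N = a * b := by rw [hN, hc, hb, mul_assoc]
  rw [regroupHom_regroupHom hN hc hN' hb, regroupHom_opTw hN' hb q x h1 h2, congrHom_ins]
  rfl

/-- On tensor space, a block exchange inside the `x`-th group of `d` blocks acts only in that group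
(`regroupHom_opTw`). Uniqueness of lifts gives the same for `V`. -/
theorem regroupHom_opRV (V : EMod k q e) {c a d i : ℕ} (hc : c = a * d) (x : Fin a) (h1 : 1 ≤ i)
    (h2 : i < d) : regroupHom hc (V.opRV c (d * x + i)) = ins x (V.opRV d i) := by
  have hx : d * x + d ≤ c := by
    rw [hc, ← Nat.mul_succ, mul_comm]; exact Nat.mul_le_mul_right d x.2
  rw [← LinearEquiv.eq_symm_apply]
  refine (lifts_opRV V rfl (by omega) (by omega)).unique ?_
  have h := ins_mem_tpowCorr (one_mem_tpow_graph V d) (lifts_opRV V rfl h1 h2) x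
  rw [map_mul, map_mul, adjSwap_inv, ← regroupHom_adjSwap hc h1 h2, ← regroupHom_adjSwap hc h1 h2,
    ← regroupHom_regroupHom_opTw hc rfl rfl x h1 h2] at h
  rw [Lifts, ← regroupHom_mem_tpowCorr hc, regroupHom_mul, regroupHom_mul, adjSwap_inv,
    LinearEquiv.apply_symm_apply]
  exact h

/-- Only the generators `T_{w_{db+i}}` with `1 ≤ i < d` are used, each of which acts inside one
group of `d` factors. They belong to the Hecke algebra of either type, so one argument covers both.
-/
theorem isTensor_homSpace (τ : Option kˣ) {c a d : ℕ} (hc : c = a * d) (V W : EMod k q e)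
    {x : TPow k V.carrier c →ₗ[k] TPow k W.carrier c} (hx : x ∈ EMod.homSpace V W τ c) :
    IsTensor (EMod.homSpace V W none d) a (regroupHom hc x) := by
  refine isTensor_of_intertwining (ι := {i // 1 ≤ i ∧ i < d}) _ (fun i => V.opRV d i)
    (fun i => W.opRV d i) (fun y hy => ?_) _ fun b i => ?_
  · exact ⟨fun i h1 h2 => hy ⟨i, h1, h2⟩, fun Q hQ => by cases hQ⟩
  · obtain ⟨i, h1, h2⟩ := i
    have hb : d * b + d ≤ c := by
      rw [hc, ← Nat.mul_succ, mul_comm]; exact Nat.mul_le_mul_right d b.2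
    have h := congrArg (regroupHom hc) (hx.1 (d * b + i) (by omega) (by omega))
    rwa [regroupHom_comp, regroupHom_comp, regroupHom_opRV V hc b h1 h2,
      regroupHom_opRV W hc b h1 h2] at h

/-- The graph of a polynomial functor on morphisms. -/
def polGraph {d : ℕ} (G : Pol k none q d e) (V W : EMod k q e) :
    Submodule k ((TPow k V.carrier d →ₗ[k] TPow k W.carrier d) × (ev G V →ₗ[k] ev G W)) :=
  corr (EMod.homSpace V W none d) (evHom G V W)

theorem mem_polGraph {d : ℕ} {G : Pol k none q d e} {V W : EMod k q e}
    {x : TPow k V.carrier d →ₗ[k] TPow k W.carrier d} {y : ev G V →ₗ[k] ev G W} :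
    (x, y) ∈ polGraph G V W ↔ ∃ h : x ∈ EMod.homSpace V W none d, evHom G V W ⟨x, h⟩ = y :=
  mem_corr

theorem evHom_comp {τ : Option kˣ} {d : ℕ} (G : Pol k τ q d e) {V W X : EMod k q e}
    (y : EMod.homSpace W X τ d) (x : EMod.homSpace V W τ d) :
    evHom G V X ⟨y.1 ∘ₗ x.1, EMod.comp_mem_homSpace y.2 x.2⟩ = evHom G W X y ∘ₗ evHom G V W x :=
  congrArg (fun f => f.hom.hom) (G.obj.map_comp (X := ⟨V⟩) (Y := ⟨W⟩) (Z := ⟨X⟩) x y)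

theorem evHom_id {τ : Option kˣ} {d : ℕ} (G : Pol k τ q d e) (V : EMod k q e) :
    evHom G V V ⟨LinearMap.id, EMod.id_mem_homSpace τ d⟩ = LinearMap.id :=
  congrArg (fun f => f.hom.hom) (G.obj.map_id ⟨V⟩)

theorem evHom_naturality {τ : Option kˣ} {d : ℕ} {G G' : Pol k τ q d e} (g : G ⟶ G') {V W : EMod k q e}
    (x : EMod.homSpace V W τ d) :
    evApp g W ∘ₗ evHom G V W x = evHom G' V W x ∘ₗ evApp g V :=
  congrArg (fun f => f.hom.hom) (g.hom.naturality (X := ⟨V⟩) (Y := ⟨W⟩) x)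

theorem comp_mem_polGraph {d : ℕ} {G : Pol k none q d e} {V W X : EMod k q e}
    (x : TPow k V.carrier d →ₗ[k] TPow k W.carrier d) (x' : ev G V →ₗ[k] ev G W)
    (y : TPow k W.carrier d →ₗ[k] TPow k X.carrier d) (y' : ev G W →ₗ[k] ev G X)
    (hx : (x, x') ∈ polGraph G V W) (hy : (y, y') ∈ polGraph G W X) :
    (y ∘ₗ x, y' ∘ₗ x') ∈ polGraph G V X := by
  obtain ⟨h, rfl⟩ := mem_polGraph.1 hx
  obtain ⟨h', rfl⟩ := mem_polGraph.1 hy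
  exact mem_polGraph.2 ⟨EMod.comp_mem_homSpace h' h, evHom_comp G ⟨y, h'⟩ ⟨x, h⟩⟩

theorem tpow_polGraph_unique {d a : ℕ} {G : Pol k none q d e} {V W : EMod k q e}
    {x : TPow k (TPow k V.carrier d) a →ₗ[k] TPow k (TPow k W.carrier d) a}
    {y y' : TPow k (ev G V) a →ₗ[k] TPow k (ev G W) a}
    (h : (x, y) ∈ tpowCorr (polGraph G V W) a) (h' : (x, y') ∈ tpowCorr (polGraph G V W) a) :
    y = y' :=
  have : ∀ X : EMod k q e, FiniteDimensional k (TPow k X.carrier d) := fun X =>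
    (Basis.piTensorProduct fun _ : Fin d => Module.finBasis k X.carrier).finiteDimensional_of_finite
  tpowCorr_corr_unique h h'

theorem psi_spec (τ : Option kˣ) {c a d : ℕ} (hc : c = a * d) (G : Pol k none q d e) (V W : EMod k q e)
    {x : TPow k V.carrier c →ₗ[k] TPow k W.carrier c} (hx : x ∈ EMod.homSpace V W τ c) :
    (regroupHom hc x, psi hc G V W x) ∈ tpowCorr (polGraph G V W) a :=
  mem_tpowCorr_corr.2 ⟨isTensor_homSpace τ hc V W hx, rfl⟩

/-- The action of `S_q^A(n;de)^{⊗a}` on `G(V)^{⊗a}` comes from the action of `S_q^A(n;e)^{⊗ad}` on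
`V^{⊗ad}`. -/
theorem exists_of_mem_tpow_graph_act (h : InducedActionWellDefined k q) {c a d b N : ℕ}
    (hc : c = a * d) (hb : b = d * e) (hN : N = c * e) (hN' : N = a * b) (G : Pol k none q d e)
    (V : EMod k q e) {x : Module.End k (VTensor k V.n N)} {y : Module.End k (TPow k (ev G V) a)}
    (hxy : (regroupHom hN' x, y) ∈ tpowCorr (act h hb G V).graph a) :
    ∃ m, (regroupHom hN x, m) ∈ tpowCorr V.graph c ∧
      (regroupHom hc m, y) ∈ tpowCorr (polGraph G V V) a := by
  let L : (Module.End k (VTensor k V.n b) × Module.End k (TPow k V.carrier d)) →ₗ[k]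
      (Module.End k (TPow k (VTensor k V.n e) d) × Module.End k (TPow k V.carrier d)) :=
    (regroupHom hb).toLinearMap.prodMap LinearMap.id
  -- An element `s` acts on `G(V)` by `G` applied to its action on `V^{⊗d}`. So the graph of the
  -- module `G(V)` is contained in a composite of two relations, and `tpowCorr_factor` produces the
  -- intermediate operator.
  obtain ⟨m, h1, h2⟩ := tpowCorr_factor (Γ₁ := (tpowCorr V.graph d).comap L)
    (Γ₂ := polGraph G V V) (fun s t hst => by
      obtain ⟨hs, rfl⟩ := mem_graph.1 hst
      exact ⟨inducedOp hb V s, inducedOp_spec hb V hs,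
        mem_polGraph.2 ⟨h.inducedOp_mem hb V s hs, rfl⟩⟩) hxy
  refine ⟨(regroupHom hc).symm m, ?_, by rwa [LinearEquiv.apply_symm_apply]⟩
  rw [← regroupHom_mem_tpowCorr hc, LinearEquiv.apply_symm_apply,
    regroupHom_regroupHom hN hc hN' hb]
  refine tpowCorr_induction (p := fun u m => (congrHom (regroup k (Fin V.n → k) hb)
    (regroup k (Fin V.n → k) hb) a u, m) ∈ tpowCorr (tpowCorr V.graph d) a)
    (fun u u' hu => ?_) ?_ ?_ ?_ h1
  · rw [congrHom_map]
    exact map_mem_tpowCorr hu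
  · rw [map_zero]; exact Submodule.zero_mem _
  · intro x x' y y' h h'
    rw [map_add]; exact Submodule.add_mem _ h h'
  · intro r x x' h
    rw [map_smul]; exact Submodule.smul_mem _ r h

theorem congrHom_permOp {M M' : Type u} [AddCommGroup M] [Module k M] [AddCommGroup M']
    [Module k M'] (f : M ≃ₗ[k] M') {a : ℕ} (σ : Equiv.Perm (Fin a)) :
    congrHom f f a (permOp k M σ) = permOp k M' σ := by
  refine PiTensorProduct.ext (MultilinearMap.ext fun v => ?_)
  simp only [congrHom, LinearMap.compMultilinearMap_apply, LinearEquiv.arrowCongr_apply,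
    congr_symm_tprod, permOp_tprod, congr_tprod, LinearEquiv.apply_symm_apply]

theorem regroupHom_rectProd_adjSwap_inv {M : Type u} [AddCommGroup M] [Module k M] {c a d i : ℕ}
    (h : c = a * d) (h1 : 1 ≤ i) (h2 : i < a) :
    regroupHom h (permOp k M (rectProd (adjSwap c) d d (d * i))⁻¹) =
      permOp k (TPow k M d) (adjSwap a i)⁻¹ :=
  regroupHom_permOp h _ _ fun x y => by
    rw [Equiv.Perm.inv_eq_iff_eq, rectProd_adjSwap_blockIdx h h1 h2, ← Equiv.Perm.mul_apply,
      mul_inv_cancel, Equiv.Perm.one_apply]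

/-- `m` and `y` are the actions of one element, the universal `R`-matrix for blocks of length `de`,
on `V^{⊗ad}` and on `G(V)^{⊗a}`. The permutations are split off because only this remaining part
lies in a tensor power. The rectangle appears through `rectProd_mul` and uniqueness of lifts. -/
theorem opRV_act (h : InducedActionWellDefined k q) {c a d b i : ℕ} (hc : c = a * d)
    (hb : b = d * e) (G : Pol k none q d e) (V : EMod k q e) (h1 : 1 ≤ i) (h2 : i < a) :
    ∃ m y, rectProd (V.opRV c) d d (d * i) =
        permOp k V.carrier (rectProd (adjSwap c) d d (d * i)) * m ∧
      (act h hb G V).opRV a i =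
        (permOp k (ev G V) (adjSwap a i) * y : Module.End k (TPow k (ev G V) a)) ∧
      (regroupHom hc m, y) ∈ tpowCorr (polGraph G V V) a := by
  have hN : a * b = c * e := by rw [hc, hb, mul_assoc]
  have hdi : d ≤ d * i := Nat.le_mul_of_pos_right d h1
  have hdc : d * i + d ≤ c := by
    rw [hc, ← Nat.mul_succ, mul_comm]; exact Nat.mul_le_mul_right d h2
  let T : Module.End k (VTensor k V.n (a * b)) := opTw V.n (a * b) q b i
  let r : Module.End k (TPow k (ev G V) a) := (act h hb G V).opRV a i
  -- `p` is the flip of blocks of length `b` as an operator on the ungrouped tensor space; grouped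
  -- into blocks of length `e` it becomes a permutation of `c` factors.
  obtain ⟨p, hp⟩ : ∃ p : Module.End k (VTensor k V.n (a * b)),
      regroupHom rfl p = permOp k (VTensor k V.n b) (adjSwap a i)⁻¹ :=
    (regroupHom rfl).surjective _
  have hp' : regroupHom hN p = permOp k _ (rectProd (adjSwap c) d d (d * i))⁻¹ := by
    apply (regroupHom hc).injective
    rw [regroupHom_rectProd_adjSwap_inv hc h1 h2, regroupHom_regroupHom hN hc rfl hb, hp,
      congrHom_permOp]
  have hA := lifts_opRV (act h hb G V) (N := a * b) rfl h1 h2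
  obtain ⟨m, hm, hm'⟩ := exists_of_mem_tpow_graph_act h hc hb hN rfl G V (x := p * T)
    (y := permOp k (ev G V) (adjSwap a i)⁻¹ * r) (by rw [regroupHom_mul, hp]; exact hA)
  refine ⟨m, _, ?_, ?_, hm'⟩
  · rw [regroupHom_mul, hp'] at hm
    have key : Lifts V (rectProd (adjSwap c) d d (d * i)) (regroupHom hN T)
        (permOp k _ (rectProd (adjSwap c) d d (d * i)) * m) := by
      rw [Lifts, ← mul_assoc, ← map_mul, inv_mul_cancel, map_one, one_mul]
      exact hm
    have e3 : T = rectProd (fun i => opTw V.n (a * b) q e i) d d (d * i) := by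
      subst hb
      have := rectProd_mul (T := opT (k := k) V.n (a * (d * e)) q) (e := e) (d' := d)
        (fun i j => opT_commute q) hdi
      rw [← mul_assoc e d i, mul_comm e d] at this
      exact this
    have key' : Lifts V (rectProd (adjSwap c) d d (d * i)) (regroupHom hN T)
        (rectProd (V.opRV c) d d (d * i)) := by
      rw [e3, ← regroupEnd_apply, map_rectProd]
      exact Lifts.rectProd fun j hj l hl => lifts_opRV V hN (by omega) (by omega)
    exact key'.unique key
  · rw [← mul_assoc, ← map_mul, mul_inv_cancel, map_one, one_mul]

/-- `jmProd_mul` expresses `T_{w_0}` for blocks of length `de` through the generators for length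
`e`. The assumption `0 < a` guarantees that at least `d` factors of `V` are present. -/
theorem opKV_act (h : InducedActionWellDefined k q) {c a d b : ℕ} (hc : c = a * d)
    (hb : b = d * e) (G : Pol k none q d e) (V : EMod k q e) (Q : kˣ) (ha : 0 < a) :
    (regroupHom hc ((List.range d).map (jmElt (V.opRV c) (V.opKV Q c))).prod,
      (act h hb G V).opKV Q a) ∈ tpowCorr (polGraph G V V) a := by
  have hN : a * b = c * e := by rw [hc, hb, mul_assoc]
  have hdc : d ≤ c := by rw [hc]; exact Nat.le_mul_of_pos_left d ha
  let T : Module.End k (VTensor k V.n (a * b)) := opTw0 V.n (a * b) Q q b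
  have hA := lifts_opKV (act h hb G V) Q (N := a * b) (d := a) rfl
  obtain ⟨m, hm, hm'⟩ := exists_of_mem_tpow_graph_act h hc hb hN rfl G V (x := T)
    (y := (act h hb G V).opKV Q a) (Lifts.one_iff.1 hA)
  have key : Lifts V 1 (regroupHom hN T) m := Lifts.one_iff.2 hm
  have e3 : T = ((List.range d).map (jmElt (opTw V.n (a * b) q e) (opTw0 V.n (a * b) Q q e))).prod := by
    have hle : d * e ≤ a * b := by rw [← hb]; exact Nat.le_mul_of_pos_left b ha
    have := jmProd_mul (T := opT (k := k) V.n (a * b) q) (t := opT0 V.n (a * b) Q)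
      (fun i j => opT_commute q) (fun i h h' => opT_braid q h h') (fun j => opT0_commute Q q) hle
    rw [← hb, ← opTw0_eq, ← opTw0_eq] at this
    exact this
  -- The transpositions in a Jucys-Murphy element cancel symmetrically around `T_{w_0}`, so no
  -- permutation remains.
  have hjm : ∀ j < d, Lifts V 1 (jmElt (fun i => regroupEnd hN (opTw V.n (a * b) q e i))
      (regroupEnd hN (opTw0 V.n (a * b) Q q e)) j) (jmElt (V.opRV c) (V.opKV Q c) j) := by
    intro j hj
    induction j with
    | zero => exact lifts_opKV V Q hN
    | succ j ih =>
      have hR := lifts_opRV V hN (i := j + 1) (by omega) (by omega)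
      have := (hR.mul (ih (by omega))).mul hR
      rwa [mul_one, show adjSwap c (j + 1) * adjSwap c (j + 1) = 1 from
        Equiv.ext fun x => adjSwap_adjSwap _ x] at this
  have key' : Lifts V 1 (regroupHom hN T)
      ((List.range d).map (jmElt (V.opRV c) (V.opKV Q c))).prod := by
    rw [e3, ← regroupEnd_apply, map_jmProd]
    have := Lifts.list_prod hjm
    simpa using this
  rwa [key.unique key'] at hm'

end Induced

/-! ### Hecke equivariance and naturality of `Ψ` -/

section WellDefined

open PiTensorProduct

variable {k : Type u} [Field k] {q : kˣ} {e : ℕ}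

theorem intertwine_list_prod {M N : Type u} [AddCommGroup M] [Module k M] [AddCommGroup N]
    [Module k N] (x : M →ₗ[k] N) {f : ℕ → Module.End k M} {g : ℕ → Module.End k N} {s : ℕ}
    (h : ∀ l < s, x ∘ₗ f l = g l ∘ₗ x) :
    x ∘ₗ ((List.range s).map f).prod = ((List.range s).map g).prod ∘ₗ x := by
  induction s with
  | zero => rfl
  | succ s ih =>
    rw [list_prod_range_succ, list_prod_range_succ]
    change x ∘ₗ (_ ∘ₗ _) = (_ ∘ₗ _) ∘ₗ x
    rw [← LinearMap.comp_assoc, ih fun l hl => h l (by omega), LinearMap.comp_assoc,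
      h s (by omega), LinearMap.comp_assoc]

theorem intertwine_jmElt {M N : Type u} [AddCommGroup M] [Module k M] [AddCommGroup N]
    [Module k N] (x : M →ₗ[k] N) {f : ℕ → Module.End k M} {g : ℕ → Module.End k N}
    {t : Module.End k M} {t' : Module.End k N} (ht : x ∘ₗ t = t' ∘ₗ x) {j : ℕ}
    (h : ∀ l, 1 ≤ l → l ≤ j → x ∘ₗ f l = g l ∘ₗ x) :
    x ∘ₗ jmElt f t j = jmElt g t' j ∘ₗ x := by
  induction j with
  | zero => exact ht
  | succ j ih =>
    have h1 := h (j + 1) (by omega) le_rfl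
    have h2 := ih fun l hl hl' => h l hl (by omega)
    change x ∘ₗ ((_ ∘ₗ _) ∘ₗ _) = ((_ ∘ₗ _) ∘ₗ _) ∘ₗ x
    rw [← LinearMap.comp_assoc, ← LinearMap.comp_assoc, h1, LinearMap.comp_assoc (g := x), h2,
      LinearMap.comp_assoc, LinearMap.comp_assoc, h1]
    simp only [LinearMap.comp_assoc]

/-- Rewritten as `(σ⁻¹ x σ) m = l x`, the hypothesis equates two composites of maps in the tensor
power of the domain of `G`. Functoriality of `G` and uniqueness give the same equation for the
images. -/
theorem tpow_polGraph_intertwine {d a : ℕ} {G : Pol k none q d e} {V W : EMod k q e}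
    {x : TPow k (TPow k V.carrier d) a →ₗ[k] TPow k (TPow k W.carrier d) a}
    {x' : TPow k (ev G V) a →ₗ[k] TPow k (ev G W) a}
    {m : Module.End k (TPow k (TPow k V.carrier d) a)} {m' : Module.End k (TPow k (ev G V) a)}
    {l : Module.End k (TPow k (TPow k W.carrier d) a)} {l' : Module.End k (TPow k (ev G W) a)}
    (σ : Equiv.Perm (Fin a)) (hx : (x, x') ∈ tpowCorr (polGraph G V W) a)
    (hm : (m, m') ∈ tpowCorr (polGraph G V V) a) (hl : (l, l') ∈ tpowCorr (polGraph G W W) a)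
    (h : x ∘ₗ permOp k _ σ ∘ₗ m = (permOp k _ σ ∘ₗ l) ∘ₗ x) :
    x' ∘ₗ permOp k _ σ ∘ₗ m' = (permOp k _ σ ∘ₗ l') ∘ₗ x' := by
  have h1 := tpowCorr_comp comp_mem_polGraph hm (permOp_conj_mem_tpowCorr σ hx)
  have h2 := tpowCorr_comp comp_mem_polGraph hx hl
  have hσ : ∀ (E : Type u) [AddCommGroup E] [Module k E],
      permOp k E σ⁻¹ ∘ₗ permOp k E σ = LinearMap.id := fun E _ _ => by
    have := (permOp k E).map_mul σ⁻¹ σ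
    rw [inv_mul_cancel, map_one] at this
    exact this.symm
  have hσ' : ∀ (E : Type u) [AddCommGroup E] [Module k E],
      permOp k E σ ∘ₗ permOp k E σ⁻¹ = LinearMap.id := fun E _ _ => by
    have := (permOp k E).map_mul σ σ⁻¹
    rw [mul_inv_cancel, map_one] at this
    exact this.symm
  have e1 : (permOp k _ σ⁻¹ ∘ₗ x ∘ₗ permOp k _ σ) ∘ₗ m = l ∘ₗ x := by
    rw [LinearMap.comp_assoc, LinearMap.comp_assoc, h, LinearMap.comp_assoc,
      ← LinearMap.comp_assoc, hσ, LinearMap.id_comp]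
  rw [e1] at h1
  have h3 := congrArg (fun z => permOp k _ σ ∘ₗ z) (tpow_polGraph_unique h1 h2)
  simp only [LinearMap.comp_assoc] at h3 ⊢
  rw [← LinearMap.comp_assoc, hσ', LinearMap.id_comp] at h3
  exact h3

/-- Without tensor factors all generators are the identity by convention. This covers the case `a =
0` excluded in `opKV_act`. -/
theorem opKV_zero (V : EMod k q e) (Q : kˣ) : V.opKV Q 0 = 1 := by
  refine (lifts_opKV V Q rfl).unique ?_
  have h1 : ∀ i, opT (k := k) V.n (0 * e) q i = 1 := fun i =>
    opT_eq_one q fun h => by have := h.2; omega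
  have h2 : ∀ i, jmElt (opT (k := k) V.n (0 * e) q) (opT0 V.n (0 * e) Q) i = 1 := fun i => by
    induction i with
    | zero => exact dif_neg (by omega)
    | succ i ih => rw [jmElt, ih, h1, one_mul, one_mul]
  have h3 : opTw0 V.n (0 * e) Q q e = 1 := by
    rw [opTw0_eq, funext h2]
    simp
  rw [h3, ← regroupEnd_apply, map_one]
  exact Lifts.one

theorem rectProd_opRV_intertwine {τ : Option kˣ} {c r s m : ℕ} {V W : EMod k q e}
    {x : TPow k V.carrier c →ₗ[k] TPow k W.carrier c} (hx : x ∈ EMod.homSpace V W τ c)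
    (hr : r ≤ m) (hc : m + s ≤ c) :
    x ∘ₗ rectProd (V.opRV c) r s m = rectProd (W.opRV c) r s m ∘ₗ x :=
  intertwine_list_prod x fun j hj => intertwine_list_prod x fun l hl =>
    hx.1 _ (by omega) (by omega)

/-- `x` commutes with the generators for blocks of length `e`, hence with the products of them that
represent the generators for length `de`. By `opRV_act` and `opKV_act` these products correspond
under `G` to the generators on `G(V)^{⊗a}`, so the commutation passes to `Ψ(x)`. -/
theorem psi_mem_homSpace (h : InducedActionWellDefined k q) (τ : Option kˣ) {c a d b : ℕ}
    (hc : c = a * d) (hb : b = d * e) (G : Pol k none q d e) (V W : EMod k q e)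
    {x : TPow k V.carrier c →ₗ[k] TPow k W.carrier c} (hx : x ∈ EMod.homSpace V W τ c) :
    psi hc G V W x ∈ EMod.homSpace (act h hb G V) (act h hb G W) τ a := by
  refine ⟨fun i h1 h2 => ?_, fun Q hQ => ?_⟩
  · obtain ⟨m, m', e1, e2, hm⟩ := opRV_act h hc hb G V h1 h2
    obtain ⟨l, l', f1, f2, hl⟩ := opRV_act h hc hb G W h1 h2
    rw [e2, f2]
    refine tpow_polGraph_intertwine _ (psi_spec τ hc G V W hx) hm hl ?_
    have hdi : d ≤ d * i := Nat.le_mul_of_pos_right d h1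
    have hdc : d * i + d ≤ c := by
      rw [hc, ← Nat.mul_succ, mul_comm]; exact Nat.mul_le_mul_right d h2
    have := congrArg (regroupHom hc) (rectProd_opRV_intertwine hx hdi hdc)
    rw [e1, f1, regroupHom_comp, regroupHom_comp, regroupHom_mul, regroupHom_mul,
      regroupHom_rectProd_adjSwap hc h1 h2, regroupHom_rectProd_adjSwap hc h1 h2] at this
    exact this
  · rcases Nat.eq_zero_or_pos a with rfl | ha
    · rw [opKV_zero, opKV_zero]; rfl
    · have hm := opKV_act h hc hb G V Q ha
      have hl := opKV_act h hc hb G W Q ha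
      -- The trivial permutation, since `T_{w_0}` acts without a flip.
      have key := tpow_polGraph_intertwine 1 (psi_spec τ hc G V W hx) hm hl ?_
      · rw [map_one, map_one] at key
        exact key
      · have hdc : d ≤ c := by rw [hc]; exact Nat.le_mul_of_pos_left d ha
        have : x ∘ₗ ((List.range d).map (jmElt (V.opRV c) (V.opKV Q c))).prod =
            ((List.range d).map (jmElt (W.opRV c) (W.opKV Q c))).prod ∘ₗ x :=
          intertwine_list_prod x fun j hj => intertwine_jmElt x (hx.2 Q hQ) fun l h1 h2 =>
            hx.1 l h1 (by omega)
        have := congrArg (regroupHom hc) this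
        rw [regroupHom_comp, regroupHom_comp] at this
        simpa only [map_one, Module.End.one_eq_id, LinearMap.id_comp] using this

/-- `C` is a module over the same `S_q^A(n;e)`, so one element acts on both sides. On pure tensors
the claim is equivariance of `f` in each factor. -/
theorem tensorRep_map_comp (V : EMod k q e) {C : Type u} [AddCommGroup C] [Module k C]
    [FiniteDimensional k C] (ρ : schur k V.n q e →ₐ[k] Module.End k C) (f : V.carrier →ₗ[k] C)
    (hf : ∀ s, f ∘ₗ V.ρ s = ρ s ∘ₗ f) {d : ℕ} {x : Module.End k (TPow k (VTensor k V.n e) d)}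
    (hx : IsTensor (Subalgebra.toSubmodule (schur k V.n q e)) d x) :
    (map fun _ => f) ∘ₗ V.tensorRep d x =
      (⟨V.n, V.n_pos, C, ρ⟩ : EMod k q e).tensorRep d x ∘ₗ (map fun _ => f) := by
  refine tpowCorr_induction (Γ := V.graph) (p := fun x y => (map fun _ => f) ∘ₗ y =
    (⟨V.n, V.n_pos, C, ρ⟩ : EMod k q e).tensorRep d x ∘ₗ (map fun _ => f)) (fun u u' hu => ?_)
    ?_ ?_ ?_ (mem_tpow_graph.2 ⟨hx, rfl⟩)
  · choose hs hu' using fun i => mem_graph.1 (hu i)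
    have := (mem_tpow_graph (V := ⟨V.n, V.n_pos, C, ρ⟩)).1 (map_mem_tpowCorr (d := d) (u := u)
      (u' := fun i => ρ ⟨u i, hs i⟩) fun i => mem_graph.2 ⟨hs i, rfl⟩)
    rw [this.2, ← map_comp_const, ← map_comp_const]
    congr 1
    funext i
    rw [← hu' i, hf]
  · simp
  · intro x x' y y' h h'
    rw [LinearMap.comp_add, map_add, LinearMap.add_comp, h, h']
  · intro r x x' h
    rw [LinearMap.comp_smul, map_smul, LinearMap.smul_comp, h]

theorem map_mem_homSpace (V : EMod k q e) {C : Type u} [AddCommGroup C] [Module k C]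
    [FiniteDimensional k C] (ρ : schur k V.n q e →ₐ[k] Module.End k C) (f : V.carrier →ₗ[k] C)
    (hf : ∀ s, f ∘ₗ V.ρ s = ρ s ∘ₗ f) (τ : Option kˣ) (d : ℕ) :
    (map fun _ => f) ∈ EMod.homSpace V ⟨V.n, V.n_pos, C, ρ⟩ τ d := by
  refine ⟨fun i h1 h2 => ?_, fun Q hQ => ?_⟩
  · have h := tensorRep_map_comp V ρ f hf (universalR_isTensor q V.n e d i h1 h2)
    rw [EMod.opRV, EMod.opRV, flip_eq, flip_eq]
    change _ ∘ₗ (_ ∘ₗ _) = (_ ∘ₗ _) ∘ₗ _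
    rw [← LinearMap.comp_assoc, map_comp_permOp, LinearMap.comp_assoc, h, LinearMap.comp_assoc]
  · exact tensorRep_map_comp V ρ f hf (universalK_isTensor Q q V.n e d)

theorem evApp_mem_homSpace (h : InducedActionWellDefined k q) (τ : Option kˣ) (a : ℕ) {d b : ℕ}
    (hb : b = d * e) {G G' : Pol k none q d e} (g : G ⟶ G') (V : EMod k q e) :
    (map fun _ : Fin a => evApp g V) ∈ EMod.homSpace (act h hb G V) (act h hb G' V) τ a :=
  map_mem_homSpace (act h hb G V) (act h hb G' V).ρ (evApp g V)
    (fun s => evHom_naturality g ⟨inducedOp hb V s.1, h.inducedOp_mem hb V s.1 s.2⟩) τ a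

/-- On pure tensors this is naturality of `g` in every factor. The partner `m` of `x` under `G'` is
built along the way and identified with `Ψ(x)` by uniqueness. -/
theorem psi_naturality_of_isTensor {c a d : ℕ} (hc : c = a * d) {G G' : Pol k none q d e} (g : G ⟶ G')
    (V W : EMod k q e) {x : TPow k V.carrier c →ₗ[k] TPow k W.carrier c} (τ : Option kˣ)
    (hx : x ∈ EMod.homSpace V W τ c) :
    (map fun _ : Fin a => evApp g W) ∘ₗ psi hc G V W x =
      psi hc G' V W x ∘ₗ map fun _ : Fin a => evApp g V := by
  have hfin : ∀ X : EMod k q e, FiniteDimensional k (TPow k X.carrier d) := fun X =>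
    (Basis.piTensorProduct fun _ : Fin d => Module.finBasis k X.carrier).finiteDimensional_of_finite
  obtain ⟨m, h1, h2⟩ : ∃ m, (regroupHom hc x, m) ∈ tpowCorr (polGraph G' V W) a ∧
      (map fun _ : Fin a => evApp g W) ∘ₗ psi hc G V W x = m ∘ₗ map fun _ : Fin a => evApp g V := by
    refine tpowCorr_induction (p := fun x y => ∃ m, (x, m) ∈ tpowCorr (polGraph G' V W) a ∧
      (map fun _ : Fin a => evApp g W) ∘ₗ y = m ∘ₗ map fun _ : Fin a => evApp g V)
      (fun u u' hu => ?_) ?_ ?_ ?_ (psi_spec τ hc G V W hx)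
    · choose hs hu' using fun i => mem_polGraph.1 (hu i)
      refine ⟨map fun i => evHom G' V W ⟨u i, hs i⟩,
        map_mem_tpowCorr fun i => mem_polGraph.2 ⟨hs i, rfl⟩, ?_⟩
      rw [← map_comp_const, ← map_comp_const]
      congr 1
      funext i
      rw [← hu' i, evHom_naturality]
    · exact ⟨0, Submodule.zero_mem _, by simp⟩
    · rintro x x' y y' ⟨m, h1, h2⟩ ⟨m', h1', h2'⟩
      exact ⟨m + m', Submodule.add_mem _ h1 h1', by
        rw [LinearMap.comp_add, LinearMap.add_comp, h2, h2']⟩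
    · rintro r x x' ⟨m, h1, h2⟩
      exact ⟨r • m, Submodule.smul_mem _ r h1, by
        rw [LinearMap.comp_smul, LinearMap.smul_comp, h2]⟩
  rw [h2, tpow_polGraph_unique h1 (psi_spec τ hc G' V W hx)]

theorem compositionWellDefined (h : InducedActionWellDefined k q) : CompositionWellDefined h where
  isTensor τ _ _ _ _ hc V W _ hx := isTensor_homSpace τ hc V W hx
  psi_mem τ _ _ _ _ _ hc hb G V W _ hx := psi_mem_homSpace h τ hc hb G V W hx
  psi_id {_ a _ _} hc G V := by
    have h1 := psi_spec none hc G V V (EMod.id_mem_homSpace none _)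
    rw [regroupHom_id] at h1
    refine tpow_polGraph_unique h1 ?_
    have := map_mem_tpowCorr (Γ := polGraph G V V) (d := a) (u := fun _ => LinearMap.id)
      (u' := fun _ => LinearMap.id) fun _ => mem_polGraph.2 ⟨EMod.id_mem_homSpace none _, evHom_id G V⟩
    rwa [map_id, map_id] at this
  psi_comp τ _ _ _ _ hc G V W X x hx y hy := by
    have h1 := psi_spec τ hc G V X (EMod.comp_mem_homSpace hy hx)
    rw [regroupHom_comp] at h1
    exact tpow_polGraph_unique h1 (tpowCorr_comp comp_mem_polGraph (psi_spec τ hc G V W hx)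
      (psi_spec τ hc G W X hy))
  map_mem τ a _ _ _ hb _ _ g V := evApp_mem_homSpace h τ a hb g V
  psi_naturality τ _ _ _ _ hc _ _ g V W _ hx := psi_naturality_of_isTensor hc g V W τ hx

end WellDefined

/-! ### Morphisms of polynomial functors by components -/

section Morphisms

variable {k : Type u} [Field k] {q : kˣ} {e : ℕ} {τ : Option kˣ} {d : ℕ}

/-- A morphism of polynomial functors from its components. -/
def Pol.mkHom {F F' : Pol k τ q d e} (f : ∀ V : EMod k q e, ev F V →ₗ[k] ev F' V)
    (hf : ∀ (V W : EMod k q e) (x : EMod.homSpace V W τ d),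
      f W ∘ₗ evHom F V W x = evHom F' V W x ∘ₗ f V) : F ⟶ F' :=
  ObjectProperty.homMk
    { app V := FGModuleCat.ofHom (f V.toEMod)
      naturality V W x := FGModuleCat.hom_ext (hf V.toEMod W.toEMod x) }

theorem Pol.isIso_of_bijective {F F' : Pol k τ q d e} (f : F ⟶ F')
    (h : ∀ V, Function.Bijective (evApp f V)) : IsIso f := by
  have h1 : ∀ V, IsIso (f.hom.app V) := fun V => by
    have : IsIso ((forget (FGModuleCat k)).map (f.hom.app V)) :=
      (isIso_iff_bijective _).2 (h V.toEMod)
    exact isIso_of_reflects_iso _ (forget (FGModuleCat k))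
  have h2 : IsIso f.hom := NatIso.isIso_of_isIso_app _
  have h3 : IsIso ((ObjectProperty.ι _).map f) := h2
  exact isIso_of_reflects_iso f (ObjectProperty.ι _)

variable {h : InducedActionWellDefined k q} (H : CompositionWellDefined h)

theorem evHom_comp_pol {c a b : ℕ} (hc : c = a * d) (hb : b = d * e) (F : Pol k τ q a b)
    (G : Pol k none q d e) {V W : EMod k q e} (x : EMod.homSpace V W τ c) :
    evHom (comp H hc hb F G) V W x =
      evHom F (act h hb G V) (act h hb G W) ⟨psi hc G V W x.1, H.psi_mem τ hc hb G V W x.1 x.2⟩ := rfl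

end Morphisms

/-! ### Associativity of homogeneous composition -/

section Associativity

open PiTensorProduct

variable {k : Type u} [Field k] {q : kˣ} {e : ℕ}

theorem congrHom_mem_tpowCorr {M N M' N' : Type u} [AddCommGroup M] [Module k M] [AddCommGroup N]
    [Module k N] [AddCommGroup M'] [Module k M'] [AddCommGroup N'] [Module k N']
    {M'' N'' : Type u} [AddCommGroup M''] [Module k M''] [AddCommGroup N''] [Module k N'']
    {Γ : Submodule k ((M' →ₗ[k] N') × (M'' →ₗ[k] N''))} (f : M ≃ₗ[k] M') (g : N ≃ₗ[k] N') {a : ℕ}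
    {x : TPow k M a →ₗ[k] TPow k N a} {y : TPow k M'' a →ₗ[k] TPow k N'' a}
    (hxy : (x, y) ∈ tpowCorr (Γ.comap
      ((f.arrowCongr g).toLinearMap.prodMap (LinearMap.id (M := M'' →ₗ[k] N'')))) a) :
    (congrHom f g a x, y) ∈ tpowCorr Γ a := by
  refine tpowCorr_induction (p := fun u m => (congrHom f g a u, m) ∈ tpowCorr Γ a)
    (fun u u' hu => ?_) ?_ ?_ ?_ hxy
  · rw [congrHom_map]
    exact map_mem_tpowCorr hu
  · rw [map_zero]; exact Submodule.zero_mem _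
  · intro x x' y y' h h'
    rw [map_add]; exact Submodule.add_mem _ h h'
  · intro r x x' h
    rw [map_smul]; exact Submodule.smul_mem _ r h

/-- The action on `K(V)^{⊗d}` factors through the action on `V^{⊗dd'}` by
`exists_of_mem_tpow_graph_act`; uniqueness identifies both steps of the factorization. -/
theorem inducedOp_act (h : InducedActionWellDefined k q) {d d' y e' N : ℕ} (hc : y = d * d')
    (he : e' = d' * e) (hN : N = d * e') (hN' : N = y * e) (K : Pol k none q d' e) (V : EMod k q e)
    {s : Module.End k (VTensor k V.n N)} (hs : s ∈ schur k V.n q N) :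
    inducedOp hN (act h he K V) s = psi hc K V V (inducedOp hN' V s) := by
  obtain ⟨m, h1, h2⟩ := exists_of_mem_tpow_graph_act h hc he hN' hN K V
    (inducedOp_spec hN (act h he K V) hs)
  rw [tpowCorr_corr_unique h1 (inducedOp_spec hN' V hs)] at h2
  exact tpow_polGraph_unique h2 (psi_spec none hc K V V (h.inducedOp_mem hN' V s hs))

variable {h : InducedActionWellDefined k q} (H : CompositionWellDefined h)

/-- Serves for modules with the same carrier whose actions agree only propositionally, such as
`G(K(V))` and `(G ∘ K)(V)`. -/
theorem id_mem_homSpace_of_ρ_eq (V : EMod k q e) (ρ : schur k V.n q e →ₐ[k] Module.End k V.carrier)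
    (hρ : V.ρ = ρ) (τ : Option kˣ) (a : ℕ) :
    LinearMap.id ∈ EMod.homSpace V ⟨V.n, V.n_pos, V.carrier, ρ⟩ τ a := by
  subst hρ
  exact EMod.id_mem_homSpace τ a

/-- The identity is a homomorphism `G(K(V)) → (G ∘ K)(V)`. -/
theorem id_mem_homSpace_act_act (τ : Option kˣ) (a : ℕ) {d d' y e' N : ℕ} (hc : y = d * d')
    (he : e' = d' * e) (hN : N = d * e') (hN' : N = y * e) (G : Pol k none q d e')
    (K : Pol k none q d' e) (V : EMod k q e) :
    (LinearMap.id : TPow k (ev G (act h he K V)) a →ₗ[k] TPow k (ev G (act h he K V)) a) ∈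
      EMod.homSpace (act h hN G (act h he K V)) (act h hN' (comp H hc he G K) V) τ a := by
  refine id_mem_homSpace_of_ρ_eq (act h hN G (act h he K V)) (act h hN' (comp H hc he G K) V).ρ
    (AlgHom.ext fun s => ?_) τ a
  refine congrArg (evHom G (act h he K V) (act h he K V)) (Subtype.ext ?_)
  exact inducedOp_act h hc he hN hN' K V s.2

/-- The graph of `G ∘ K` is contained in the composite of the graph of `Ψ` for `K` with that of `G`.
Its tensor power therefore factors through an intermediate map, which regrouping and uniqueness
identify with `Ψ(z)` for `K`. -/
theorem psi_comp_pol (τ : Option kˣ) {c a d d' x y e' : ℕ} (h1 : c = x * d') (h2 : x = a * d)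
    (h3 : c = a * y) (hc : y = d * d') (he : e' = d' * e) (G : Pol k none q d e')
    (K : Pol k none q d' e) (V W : EMod k q e) {z : TPow k V.carrier c →ₗ[k] TPow k W.carrier c}
    (hz : z ∈ EMod.homSpace V W τ c) :
    psi h3 (comp H hc he G K) V W z =
      psi h2 G (act h he K V) (act h he K W) (psi h1 K V W z) := by
  obtain ⟨m, hm, hm'⟩ := tpowCorr_factor
    (Γ₁ := (tpowCorr (polGraph K V W) d).comap
      (((regroup k V.carrier hc).arrowCongr (regroup k W.carrier hc)).toLinearMap.prodMap
        (LinearMap.id (M := TPow k (ev K V) d →ₗ[k] TPow k (ev K W) d))))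
    (Γ₂ := polGraph G (act h he K V) (act h he K W)) (fun s t hst => by
      obtain ⟨hs, rfl⟩ := mem_polGraph.1 hst
      exact ⟨psi hc K V W s, psi_spec none hc K V W hs,
        mem_polGraph.2 ⟨H.psi_mem none hc he K V W s hs, rfl⟩⟩)
    (psi_spec τ h3 (comp H hc he G K) V W hz)
  have h4 := congrHom_mem_tpowCorr _ _ hm
  rw [← regroupHom_regroupHom h1 h2 h3 hc] at h4
  obtain ⟨n, rfl⟩ := (regroupHom h2).surjective m
  rw [regroupHom_mem_tpowCorr h2] at h4
  rw [tpow_polGraph_unique h4 (psi_spec τ h1 K V W hz)] at hm'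
  exact tpow_polGraph_unique (G := G) (V := act h he K V) (W := act h he K W) hm'
    (psi_spec τ h2 G (act h he K V) (act h he K W)
    (H.psi_mem τ h1 he K V W z hz))

/-- The isomorphism `(F ∘ G) ∘ K ≅ F ∘ (G ∘ K)`. -/
theorem nonempty_assoc (τ : Option kˣ) {c a d d' x y e b b' : ℕ} (h1 : c = x * d') (h2 : x = a * d)
    (h3 : c = a * y) (hc : y = d * d') (he : e = d' * b) (hN : b' = d * e) (hN' : b' = y * b)
    (F : Pol k τ q a b') (G : Pol k none q d e) (K : Pol k none q d' b) :
    Nonempty (comp H h1 he (comp H h2 hN F G) K ≅ comp H h3 hN' F (comp H hc he G K)) := by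
  -- Both composites evaluate `F` at modules with a common carrier. The component is `F` of the
  -- identity map, and the inverse is `F` of the identity in the other direction.
  let f : comp H h1 he (comp H h2 hN F G) K ⟶ comp H h3 hN' F (comp H hc he G K) :=
    Pol.mkHom (fun V => evHom F (act h hN G (act h he K V)) (act h hN' (comp H hc he G K) V)
      ⟨_, id_mem_homSpace_act_act H τ a hc he hN hN' G K V⟩) fun V W z => by
        rw [evHom_comp_pol, evHom_comp_pol, evHom_comp_pol]
        refine (evHom_comp F _ _).symm.trans (Eq.trans ?_ (evHom_comp F _ _))
        refine congrArg (evHom F _ _) (Subtype.ext ?_)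
        exact (psi_comp_pol H τ h1 h2 h3 hc he G K V W z.2).symm
  have : IsIso f := Pol.isIso_of_bijective f fun V => by
    have h' : (LinearMap.id : TPow k (ev G (act h he K V)) a →ₗ[k] TPow k (ev G (act h he K V)) a) ∈
      EMod.homSpace (act h hN' (comp H hc he G K) V) (act h hN G (act h he K V)) τ a :=
      ⟨fun i h1 h2 => ((id_mem_homSpace_act_act H τ a hc he hN hN' G K V).1 i h1 h2).symm,
        fun Q hQ => ((id_mem_homSpace_act_act H τ a hc he hN hN' G K V).2 Q hQ).symm⟩
    refine Function.bijective_iff_has_inverse.2 ⟨evHom F (act h hN' (comp H hc he G K) V)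
      (act h hN G (act h he K V)) ⟨_, h'⟩, fun t => ?_, fun t => ?_⟩
    · exact LinearMap.congr_fun ((evHom_comp F ⟨_, h'⟩
        ⟨_, id_mem_homSpace_act_act H τ a hc he hN hN' G K V⟩).symm.trans (evHom_id F _)) t
    · exact LinearMap.congr_fun ((evHom_comp F
        ⟨_, id_mem_homSpace_act_act H τ a hc he hN hN' G K V⟩ ⟨_, h'⟩).symm.trans (evHom_id F _)) t
  exact ⟨asIso f⟩

end Associativity

/-! ### Unitality of homogeneous composition -/

section Units

open PiTensorProduct

variable {k : Type u} [Field k] {q : kˣ} {e : ℕ} {d : ℕ}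

theorem mem_homSpace_of_eq_one (hd : d = 1) {V W : EMod k q e}
    (x : TPow k V.carrier d →ₗ[k] TPow k W.carrier d) : x ∈ EMod.homSpace V W none d :=
  ⟨fun i h1 h2 => by omega, fun Q hQ => by cases hQ⟩

theorem subsingletonEquiv_arrowCongr_map {ι M N : Type*} [AddCommGroup M] [Module k M]
    [AddCommGroup N] [Module k N] [Subsingleton ι] [Fintype ι] [DecidableEq ι] (i : ι)
    (u : ι → (M →ₗ[k] N)) :
    (subsingletonEquiv (R := k) (s := fun _ => M) i).arrowCongr
      (subsingletonEquiv (R := k) (s := fun _ => N) i) (map u) = u i := by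
  refine LinearMap.ext fun v => ?_
  have h1 : (subsingletonEquiv (R := k) (s := fun _ => M) i).symm v =
      PiTensorProduct.tprod k fun _ => v := by
    rw [LinearEquiv.symm_apply_eq, subsingletonEquiv_apply_tprod]
  rw [LinearEquiv.arrowCongr_apply, h1, map_tprod, subsingletonEquiv_apply_tprod]

theorem evHom_idPol_map (hd : d = 1) {V W : EMod k q e} (u : Fin d → (V.carrier →ₗ[k] W.carrier))
    (hu : map u ∈ EMod.homSpace V W none d) (i : Fin d) :
    evHom (idPol hd e) V W ⟨map u, hu⟩ = u i := by
  subst hd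
  obtain rfl := Subsingleton.elim i 0
  exact subsingletonEquiv_arrowCongr_map (0 : Fin 1) u

theorem regroup_one_left {M : Type u} [AddCommGroup M] [Module k M] {a c : ℕ} (ha : a = 1)
    (hc : c = a * c) (t : TPow k M c) : regroup k M hc t = PiTensorProduct.tprod k fun _ => t := by
  subst ha
  have : ∀ (i : Fin 1) j, blockIdx hc (i, j) = j := fun i j => Fin.ext (by simp [blockIdx_val])
  induction t using PiTensorProduct.induction_on with
  | smul_tprod r f =>
    have h1 := (PiTensorProduct.tprod k).map_smul_univ (fun _ : Fin 1 => r) fun _ => PiTensorProduct.tprod k f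
    rw [h1, map_smul, regroup_tprod, Finset.prod_const, Finset.card_univ, Fintype.card_fin, pow_one]
    congr 1
    refine congrArg (PiTensorProduct.tprod k) (funext fun i => ?_)
    exact congrArg (PiTensorProduct.tprod k) (funext fun j => congrArg f (this i j))
  | add x y hx hy =>
    rw [map_add, hx, hy]
    have h1 := (PiTensorProduct.tprod (R := k) (s := fun _ : Fin 1 => TPow k M c)).map_update_add
      (fun _ => x) 0 x y
    have h2 : ∀ z : TPow k M c, Function.update (fun _ : Fin 1 => x) 0 z = fun _ => z := fun z =>
      funext fun i => by obtain rfl := Subsingleton.elim i 0; simp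
    simpa only [h2] using h1.symm

theorem regroupHom_one_left {M N : Type u} [AddCommGroup M] [Module k M] [AddCommGroup N]
    [Module k N] {a c : ℕ} (ha : a = 1) (hc : c = a * c) (x : TPow k M c →ₗ[k] TPow k N c) :
    regroupHom hc x = map fun _ => x := by
  refine LinearMap.ext fun t => ?_
  obtain ⟨t, rfl⟩ := (regroup k M hc).surjective t
  rw [regroupHom, LinearEquiv.arrowCongr_apply, LinearEquiv.symm_apply_apply,
    regroup_one_left ha, regroup_one_left ha, map_tprod]

theorem psi_eq_of_mem {c a : ℕ} (hc : c = a * d) {G : Pol k none q d e} {V W : EMod k q e}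
    {x : TPow k V.carrier c →ₗ[k] TPow k W.carrier c} {y : TPow k (ev G V) a →ₗ[k] TPow k (ev G W) a}
    (hxy : (regroupHom hc x, y) ∈ tpowCorr (polGraph G V W) a) : psi hc G V W x = y :=
  have : ∀ X : EMod k q e, FiniteDimensional k (TPow k X.carrier d) := fun X =>
    (Basis.piTensorProduct fun _ : Fin d => Module.finBasis k X.carrier).finiteDimensional_of_finite
  (mem_tpowCorr_corr.1 hxy).2

/-- Every map `M^{⊗c} → N^{⊗c}` is a combination of pure tensors, and on these the relation only has
to be known in each factor. -/
theorem regroupHom_one_right_mem {M N : Type u} [AddCommGroup M] [Module k M] [AddCommGroup N]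
    [Module k N] [FiniteDimensional k M] [FiniteDimensional k N] {c : ℕ} (hd : d = 1)
    (hc : c = c * d) {Γ : Submodule k ((TPow k M d →ₗ[k] TPow k N d) × (M →ₗ[k] N))}
    (hΓ : ∀ (u : Fin d → (M →ₗ[k] N)) (i : Fin d), (map u, u i) ∈ Γ)
    (x : TPow k M c →ₗ[k] TPow k N c) : (regroupHom hc x, x) ∈ tpowCorr Γ c := by
  have h : (⊤ : Submodule k (TPow k M c →ₗ[k] TPow k N c)) ≤
      (tpowCorr Γ c).comap ((regroupHom hc).toLinearMap.prod LinearMap.id) := by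
    rw [← LinearMap.range_eq_top.2 (piTensorHomMap_surjective c), LinearMap.range_eq_map,
      ← PiTensorProduct.span_tprod_eq_top, Submodule.map_span, Submodule.span_le]
    rintro _ ⟨_, ⟨u, rfl⟩, rfl⟩
    have h1 : ∀ i, u i = u (blockIdx hc (i, ⟨0, by omega⟩)) := fun i => congrArg u (Fin.ext (by
      subst hd
      simp [blockIdx_val]))
    have h2 : (map (fun i => map fun j => u (blockIdx hc (i, j))), map u) ∈ tpowCorr Γ c :=
      map_mem_tpowCorr fun i => by
        rw [h1 i]
        exact hΓ (fun j => u (blockIdx hc (i, j))) _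
    rw [← regroup_map hc u] at h2
    rw [piTensorHomMap_tprod_eq_map]
    exact h2
  exact h trivial

theorem psi_idPol {c : ℕ} (hd : d = 1) (hc : c = c * d) (V W : EMod k q e)
    (x : TPow k V.carrier c →ₗ[k] TPow k W.carrier c) : psi hc (idPol hd e) V W x = x :=
  psi_eq_of_mem hc (regroupHom_one_right_mem hd hc (Γ := polGraph (idPol hd e) V W)
    (fun u i => mem_polGraph.2 ⟨mem_homSpace_of_eq_one hd _, evHom_idPol_map hd u _ i⟩) x)

theorem psi_one_left {a c : ℕ} (ha : a = 1) (hc : c = a * c) (G : Pol k none q c e) (V W : EMod k q e)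
    {x : TPow k V.carrier c →ₗ[k] TPow k W.carrier c} (hx : x ∈ EMod.homSpace V W none c) :
    psi hc G V W x = map fun _ => evHom G V W ⟨x, hx⟩ := by
  refine psi_eq_of_mem hc ?_
  rw [regroupHom_one_left ha]
  exact map_mem_tpowCorr fun _ => mem_polGraph.2 ⟨hx, rfl⟩

theorem inducedOp_one_left (hd : d = 1) (hb : e = d * e) (V : EMod k q e)
    (s : schur k V.n q e) : inducedOp hb V s = map fun _ => V.ρ s := by
  have h1 : (regroupHom hb s.1, map fun _ => V.ρ s) ∈ tpowCorr V.graph d := by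
    rw [regroupHom_one_left hd]
    exact map_mem_tpowCorr fun _ => mem_graph.2 ⟨s.2, rfl⟩
  exact tpowCorr_corr_unique (inducedOp_spec hb V s.2) h1

theorem id_mem_homSpace_act_idPol (h : InducedActionWellDefined k q) (τ : Option kˣ) (a : ℕ)
    (hd : d = 1) (hb : e = d * e) (V : EMod k q e) :
    (LinearMap.id : TPow k V.carrier a →ₗ[k] TPow k V.carrier a) ∈
      EMod.homSpace V (act h hb (idPol hd e) V) τ a := by
  refine id_mem_homSpace_of_ρ_eq V (act h hb (idPol hd e) V).ρ (AlgHom.ext fun s => ?_) τ a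
  have h1 := inducedOp_one_left hd hb V s
  have h2 : (map fun _ => V.ρ s) ∈ EMod.homSpace V V none d := mem_homSpace_of_eq_one hd _
  refine (evHom_idPol_map hd _ h2 ⟨0, by omega⟩).symm.trans ?_
  exact congrArg (evHom (idPol hd e) V V) (Subtype.ext h1.symm)

variable {h : InducedActionWellDefined k q} (H : CompositionWellDefined h)

theorem evHom_idPol_comp {a c b : ℕ} (ha : a = 1) (hc : c = a * c) (hb : b = c * e)
    (G : Pol k none q c e) {V W : EMod k q e} (x : EMod.homSpace V W none c) :
    evHom (comp H hc hb (idPol ha b) G) V W x = evHom G V W x := by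
  rw [evHom_comp_pol]
  have h1 := psi_one_left ha hc G V W x.2
  have h2 : (map fun _ => evHom G V W x) ∈
    EMod.homSpace (act h hb G V) (act h hb G W) none a := mem_homSpace_of_eq_one ha _
  refine Eq.trans ?_ (evHom_idPol_map ha _ h2 ⟨0, by omega⟩)
  exact congrArg (evHom (idPol ha b) _ _) (Subtype.ext h1)

/-- The isomorphism `Id ∘ G ≅ G`. -/
theorem nonempty_leftUnit {a c b : ℕ} (ha : a = 1) (hc : c = a * c) (hb : b = c * e)
    (G : Pol k none q c e) : Nonempty (comp H hc hb (idPol ha b) G ≅ G) := by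
  let f : comp H hc hb (idPol ha b) G ⟶ G := Pol.mkHom (fun V => LinearMap.id) fun V W x => by
    rw [evHom_idPol_comp]
    rfl
  have : IsIso f := Pol.isIso_of_bijective f fun V => Function.bijective_id
  exact ⟨asIso f⟩

/-- The isomorphism `F ∘ Id ≅ F`. -/
theorem nonempty_rightUnit {τ : Option kˣ} {c : ℕ} (hd : d = 1) (hc : c = c * d) (hb : e = d * e)
    (F : Pol k τ q c e) : Nonempty (comp H hc hb F (idPol hd e) ≅ F) := by
  let f : F ⟶ comp H hc hb F (idPol hd e) :=
    Pol.mkHom (fun V => evHom F V (act h hb (idPol hd e) V)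
      ⟨_, id_mem_homSpace_act_idPol h τ c hd hb V⟩) fun V W z => by
        rw [evHom_comp_pol]
        refine (evHom_comp F _ _).symm.trans (Eq.trans ?_ (evHom_comp F _ _))
        refine congrArg (evHom F _ _) (Subtype.ext ?_)
        exact (psi_idPol hd hc V W z.1).symm
  have : IsIso f := Pol.isIso_of_bijective f fun V => by
    have h' : (LinearMap.id : TPow k V.carrier c →ₗ[k] TPow k V.carrier c) ∈
      EMod.homSpace (act h hb (idPol hd e) V) V τ c :=
      ⟨fun i h1 h2 => ((id_mem_homSpace_act_idPol h τ c hd hb V).1 i h1 h2).symm,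
        fun Q hQ => ((id_mem_homSpace_act_idPol h τ c hd hb V).2 Q hQ).symm⟩
    refine Function.bijective_iff_has_inverse.2 ⟨evHom F (act h hb (idPol hd e) V) V ⟨_, h'⟩,
      fun t => ?_, fun t => ?_⟩
    · exact LinearMap.congr_fun ((evHom_comp F ⟨_, h'⟩
        ⟨_, id_mem_homSpace_act_idPol h τ c hd hb V⟩).symm.trans (evHom_id F _)) t
    · exact LinearMap.congr_fun ((evHom_comp F
        ⟨_, id_mem_homSpace_act_idPol h τ c hd hb V⟩ ⟨_, h'⟩).symm.trans (evHom_id F _)) t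
  exact ⟨(asIso f).symm⟩

end Units

/-! ### Modules of all degrees at once: equalities of degrees as propositions instead of casts -/

section GradedModules

variable {k : Type u} [Field k] {q : kˣ}

theorem psi_map {c a d e : ℕ} (hc : c = a * d) (G : Pol k none q d e) {V W : EMod k q e}
    (f : V.carrier →ₗ[k] W.carrier)
    (hf : (PiTensorProduct.map fun _ => f) ∈ EMod.homSpace V W none d) :
    psi hc G V W (PiTensorProduct.map fun _ => f) =
      PiTensorProduct.map fun _ => evHom G V W ⟨_, hf⟩ := by
  refine psi_eq_of_mem hc ?_
  rw [regroup_map]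
  exact map_mem_tpowCorr fun _ => mem_polGraph.2 ⟨hf, rfl⟩

variable (k q) in
/-- Modules over the algebras `S_q^A(n;e)`, for all `e ≥ 1`. -/
structure GMod where
  deg : ℕ+
  mod : EMod k q deg

/-- A homomorphism: a linear map between modules of the same degree all of whose tensor powers commute
with the action of the `e`-Hecke algebras of type A and B. -/
@[ext]
structure GMod.Hom (V W : GMod k q) where
  toLin : V.mod.carrier →ₗ[k] W.mod.carrier
  deg_eq : V.deg = W.deg
  comm_opRV : ∀ a i, 1 ≤ i → i < a → (PiTensorProduct.map fun _ => toLin) ∘ₗ V.mod.opRV a i =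
    W.mod.opRV a i ∘ₗ PiTensorProduct.map fun _ => toLin
  comm_opKV : ∀ a Q, (PiTensorProduct.map fun _ => toLin) ∘ₗ V.mod.opKV Q a =
    W.mod.opKV Q a ∘ₗ PiTensorProduct.map fun _ => toLin

instance : Category (GMod k q) where
  Hom := GMod.Hom
  id V := ⟨LinearMap.id, rfl, fun a i _ _ => by rw [PiTensorProduct.map_id]; rfl,
    fun a Q => by rw [PiTensorProduct.map_id]; rfl⟩
  comp {V W X} f g := ⟨g.toLin ∘ₗ f.toLin, f.deg_eq.trans g.deg_eq, fun a i h1 h2 => by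
      rw [PiTensorProduct.map_comp, LinearMap.comp_assoc, f.comm_opRV a i h1 h2,
        ← LinearMap.comp_assoc, g.comm_opRV a i h1 h2, LinearMap.comp_assoc],
    fun a Q => by
      rw [PiTensorProduct.map_comp, LinearMap.comp_assoc, f.comm_opKV a Q,
        ← LinearMap.comp_assoc, g.comm_opKV a Q, LinearMap.comp_assoc]⟩

namespace GMod

theorem hom_ext {V W : GMod k q} {f g : V ⟶ W} (h : f.toLin = g.toLin) : f = g := Hom.ext h

/-- A homomorphism of modules of the same degree. -/
def homMk {b : ℕ+} {V W : EMod k q b} (f : V.carrier →ₗ[k] W.carrier)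
    (hf : ∀ τ a, (PiTensorProduct.map fun _ => f) ∈ EMod.homSpace V W τ a) :
    (⟨b, V⟩ : GMod k q) ⟶ ⟨b, W⟩ :=
  ⟨f, rfl, fun a i => (hf none a).1 i, fun a Q => (hf (some Q) a).2 Q rfl⟩

theorem Hom.mem_homSpace {b : ℕ+} {V W : EMod k q b} (f : Hom (⟨b, V⟩ : GMod k q) ⟨b, W⟩)
    (τ : Option kˣ)
    (a : ℕ) : (PiTensorProduct.map fun _ => f.toLin) ∈ EMod.homSpace V W τ a :=
  ⟨fun i => f.comm_opRV a i, fun Q _ => f.comm_opKV a Q⟩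

end GMod

variable {τ : Option kˣ}

/-- The map `F_{a,b}(V) → F_{a,b}(W)` induced by a homomorphism. -/
def Fam.fnMap (F : Fam k τ q) (a : ℕ+) : {V W : GMod k q} → (V ⟶ W) →
    (ev (F (a, V.deg)) V.mod ⟶ ev (F (a, W.deg)) W.mod)
  | ⟨b, V⟩, ⟨b', W⟩, f => by
    obtain rfl : b = b' := GMod.Hom.deg_eq f
    exact FGModuleCat.ofHom (evHom (F (a, b)) V W ⟨_, GMod.Hom.mem_homSpace f τ a⟩)

/-- The functor `V ↦ F_{a,b}(V)` on modules of all degrees `b`. -/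
def Fam.fn (F : Fam k τ q) (a : ℕ+) : GMod k q ⥤ FGModuleCat.{u} k where
  obj V := ev (F (a, V.deg)) V.mod
  map f := F.fnMap a f
  map_id V := by
    apply FGModuleCat.hom_ext
    refine Eq.trans ?_ (evHom_id (F (a, V.deg)) V.mod)
    exact congrArg (evHom (F (a, V.deg)) V.mod V.mod) (Subtype.ext (by exact PiTensorProduct.map_id))
  map_comp {V W X} f g := by
    obtain ⟨b, V⟩ := V
    obtain ⟨b', W⟩ := W
    obtain ⟨b'', X⟩ := X
    obtain rfl : b = b' := f.deg_eq
    obtain rfl : b = b'' := g.deg_eq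
    apply FGModuleCat.hom_ext
    refine Eq.trans ?_ (evHom_comp (F (a, b)) ⟨_, GMod.Hom.mem_homSpace g τ a⟩
      ⟨_, GMod.Hom.mem_homSpace f τ a⟩)
    exact congrArg (evHom (F (a, b)) V X) (Subtype.ext (PiTensorProduct.map_comp _ _))

/-- The components of a morphism of families. -/
def Fam.app {F F' : Fam k τ q} (f : F ⟶ F') (a : ℕ+) : F.fn a ⟶ F'.fn a where
  app V := (f (a, V.deg)).hom.app ⟨V.mod⟩
  naturality V W x := by
    obtain ⟨b, V⟩ := V
    obtain ⟨b', W⟩ := W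
    obtain rfl : b = b' := x.deg_eq
    exact (f (a, b)).hom.naturality (X := ⟨V⟩) (Y := ⟨W⟩)
      ⟨_, GMod.Hom.mem_homSpace x τ a⟩

theorem Fam.hom_ext {F F' : Fam k τ q} {f g : F ⟶ F'}
    (h : ∀ (a : ℕ+) (V : GMod k q), (Fam.app f a).app V = (Fam.app g a).app V) : f = g := by
  funext s
  apply ObjectProperty.hom_ext
  ext V : 2
  exact h s.1 ⟨s.2, V.toEMod⟩

theorem Fam.app_comp {F F' F'' : Fam k τ q} (f : F ⟶ F') (g : F' ⟶ F'') (a : ℕ+) (V : GMod k q) :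
    (Fam.app (f ≫ g) a).app V = (Fam.app f a).app V ≫ (Fam.app g a).app V := rfl

theorem Fam.app_id (F : Fam k τ q) (a : ℕ+) (V : GMod k q) : (Fam.app (𝟙 F) a).app V = 𝟙 _ := rfl

variable (h : InducedActionWellDefined k q)

theorem act_map_mem_homSpace (G : Fam k none q) (d : ℕ+) {b : ℕ+} {V W : EMod k q b}
    (f : (⟨b, V⟩ : GMod k q) ⟶ ⟨b, W⟩) (τ : Option kˣ) (a : ℕ) :
    (PiTensorProduct.map fun _ => (G.fnMap d f).hom.hom) ∈
      EMod.homSpace (act h (PNat.mul_coe d b) (G (d, b)) V)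
        (act h (PNat.mul_coe d b) (G (d, b)) W) τ a := by
  have h1 := psi_mem_homSpace h τ rfl (PNat.mul_coe d b) (G (d, b)) V W
    (GMod.Hom.mem_homSpace f τ (a * d))
  rwa [psi_map rfl (G (d, b)) _ (GMod.Hom.mem_homSpace f none d)] at h1

/-- The functor `V ↦ G_{d,e}(V)` on modules of all degrees `e`. -/
def Fam.actFn (G : Fam k none q) (d : ℕ+) : GMod k q ⥤ GMod k q where
  obj V := ⟨d * V.deg, act h (PNat.mul_coe d V.deg) (G (d, V.deg)) V.mod⟩
  map {V W} f := by
    refine ⟨((G.fn d).map f).hom.hom, congrArg (d * ·) f.deg_eq, fun a i => ?_, fun a Q => ?_⟩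
    · obtain ⟨b, V⟩ := V
      obtain ⟨b', W⟩ := W
      obtain rfl : b = b' := f.deg_eq
      exact (act_map_mem_homSpace h G d f none a).1 i
    · obtain ⟨b, V⟩ := V
      obtain ⟨b', W⟩ := W
      obtain rfl : b = b' := f.deg_eq
      exact (act_map_mem_homSpace h G d f (some Q) a).2 Q rfl
  map_id V := GMod.hom_ext (congrArg (fun f => f.hom.hom) ((G.fn d).map_id V))
  map_comp f g := GMod.hom_ext (congrArg (fun f => f.hom.hom) ((G.fn d).map_comp f g))

/-- The components of a morphism of families, as homomorphisms of modules. -/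
def Fam.actApp {G G' : Fam k none q} (g : G ⟶ G') (d : ℕ+) : G.actFn h d ⟶ G'.actFn h d where
  app V := GMod.homMk ((Fam.app g d).app V).hom.hom fun τ a =>
    evApp_mem_homSpace h τ a (PNat.mul_coe d V.deg) (g (d, V.deg)) V.mod
  naturality _ _ f := GMod.hom_ext (congrArg (fun f => f.hom.hom) ((Fam.app g d).naturality f))

end GradedModules

/-! ### Composition of families and its associator, summand by summand -/

section GradedComposition

variable {k : Type u} [Field k] {q : kˣ} {τ : Option kˣ}

/-- The elements of `Hom_H(V^{⊗a}, W^{⊗a})` for modules `V`, `W` of the same degree. -/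
structure GMod.PHom (τ : Option kˣ) (a : ℕ) (V W : GMod k q) where
  toLin : TPow k V.mod.carrier a →ₗ[k] TPow k W.mod.carrier a
  deg_eq : V.deg = W.deg
  comm_opRV : ∀ i, 1 ≤ i → i < a → toLin ∘ₗ V.mod.opRV a i = W.mod.opRV a i ∘ₗ toLin
  comm_opKV : ∀ Q ∈ τ, toLin ∘ₗ V.mod.opKV Q a = W.mod.opKV Q a ∘ₗ toLin

theorem GMod.PHom.mem_homSpace {a : ℕ} {b : ℕ+} {V W : EMod k q b}
    (x : GMod.PHom τ a ⟨b, V⟩ ⟨b, W⟩) : x.toLin ∈ EMod.homSpace V W τ a :=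
  ⟨x.comm_opRV, x.comm_opKV⟩

/-- The map `F_{a,b}(V) → F_{a,b}(W)` induced by an element of `Hom_H(V^{⊗a}, W^{⊗a})`. -/
def Fam.fnHom (F : Fam k τ q) (a : ℕ+) : {V W : GMod k q} → GMod.PHom τ a V W →
    ((F.fn a).obj V ⟶ (F.fn a).obj W)
  | ⟨b, V⟩, ⟨b', W⟩, x => by
    obtain rfl : b = b' := x.deg_eq
    exact FGModuleCat.ofHom (evHom (F (a, b)) V W ⟨_, x.mem_homSpace⟩)

/-- Once the degrees are identified, this is functoriality of `F_{a,b}` on a commutative square of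
morphisms between `a`-th tensor powers. -/
theorem Fam.fnHom_square (F : Fam k τ q) (a : ℕ+) {V W V' W' : GMod k q}
    (x : GMod.PHom τ a V W) (x' : GMod.PHom τ a V' W') (f : V ⟶ V') (g : W ⟶ W')
    (hx : (PiTensorProduct.map fun _ => GMod.Hom.toLin g) ∘ₗ x.toLin =
      x'.toLin ∘ₗ PiTensorProduct.map fun _ => GMod.Hom.toLin f) :
    F.fnHom a x ≫ (F.fn a).map g = (F.fn a).map f ≫ F.fnHom a x' := by
  obtain ⟨b, V⟩ := V
  obtain ⟨b', V'⟩ := V'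
  obtain ⟨b1, W⟩ := W
  obtain ⟨b1', W'⟩ := W'
  obtain rfl : b = b' := f.deg_eq
  obtain rfl : b = b1 := x.deg_eq
  obtain rfl : b = b1' := g.deg_eq
  apply FGModuleCat.hom_ext
  refine (evHom_comp (F (a, b)) ⟨_, GMod.Hom.mem_homSpace g τ a⟩ ⟨_, x.mem_homSpace⟩).symm.trans
    (Eq.trans ?_ (evHom_comp (F (a, b)) ⟨_, x'.mem_homSpace⟩ ⟨_, GMod.Hom.mem_homSpace f τ a⟩))
  exact congrArg (evHom (F (a, b)) V W') (Subtype.ext hx)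

/-- A morphism of families from its components. -/
def Fam.mkHom {F F' : Fam k τ q} (φ : ∀ (a : ℕ+) (V : GMod k q), (F.fn a).obj V ⟶ (F'.fn a).obj V)
    (hφ : ∀ (a : ℕ+) {V W : GMod k q} (x : GMod.PHom τ a V W),
      F.fnHom a x ≫ φ a W = φ a V ≫ F'.fnHom a x) : F ⟶ F' := fun s =>
  Pol.mkHom (fun V => (φ s.1 ⟨s.2, V⟩).hom.hom) fun V W x =>
    congrArg (fun f => f.hom.hom) (hφ s.1 (V := ⟨s.2, V⟩) (W := ⟨s.2, W⟩) ⟨x.1, rfl, x.2.1, x.2.2⟩)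

variable {h : InducedActionWellDefined k q} (H : CompositionWellDefined h)

theorem coe_eq_mul {c a d : ℕ+} (hc : c = a * d) : (c : ℕ) = a * d :=
  Factorization.coe_eq ⟨(a, d), hc⟩

section

variable (F : Fam k τ q) (G : Fam k none q) {c : ℕ+}

/-- The map `Ψ`. -/
def GMod.PHom.act {a d : ℕ+} (hc : c = a * d) : {V W : GMod k q} → GMod.PHom τ c V W →
    GMod.PHom τ a ((G.actFn h d).obj V) ((G.actFn h d).obj W)
  | ⟨b, V⟩, ⟨b', W⟩, x => by
    obtain rfl : b = b' := x.deg_eq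
    have hx := H.psi_mem τ (coe_eq_mul hc) (PNat.mul_coe d b) (G (d, b)) V W x.toLin x.mem_homSpace
    exact ⟨psi (coe_eq_mul hc) (G (d, b)) V W x.toLin, rfl, hx.1, hx.2⟩

/-- The inclusion of a summand `F_{a,de} ∘ G_{d,e}` of the composite. -/
def Fam.inc (a d : ℕ+) (hc : c = a * d) (V : GMod k q) :
    (F.fn a).obj ((G.actFn h d).obj V) ⟶ ((famComp H F G).fn c).obj V :=
  FGModuleCat.ofHom (DirectSum.lof k (Factorization c)
    (fun p => (F.fn p.a).obj ((G.actFn h p.d).obj V)) ⟨(a, d), hc⟩)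

/-- The map out of the composite given by maps on the summands. -/
def Fam.desc {V : GMod k q} {M : FGModuleCat.{u} k}
    (φ : ∀ a d : ℕ+, c = a * d → ((F.fn a).obj ((G.actFn h d).obj V) ⟶ M)) :
    ((famComp H F G).fn c).obj V ⟶ M :=
  FGModuleCat.ofHom (DirectSum.toModule k (Factorization c) M fun p => (φ p.a p.d p.2).hom.hom)

variable {F G}

theorem Fam.inc_desc {V : GMod k q} {M : FGModuleCat.{u} k}
    (φ : ∀ a d : ℕ+, c = a * d → ((F.fn a).obj ((G.actFn h d).obj V) ⟶ M)) (a d : ℕ+)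
    (hc : c = a * d) : Fam.inc H F G a d hc V ≫ Fam.desc H F G φ = φ a d hc := by
  apply FGModuleCat.hom_ext
  refine LinearMap.ext fun v => ?_
  exact DirectSum.toModule_lof (M := fun p : Factorization c =>
    (F.fn p.a).obj ((G.actFn h p.d).obj V)) (φ := fun p => (φ p.a p.d p.2).hom.hom) k ⟨(a, d), hc⟩ v

theorem Fam.comp_ext {V : GMod k q} {M : FGModuleCat.{u} k}
    {f g : ((famComp H F G).fn c).obj V ⟶ M}
    (hfg : ∀ (a d : ℕ+) (hc : c = a * d), Fam.inc H F G a d hc V ≫ f = Fam.inc H F G a d hc V ≫ g) :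
    f = g := by
  apply FGModuleCat.hom_ext
  refine DirectSum.linearMap_ext (R := k)
    (M := fun p : Factorization c => (F.fn p.a).obj ((G.actFn h p.d).obj V)) fun p => ?_
  exact congrArg (fun f => f.hom.hom) (hfg p.a p.d p.2)

theorem Fam.inc_fnHom {a d : ℕ+} (hc : c = a * d) {V W : GMod k q} (x : GMod.PHom τ c V W) :
    Fam.inc H F G a d hc V ≫ (famComp H F G).fnHom c x =
      F.fnHom a (x.act H G hc) ≫ Fam.inc H F G a d hc W := by
  obtain ⟨b, V⟩ := V
  obtain ⟨b', W⟩ := W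
  obtain rfl : b = b' := x.deg_eq
  apply FGModuleCat.hom_ext
  refine LinearMap.ext fun v => ?_
  exact DirectSum.lmap_lof (fun p : Factorization c => evHom (comp H p.coe_eq
    (PNat.mul_coe p.d b) (F (p.a, p.d * b)) (G (p.d, b))) V W ⟨_, x.mem_homSpace⟩) ⟨(a, d), hc⟩ v

theorem Fam.inc_fnHom_assoc {a d : ℕ+} (hc : c = a * d) {V W : GMod k q} (x : GMod.PHom τ c V W)
    {M : FGModuleCat.{u} k} (y : ((famComp H F G).fn c).obj W ⟶ M) :
    Fam.inc H F G a d hc V ≫ (famComp H F G).fnHom c x ≫ y =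
      F.fnHom a (x.act H G hc) ≫ Fam.inc H F G a d hc W ≫ y := by
  rw [← Category.assoc, Fam.inc_fnHom, Category.assoc]

theorem Fam.inc_naturality {a d : ℕ+} (hc : c = a * d) {V W : GMod k q} (f : V ⟶ W) :
    Fam.inc H F G a d hc V ≫ ((famComp H F G).fn c).map f =
      (F.fn a).map ((G.actFn h d).map f) ≫ Fam.inc H F G a d hc W := by
  obtain ⟨b, V⟩ := V
  obtain ⟨b', W⟩ := W
  obtain rfl : b = b' := f.deg_eq
  have hf := GMod.Hom.mem_homSpace f τ c
  refine (Fam.inc_fnHom H hc (V := ⟨b, V⟩) (W := ⟨b, W⟩) ⟨_, rfl, hf.1, hf.2⟩).trans ?_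
  refine congrArg (· ≫ Fam.inc H F G a d hc ⟨b, W⟩) ?_
  apply FGModuleCat.hom_ext
  refine congrArg (evHom (F (a, d * b)) _ _) (Subtype.ext ?_)
  exact psi_map (coe_eq_mul hc) (G (d, b)) (GMod.Hom.toLin f) (GMod.Hom.mem_homSpace f none d)

theorem Fam.inc_naturality_assoc {a d : ℕ+} (hc : c = a * d) {V W : GMod k q} (f : V ⟶ W)
    {M : FGModuleCat.{u} k} (y : ((famComp H F G).fn c).obj W ⟶ M) :
    Fam.inc H F G a d hc V ≫ ((famComp H F G).fn c).map f ≫ y =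
      (F.fn a).map ((G.actFn h d).map f) ≫ Fam.inc H F G a d hc W ≫ y := by
  rw [← Category.assoc, Fam.inc_naturality, Category.assoc]

theorem Fam.inc_app_famCompMap {F' : Fam k τ q} {G' : Fam k none q} (f : F ⟶ F') (g : G ⟶ G')
    {a d : ℕ+} (hc : c = a * d) (V : GMod k q) :
    Fam.inc H F G a d hc V ≫ (Fam.app (famCompMap H f g) c).app V =
      (F.fn a).map ((Fam.actApp h g d).app V) ≫
        (Fam.app f a).app ((G'.actFn h d).obj V) ≫ Fam.inc H F' G' a d hc V := by
  apply FGModuleCat.hom_ext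
  refine LinearMap.ext fun v => ?_
  exact DirectSum.lmap_lof (fun p : Factorization c => evApp (compMap H p.coe_eq
    (PNat.mul_coe p.d V.deg) (f (p.a, p.d * V.deg)) (g (p.d, V.deg))) V.mod) ⟨(a, d), hc⟩ v

theorem Fam.inc_app_famCompMap_assoc {F' : Fam k τ q} {G' : Fam k none q} (f : F ⟶ F')
    (g : G ⟶ G') {a d : ℕ+} (hc : c = a * d) (V : GMod k q) {M : FGModuleCat.{u} k}
    (y : ((famComp H F' G').fn c).obj V ⟶ M) :
    Fam.inc H F G a d hc V ≫ (Fam.app (famCompMap H f g) c).app V ≫ y =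
      (F.fn a).map ((Fam.actApp h g d).app V) ≫
        (Fam.app f a).app ((G'.actFn h d).obj V) ≫ Fam.inc H F' G' a d hc V ≫ y := by
  rw [← Category.assoc, Fam.inc_app_famCompMap, Category.assoc, Category.assoc]

end

/-- The two modules have degrees `d(d'e)` and `(dd')e`, which are equal only propositionally.
Commutation is therefore stated operator by operator instead of as membership in `homSpace`. -/
theorem comm_act_act {d d' y e e' N N' : ℕ} (hc : y = d * d') (he : e' = d' * e)
    (hN : N = d * e') (hN' : N' = y * e) (G : Pol k none q d e') (K : Pol k none q d' e)
    (L : Pol k none q y e) (f : comp H hc he G K ⟶ L) (V : EMod k q e) (a : ℕ) :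
    (∀ i, 1 ≤ i → i < a →
      (PiTensorProduct.map fun _ : Fin a => evApp f V) ∘ₗ (act h hN G (act h he K V)).opRV a i =
        (act h hN' L V).opRV a i ∘ₗ PiTensorProduct.map fun _ : Fin a => evApp f V) ∧
    ∀ Q, (PiTensorProduct.map fun _ : Fin a => evApp f V) ∘ₗ
        (act h hN G (act h he K V)).opKV Q a =
      (act h hN' L V).opKV Q a ∘ₗ PiTensorProduct.map fun _ : Fin a => evApp f V := by
  obtain rfl : N = N' := by rw [hN, hN', hc, he, mul_assoc]
  have key : ∀ τ, (PiTensorProduct.map fun _ : Fin a => evApp f V) ∈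
      EMod.homSpace (act h hN G (act h he K V)) (act h hN' L V) τ a := fun τ =>
    EMod.comp_mem_homSpace (evApp_mem_homSpace h τ a hN' f V)
      (id_mem_homSpace_act_act H τ a hc he hN hN' G K V)
  exact ⟨(key none).1, fun Q => (key (some Q)).2 Q rfl⟩

/-- The inclusion of a summand `F_{a,de} ∘ G_{d,e}` of the composite. -/
def Fam.incPol (F : Fam k τ q) (G : Fam k none q) {c a d : ℕ+} (hc : c = a * d) (e : ℕ+) :
    comp H (coe_eq_mul hc) (PNat.mul_coe d e) (F (a, d * e)) (G (d, e)) ⟶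
      famComp H F G (c, e) :=
  Pol.mkHom (fun V => (Fam.inc H F G a d hc ⟨e, V⟩).hom.hom) fun V W x =>
    (congrArg (fun f => f.hom.hom) (Fam.inc_fnHom H (F := F) (G := G) hc (V := ⟨e, V⟩) (W := ⟨e, W⟩)
      ⟨x.1, rfl, x.2.1, x.2.2⟩)).symm

/-- The inclusion `G(K(V)) → (G ∘ K)(V)` of a summand as a homomorphism of modules. -/
def Fam.incMod (G K : Fam k none q) {y : ℕ+} (d d' : ℕ+) (hy : y = d * d') (V : GMod k q) :
    (G.actFn h d).obj ((K.actFn h d').obj V) ⟶ ((famComp H G K).actFn h y).obj V where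
  toLin := (Fam.inc H G K d d' hy V).hom.hom
  deg_eq := (mul_assoc d d' V.deg).symm.trans (congrArg (· * V.deg) hy.symm)
  comm_opRV a := (comm_act_act H (coe_eq_mul hy) (PNat.mul_coe d' V.deg) (PNat.mul_coe d (d' * V.deg))
    (PNat.mul_coe y V.deg) _ _ _ (Fam.incPol H G K hy V.deg) V.mod a).1
  comm_opKV a := (comm_act_act H (coe_eq_mul hy) (PNat.mul_coe d' V.deg) (PNat.mul_coe d (d' * V.deg))
    (PNat.mul_coe y V.deg) _ _ _ (Fam.incPol H G K hy V.deg) V.mod a).2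

theorem Fam.incMod_app_famCompMap {G K G' K' : Fam k none q} (f : G ⟶ G') (g : K ⟶ K') {y d d' : ℕ+}
    (hy : y = d * d') (V : GMod k q) :
    Fam.incMod H G K d d' hy V ≫ (Fam.actApp h (famCompMap H f g) y).app V =
      (G.actFn h d).map ((Fam.actApp h g d').app V) ≫
        (Fam.actApp h f d).app ((K'.actFn h d').obj V) ≫ Fam.incMod H G' K' d d' hy V :=
  GMod.hom_ext (congrArg (fun f => f.hom.hom) (Fam.inc_app_famCompMap H f g hy V))

/-! ### The associator -/

theorem eq_mul_of_eq_mul {c x a d d' y : ℕ+} (hc : c = x * d') (hx : x = a * d) (hy : y = d * d') :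
    c = a * y := by rw [hc, hx, hy, mul_assoc]

section

variable (F : Fam k τ q) (G K : Fam k none q)

/-- The associator `(F ∘ G) ∘ K → F ∘ (G ∘ K)` on a summand `F_{a,y} ∘ G_{d,d'e} ∘ K_{d',e}`. -/
def Fam.assocSummand {c y : ℕ+} (a d d' : ℕ+) (hc : c = a * y) (hy : y = d * d') (V : GMod k q) :
    (F.fn a).obj ((G.actFn h d).obj ((K.actFn h d').obj V)) ⟶
      ((famComp H F (famComp H G K)).fn c).obj V :=
  (F.fn a).map (Fam.incMod H G K d d' hy V) ≫ Fam.inc H F (famComp H G K) a y hc V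

/-- The coherence proofs meet summands whose middle degree equals `d * d'` without being
syntactically that product; this lets the degree be replaced. -/
theorem Fam.assocSummand_eq {c y y' : ℕ+} (a d d' : ℕ+) (hc : c = a * y) (hy : y = d * d')
    (hc' : c = a * y') (hy' : y' = d * d') (V : GMod k q) :
    Fam.assocSummand H F G K a d d' hc hy V = Fam.assocSummand H F G K a d d' hc' hy' V := by
  subst hy hy'
  rfl

/-- The components of the associator. -/
def Fam.assocApp (c : ℕ+) (V : GMod k q) :
    ((famComp H (famComp H F G) K).fn c).obj V ⟶ ((famComp H F (famComp H G K)).fn c).obj V :=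
  Fam.desc H (famComp H F G) K fun _ d' hc => Fam.desc H F G fun a d hx =>
    Fam.assocSummand H F G K a d d' (eq_mul_of_eq_mul hc hx rfl) rfl V

theorem Fam.inc_assocApp {c x a d d' : ℕ+} (hc : c = x * d') (hx : x = a * d) (V : GMod k q) :
    Fam.inc H F G a d hx ((K.actFn h d').obj V) ≫ Fam.inc H (famComp H F G) K x d' hc V ≫
      Fam.assocApp H F G K c V =
    Fam.assocSummand H F G K a d d' (eq_mul_of_eq_mul hc hx rfl) rfl V := by
  rw [Fam.assocApp, Fam.inc_desc, Fam.inc_desc]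

/-- Combines `psi_comp_pol` with naturality of `Ψ` along the inclusion of a summand of `G ∘ K`. -/
theorem Fam.incMod_act {c x a d d' y : ℕ+} (hc : c = x * d') (hx : x = a * d) (hc' : c = a * y)
    (hy : y = d * d') {V W : GMod k q} (z : GMod.PHom τ c V W) :
    (PiTensorProduct.map fun _ : Fin a => (Fam.incMod H G K d d' hy W).toLin) ∘ₗ
        ((z.act H K hc).act H G hx).toLin =
      (z.act H (famComp H G K) hc').toLin ∘ₗ
        PiTensorProduct.map fun _ : Fin a => (Fam.incMod H G K d d' hy V).toLin := by
  obtain ⟨b, V⟩ := V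
  obtain ⟨b', W⟩ := W
  obtain rfl : b = b' := z.deg_eq
  have h1 := H.psi_naturality τ (coe_eq_mul hc') (Fam.incPol H G K hy b) V W z.toLin z.mem_homSpace
  have h2 := psi_comp_pol H τ (coe_eq_mul hc) (coe_eq_mul hx) (coe_eq_mul hc')
    (coe_eq_mul hy) (PNat.mul_coe d' b) (G (d, d' * b)) (K (d', b)) V W z.mem_homSpace
  rw [h2] at h1
  exact h1

theorem Fam.assocSummand_naturality {c x a d d' y : ℕ+} (hc : c = x * d') (hx : x = a * d)
    (hc' : c = a * y) (hy : y = d * d') {V W : GMod k q} (z : GMod.PHom τ c V W) :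
    F.fnHom a ((z.act H K hc).act H G hx) ≫ Fam.assocSummand H F G K a d d' hc' hy W =
      Fam.assocSummand H F G K a d d' hc' hy V ≫ (famComp H F (famComp H G K)).fnHom c z := by
  rw [Fam.assocSummand, Fam.assocSummand, Category.assoc, Fam.inc_fnHom, ← Category.assoc,
    ← Category.assoc, F.fnHom_square a _ _ _ _ (Fam.incMod_act H G K hc hx hc' hy z)]

theorem Fam.assocApp_naturality {c : ℕ+} {V W : GMod k q} (z : GMod.PHom τ c V W) :
    (famComp H (famComp H F G) K).fnHom c z ≫ Fam.assocApp H F G K c W =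
      Fam.assocApp H F G K c V ≫ (famComp H F (famComp H G K)).fnHom c z := by
  refine Fam.comp_ext H fun x d' hc => ?_
  rw [Fam.inc_fnHom_assoc]
  refine Fam.comp_ext H fun a d hx => ?_
  rw [Fam.inc_fnHom_assoc, Fam.inc_assocApp,
    Fam.assocSummand_naturality H F G K hc hx, ← Fam.inc_assocApp H F G K hc hx]
  simp only [Category.assoc]

/-- The associator `(F ∘ G) ∘ K → F ∘ (G ∘ K)`. -/
def Fam.assoc : famComp H (famComp H F G) K ⟶ famComp H F (famComp H G K) :=
  Fam.mkHom (Fam.assocApp H F G K) fun _ _ _ z => Fam.assocApp_naturality H F G K z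

end

section

variable {F F' : Fam k τ q} {G G' K K' : Fam k none q}

theorem Fam.inc_inc_assoc {c x a d d' y : ℕ+} (hc : c = x * d') (hx : x = a * d) (hc' : c = a * y)
    (hy : y = d * d') (V : GMod k q) :
    Fam.inc H F G a d hx ((K.actFn h d').obj V) ≫ Fam.inc H (famComp H F G) K x d' hc V ≫
      (Fam.app (Fam.assoc H F G K) c).app V =
    (F.fn a).map (Fam.incMod H G K d d' hy V) ≫ Fam.inc H F (famComp H G K) a y hc' V :=
  (Fam.inc_assocApp H F G K hc hx V).trans (Fam.assocSummand_eq H F G K a d d' _ rfl hc' hy V)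

theorem Fam.inc_inc_assoc_assoc {c x a d d' y : ℕ+} (hc : c = x * d') (hx : x = a * d)
    (hc' : c = a * y) (hy : y = d * d') (V : GMod k q) {M : FGModuleCat.{u} k}
    (z : ((famComp H F (famComp H G K)).fn c).obj V ⟶ M) :
    Fam.inc H F G a d hx ((K.actFn h d').obj V) ≫ Fam.inc H (famComp H F G) K x d' hc V ≫
      (Fam.app (Fam.assoc H F G K) c).app V ≫ z =
    (F.fn a).map (Fam.incMod H G K d d' hy V) ≫ Fam.inc H F (famComp H G K) a y hc' V ≫ z := by
  have := congrArg (· ≫ z) (Fam.inc_inc_assoc H hc hx hc' hy V)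
  simpa only [Category.assoc] using this

end

end GradedComposition

/-! ### Naturality of the associator and the pentagon -/

section GradedCoherence

variable {k : Type u} [Field k] {q : kˣ} {τ : Option kˣ}

variable {h : InducedActionWellDefined k q} (H : CompositionWellDefined h)

section

variable {F F' : Fam k τ q} {G G' K K' : Fam k none q}

theorem Fam.actApp_id (G : Fam k none q) (d : ℕ+) (V : GMod k q) :
    (Fam.actApp h (𝟙 G) d).app V = 𝟙 _ := rfl

theorem Fam.incMod_incMod_assoc (G K L : Fam k none q) {c x a d d' y : ℕ+} (hc : c = x * d')
    (hx : x = a * d) (hc' : c = a * y) (hy : y = d * d') (V : GMod k q) :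
    Fam.incMod H G K a d hx ((L.actFn h d').obj V) ≫ Fam.incMod H (famComp H G K) L x d' hc V ≫
      (Fam.actApp h (Fam.assoc H G K L) c).app V =
    (G.actFn h a).map (Fam.incMod H K L d d' hy V) ≫ Fam.incMod H G (famComp H K L) a y hc' V :=
  GMod.hom_ext (congrArg (fun f => f.hom.hom) (Fam.inc_inc_assoc H (F := G) (G := K) (K := L) hc hx hc' hy V))

/-- After precomposition with the inclusions of summands, both sides become `F` of a homomorphism of
modules, then a component of `f`, then one inclusion. The module homomorphisms agree by
`incMod_app_famCompMap`. -/
theorem Fam.assoc_naturality (f : F ⟶ F') (g : G ⟶ G') (l : K ⟶ K') :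
    famCompMap H (famCompMap H f g) l ≫ Fam.assoc H F' G' K' =
      Fam.assoc H F G K ≫ famCompMap H f (famCompMap H g l) := by
  refine Fam.hom_ext fun c V => Fam.comp_ext H fun x d' hc => Fam.comp_ext H fun a d hx => ?_
  have hc' := eq_mul_of_eq_mul hc hx rfl
  rw [Fam.app_comp, Fam.app_comp, Fam.inc_app_famCompMap_assoc, Fam.inc_naturality_assoc,
    Fam.inc_app_famCompMap_assoc, Fam.inc_inc_assoc H hc hx hc' rfl,
    Fam.inc_inc_assoc_assoc H hc hx hc' rfl, Fam.inc_app_famCompMap]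
  rw [← (Fam.app f a).naturality_assoc]
  simp only [← Functor.map_comp_assoc, Fam.incMod_app_famCompMap]

/-- On the summand for `c = a d d' d''` both sides are `F` of a homomorphism out of `G(K(L(V)))`
followed by one inclusion. The two homomorphisms agree by `incMod_incMod_assoc`. -/
theorem Fam.pentagon (F : Fam k τ q) (G K L : Fam k none q) :
    famCompMap H (Fam.assoc H F G K) (𝟙 L) ≫ Fam.assoc H F (famComp H G K) L ≫
        famCompMap H (𝟙 F) (Fam.assoc H G K L) =
      Fam.assoc H (famComp H F G) K L ≫ Fam.assoc H F G (famComp H K L) := by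
  refine Fam.hom_ext fun c V => Fam.comp_ext H fun x d'' hc => Fam.comp_ext H fun w d' hx =>
    Fam.comp_ext H fun a d hw => ?_
  have h1 := eq_mul_of_eq_mul hx hw rfl
  have h3 := eq_mul_of_eq_mul hc hx rfl
  have h4 := eq_mul_of_eq_mul h3 hw rfl
  -- Matches the middle degrees arising from the two bracketings.
  have h5 : d * (d' * d'') = d * d' * d'' := (mul_assoc d d' d'').symm
  rw [Fam.app_comp, Fam.app_comp, Fam.app_comp, Fam.inc_app_famCompMap_assoc,
    Fam.inc_inc_assoc_assoc H hc hx h3 rfl, Fam.actApp_id, CategoryTheory.Functor.map_id,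
    Category.id_comp, Fam.inc_inc_assoc_assoc H hx hw h1 rfl,
    Fam.inc_inc_assoc_assoc H hc h1 h4 h5, Fam.inc_app_famCompMap, Fam.inc_naturality_assoc,
    Fam.inc_inc_assoc H h3 hw h4 rfl, Fam.app_id, Category.id_comp]
  simp only [← Functor.map_comp_assoc]
  rw [Fam.incMod_incMod_assoc H G K L h5 rfl rfl rfl]

end

end GradedCoherence

/-! ### Unitors for families and the triangle identity -/

section GradedUnits

variable {k : Type u} [Field k] {q : kˣ} {τ : Option kˣ}

/-- The isomorphism of the component of degree `1` of the unit family with `Id`. -/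
def idFamIso (e : ℕ+) : idPol (k := k) (q := q) (d := (1 : ℕ+)) PNat.one_coe e ≅ idFam (1, e) :=
  eqToIso (by rw [idFam, dif_pos PNat.one_coe])

theorem vanishes_idFam {d e : ℕ+} (hd : d ≠ 1) : Vanishes (idFam (k := k) (q := q) (d, e)) := by
  rw [idFam, dif_neg fun h => hd (PNat.coe_eq_one_iff.1 h)]
  exact vanishes_zeroPol

variable {h : InducedActionWellDefined k q} (H : CompositionWellDefined h)

theorem comm_act_of_idPol (h : InducedActionWellDefined k q) {d e N : ℕ} (hd : d = 1)
    (hN : N = d * e) (L : Pol k none q d e) (f : idPol hd e ⟶ L) (V : EMod k q e) (a : ℕ) :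
    (∀ i, 1 ≤ i → i < a →
      (PiTensorProduct.map fun _ : Fin a => evApp f V) ∘ₗ V.opRV a i =
        (act h hN L V).opRV a i ∘ₗ PiTensorProduct.map fun _ : Fin a => evApp f V) ∧
    ∀ Q, (PiTensorProduct.map fun _ : Fin a => evApp f V) ∘ₗ V.opKV Q a =
      (act h hN L V).opKV Q a ∘ₗ PiTensorProduct.map fun _ : Fin a => evApp f V := by
  obtain rfl : e = N := by rw [hN, hd, one_mul]
  have key : ∀ τ, (PiTensorProduct.map fun _ : Fin a => evApp f V) ∈
      EMod.homSpace V (act h hN L V) τ a := fun τ =>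
    EMod.comp_mem_homSpace (evApp_mem_homSpace h τ a hN f V)
      (id_mem_homSpace_act_idPol h τ a hd hN V)
  exact ⟨(key none).1, fun Q => (key (some Q)).2 Q rfl⟩

variable (h) in
/-- The isomorphism `V → Id(V)` as a homomorphism of modules. -/
def GMod.toId (V : GMod k q) : V ⟶ (idFam.actFn h 1).obj V where
  toLin := evApp (idFamIso V.deg).hom V.mod
  deg_eq := (one_mul V.deg).symm
  comm_opRV a := (comm_act_of_idPol h PNat.one_coe (PNat.mul_coe 1 V.deg) _ (idFamIso V.deg).hom
    V.mod a).1
  comm_opKV a := (comm_act_of_idPol h PNat.one_coe (PNat.mul_coe 1 V.deg) _ (idFamIso V.deg).hom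
    V.mod a).2

theorem GMod.toId_naturality {V W : GMod k q} (f : V ⟶ W) :
    V.toId h ≫ (idFam.actFn h 1).map f = f ≫ W.toId h := by
  obtain ⟨b, V⟩ := V
  obtain ⟨b', W⟩ := W
  obtain rfl : b = b' := f.deg_eq
  refine GMod.hom_ext ?_
  refine (evHom_naturality (idFamIso b).hom ⟨_, GMod.Hom.mem_homSpace f none 1⟩).symm.trans ?_
  exact congrArg (fun g => evApp (idFamIso b).hom W ∘ₗ g)
    (evHom_idPol_map PNat.one_coe (fun _ => f.toLin) _ (0 : Fin 1))

/-- `Ψ` for `Id` is the identity (`psi_idPol`); the rest is naturality of `Ψ` along the isomorphism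
of `Id` with the degree one component of the unit family. -/
theorem toId_act {c : ℕ+} (hc : c = c * 1) {V W : GMod k q} (z : GMod.PHom τ c V W) :
    (PiTensorProduct.map fun _ : Fin c => (W.toId h).toLin) ∘ₗ z.toLin =
      (z.act H idFam hc).toLin ∘ₗ PiTensorProduct.map fun _ : Fin c => (V.toId h).toLin := by
  obtain ⟨b, V⟩ := V
  obtain ⟨b', W⟩ := W
  obtain rfl : b = b' := z.deg_eq
  have h1 := H.psi_naturality τ (coe_eq_mul hc) (idFamIso b).hom V W z.toLin z.mem_homSpace
  have h2 := psi_idPol PNat.one_coe (coe_eq_mul hc) V W z.toLin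
  rw [h2] at h1
  exact h1

theorem eq_mul_one (c : ℕ+) : c = c * 1 := (mul_one c).symm

theorem eq_one_mul (c : ℕ+) : c = 1 * c := (one_mul c).symm

/-- The right unitor `F → F ∘ Id`. -/
def Fam.rightUnit (F : Fam k τ q) : F ⟶ famComp H F idFam :=
  Fam.mkHom (fun c V => (F.fn c).map (V.toId h) ≫ Fam.inc H F idFam c 1 (eq_mul_one c) V)
    fun c V W z => by
      rw [Category.assoc, Fam.inc_fnHom, ← Category.assoc, ← Category.assoc,
        F.fnHom_square c _ _ _ _ (toId_act H (eq_mul_one c) z)]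

theorem Fam.app_rightUnit (F : Fam k τ q) (c : ℕ+) (V : GMod k q) :
    (Fam.app (Fam.rightUnit H F) c).app V =
      (F.fn c).map (V.toId h) ≫ Fam.inc H F idFam c 1 (eq_mul_one c) V := rfl

variable (h) in
/-- The isomorphism `G(V) → Id(G(V))`. -/
def Fam.toIdApp (G : Fam k none q) (c : ℕ+) (V : GMod k q) :
    (G.fn c).obj V ⟶ (idFam.fn 1).obj ((G.actFn h c).obj V) :=
  FGModuleCat.ofHom (((G.actFn h c).obj V).toId h).toLin

theorem Fam.toIdApp_fnHom (G : Fam k none q) {c : ℕ+} (hc : c = 1 * c) {V W : GMod k q}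
    (z : GMod.PHom none c V W) :
    G.fnHom c z ≫ Fam.toIdApp h G c W = Fam.toIdApp h G c V ≫ idFam.fnHom 1 (z.act H G hc) := by
  obtain ⟨b, V⟩ := V
  obtain ⟨b', W⟩ := W
  obtain rfl : b = b' := z.deg_eq
  apply FGModuleCat.hom_ext
  refine Eq.trans ?_ (evHom_naturality (idFamIso (c * b)).hom
    (V := act h (PNat.mul_coe c b) (G (c, b)) V) (W := act h (PNat.mul_coe c b) (G (c, b)) W)
    ⟨_, H.psi_mem none (coe_eq_mul hc) (PNat.mul_coe c b) (G (c, b)) V W z.toLin z.mem_homSpace⟩)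
  refine congrArg (fun g => evApp (idFamIso (c * b)).hom (act h (PNat.mul_coe c b) (G (c, b)) W) ∘ₗ g)
    ?_
  exact (evHom_idPol_comp H PNat.one_coe (coe_eq_mul hc) (PNat.mul_coe c b) (G (c, b))
    ⟨_, z.mem_homSpace⟩).symm

/-- The left unitor `G → Id ∘ G`. -/
def Fam.leftUnit (G : Fam k none q) : G ⟶ famComp H idFam G :=
  Fam.mkHom (fun c V => Fam.toIdApp h G c V ≫ Fam.inc H idFam G 1 c (eq_one_mul c) V)
    fun c V W z => by
      rw [Category.assoc, Fam.inc_fnHom, ← Category.assoc, ← Category.assoc,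
        Fam.toIdApp_fnHom H G (eq_one_mul c)]

theorem Fam.app_leftUnit (G : Fam k none q) (c : ℕ+) (V : GMod k q) :
    (Fam.app (Fam.leftUnit H G) c).app V =
      Fam.toIdApp h G c V ≫ Fam.inc H idFam G 1 c (eq_one_mul c) V := rfl

theorem Fam.rightUnit_naturality {F F' : Fam k τ q} (f : F ⟶ F') :
    Fam.rightUnit H F ≫ famCompMap H f (𝟙 idFam) = f ≫ Fam.rightUnit H F' := by
  refine Fam.hom_ext fun c V => ?_
  rw [Fam.app_comp, Fam.app_comp, Fam.app_rightUnit, Fam.app_rightUnit, Category.assoc,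
    Fam.inc_app_famCompMap, Fam.actApp_id, CategoryTheory.Functor.map_id, Category.id_comp,
    (Fam.app f c).naturality_assoc]

theorem Fam.leftUnit_naturality {G G' : Fam k none q} (g : G ⟶ G') :
    Fam.leftUnit H G ≫ famCompMap H (𝟙 idFam) g = g ≫ Fam.leftUnit H G' := by
  refine Fam.hom_ext fun c V => ?_
  have h1 : Fam.toIdApp h G c V ≫ (idFam.fn 1).map ((Fam.actApp h g c).app V) =
      (Fam.app g c).app V ≫ Fam.toIdApp h G' c V :=
    FGModuleCat.hom_ext (congrArg GMod.Hom.toLin (GMod.toId_naturality (h := h)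
      ((Fam.actApp h g c).app V)))
  rw [Fam.app_comp, Fam.app_comp, Fam.app_leftUnit, Fam.app_leftUnit, Category.assoc,
    Fam.inc_app_famCompMap, Fam.app_id, Category.id_comp, reassoc_of% h1]

theorem Fam.triangle (F : Fam k τ q) (G : Fam k none q) :
    famCompMap H (Fam.rightUnit H F) (𝟙 G) ≫ Fam.assoc H F idFam G =
      famCompMap H (𝟙 F) (Fam.leftUnit H G) := by
  refine Fam.hom_ext fun c V => Fam.comp_ext H fun a d hc => ?_
  -- The left unitor of `G`, seen as a homomorphism of modules, is this composite by construction.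
  have h1 : ((G.actFn h d).obj V).toId h ≫ Fam.incMod H idFam G 1 d (eq_one_mul d) V =
    (Fam.actApp h (Fam.leftUnit H G) d).app V := rfl
  rw [Fam.app_comp, Fam.inc_app_famCompMap_assoc, Fam.actApp_id, CategoryTheory.Functor.map_id,
    Category.id_comp, Fam.app_rightUnit, Category.assoc,
    Fam.inc_inc_assoc H hc (eq_mul_one a) hc (eq_one_mul d), ← Functor.map_comp_assoc, h1,
    Fam.inc_app_famCompMap, Fam.app_id, Category.id_comp]

end GradedUnits

/-! ### Invertibility of the associator and the unitors -/

section GradedIsos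

variable {k : Type u} [Field k] {q : kˣ} {τ : Option kˣ}

theorem FGModuleCat.isIso_of_bijective {M N : FGModuleCat.{u} k} (f : M ⟶ N)
    (hf : Function.Bijective f.hom.hom) : IsIso f := by
  have : IsIso ((forget (FGModuleCat k)).map f) := (isIso_iff_bijective _).2 hf
  exact isIso_of_reflects_iso _ (forget (FGModuleCat k))

theorem FGModuleCat.bijective_of_isIso {M N : FGModuleCat.{u} k} (f : M ⟶ N) [IsIso f] :
    Function.Bijective f.hom.hom :=
  (isIso_iff_bijective ((forget (FGModuleCat k)).map f)).1 inferInstance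

theorem FGModuleCat.eq_of_subsingleton {M N : FGModuleCat.{u} k} (hM : Subsingleton M)
    (f g : M ⟶ N) : f = g := by
  apply FGModuleCat.hom_ext
  refine LinearMap.ext fun v => ?_
  rw [Subsingleton.elim v 0, map_zero, map_zero]

/-- Tensor powers of the inverse map invert the tensor powers of `f`, so commutation with the Hecke
generators passes to the inverse. -/
theorem GMod.isIso_of_bijective {V W : GMod k q} (f : V ⟶ W)
    (hf : Function.Bijective f.toLin) : IsIso f := by
  let φ : V.mod.carrier ≃ₗ[k] W.mod.carrier := LinearEquiv.ofBijective f.toLin hf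
  let ψ : W.mod.carrier →ₗ[k] V.mod.carrier := φ.symm.toLinearMap
  have h1 : ∀ a, (PiTensorProduct.map fun _ : Fin a => ψ) ∘ₗ
      (PiTensorProduct.map fun _ : Fin a => f.toLin) = LinearMap.id := fun a => by
    rw [← PiTensorProduct.map_comp, ← PiTensorProduct.map_id]
    exact congrArg _ (funext fun _ => LinearMap.ext fun v => φ.symm_apply_apply v)
  have h2 : ∀ a, (PiTensorProduct.map fun _ : Fin a => f.toLin) ∘ₗ
      (PiTensorProduct.map fun _ : Fin a => ψ) =
        LinearMap.id := fun a => by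
    rw [← PiTensorProduct.map_comp, ← PiTensorProduct.map_id]
    exact congrArg _ (funext fun _ => LinearMap.ext fun v => φ.apply_symm_apply v)
  have key : ∀ (a : ℕ) (x : Module.End k (TPow k V.mod.carrier a))
      (y : Module.End k (TPow k W.mod.carrier a)),
      (PiTensorProduct.map fun _ => f.toLin) ∘ₗ x = y ∘ₗ (PiTensorProduct.map fun _ => f.toLin) →
      (PiTensorProduct.map fun _ : Fin a => ψ) ∘ₗ y =
        x ∘ₗ PiTensorProduct.map fun _ : Fin a => ψ := by
    intro a x y hxy
    have h3 := congrArg (fun z => (PiTensorProduct.map fun _ : Fin a =>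
      ψ) ∘ₗ z ∘ₗ (PiTensorProduct.map fun _ : Fin a =>
      ψ)) hxy
    simp only [LinearMap.comp_assoc] at h3
    rw [h2, LinearMap.comp_id, ← LinearMap.comp_assoc, h1, LinearMap.id_comp] at h3
    exact h3.symm
  let g : W ⟶ V := ⟨ψ, f.deg_eq.symm, fun a i h1 h2 => key a _ _ (f.comm_opRV a i h1 h2),
    fun a Q => key a _ _ (f.comm_opKV a Q)⟩
  exact ⟨g, GMod.hom_ext (LinearMap.ext fun v => φ.symm_apply_apply v),
    GMod.hom_ext (LinearMap.ext fun v => φ.apply_symm_apply v)⟩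

theorem Fam.isIso {F F' : Fam k τ q} (f : F ⟶ F')
    (hf : ∀ (a : ℕ+) (V : GMod k q), IsIso ((Fam.app f a).app V)) : IsIso f := by
  have h1 : ∀ s, IsIso (f s) := fun s => Pol.isIso_of_bijective (f s) fun V =>
    have := hf s.1 ⟨s.2, V⟩
    FGModuleCat.bijective_of_isIso ((Fam.app f s.1).app ⟨s.2, V⟩)
  exact ⟨fun s => inv (f s), funext fun s => IsIso.hom_inv_id (f s),
    funext fun s => IsIso.inv_hom_id (f s)⟩

variable {h : InducedActionWellDefined k q} (H : CompositionWellDefined h)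

-- Relies on `a ≥ 1`: if `G(V)` is zero then so is its `a`-th tensor power, and its identity
-- morphism is zero before `F` is applied.
include H in
theorem Fam.subsingleton_summand {F : Fam k τ q} {G : Fam k none q} {a d : ℕ+} (V : GMod k q)
    (hFG : Vanishes (F (a, d * V.deg)) ∨ Vanishes (G (d, V.deg))) :
    Subsingleton ((F.fn a).obj ((G.actFn h d).obj V)) := by
  have h1 : Vanishes (comp H (coe_eq_mul (rfl : a * d = a * d)) (PNat.mul_coe d V.deg)
      (F (a, d * V.deg)) (G (d, V.deg))) := by
    by_contra h2
    obtain ⟨h3, h4⟩ := not_vanishes_of_comp H _ _ a.pos _ _ h2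
    tauto
  exact h1 ⟨V.mod⟩

/-- In `c = a * d` the factor `d` determines `a`, so every other summand has `d' ≠ d` and vanishes.
The projection onto the remaining summand is the inverse. -/
theorem Fam.isIso_inc {F : Fam k τ q} {G : Fam k none q} {c a d : ℕ+} (hc : c = a * d)
    (V : GMod k q) (hFG : ∀ a' d' : ℕ+, c = a' * d' → d' ≠ d →
      Vanishes (F (a', d' * V.deg)) ∨ Vanishes (G (d', V.deg))) :
    IsIso (Fam.inc H F G a d hc V) := by
  classical
  have ha : ∀ a' : ℕ+, c = a' * d → a' = a := fun a' h' => mul_right_cancel (h'.symm.trans hc)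
  let r : ((famComp H F G).fn c).obj V ⟶ (F.fn a).obj ((G.actFn h d).obj V) :=
    Fam.desc H F G fun a' d' hc' => if hd : d' = d then
      eqToHom (by subst hd; rw [ha a' hc']) else 0
  have h1 : Fam.inc H F G a d hc V ≫ r = 𝟙 _ := by
    rw [Fam.inc_desc, dif_pos rfl, eqToHom_refl]
  refine ⟨r, h1, Fam.comp_ext H fun a' d' hc' => ?_⟩
  by_cases hd : d' = d
  · subst hd
    obtain rfl := ha a' hc'
    rw [reassoc_of% h1, Category.comp_id]
  · exact FGModuleCat.eq_of_subsingleton (Fam.subsingleton_summand H V (hFG a' d' hc' hd)) _ _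

theorem Fam.isIso_app_of_vanishes {F F' : Fam k τ q} (f : F ⟶ F') (a : ℕ+) (V : GMod k q)
    (hF : Vanishes (F (a, V.deg))) (hF' : Vanishes (F' (a, V.deg))) :
    IsIso ((Fam.app f a).app V) := by
  have h1 : Subsingleton ((F.fn a).obj V) := hF ⟨V.mod⟩
  have h2 : Subsingleton ((F'.fn a).obj V) := hF' ⟨V.mod⟩
  exact ⟨⟨0, FGModuleCat.eq_of_subsingleton h1 _ _, FGModuleCat.eq_of_subsingleton h2 _ _⟩⟩

/-- The defining condition of `AEP` enters here. For a given module `V` of degree `e`, at most one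
pair `(d, d')` has both `G_{d,d'e}` and `K_{d',e}` nonzero. If it occurs in a factorization `c = a d
d'`, every direct sum involved reduces to a single summand, where the associator is a composite of
isomorphisms; otherwise source and target both vanish. -/
theorem Fam.isIso_assoc (F : Fam k τ q) (G K : AEP k q) : IsIso (Fam.assoc H F G.obj K.obj) := by
  refine Fam.isIso _ fun c V => ?_
  by_cases hA : ∃ x a d d' : ℕ+, c = x * d' ∧ x = a * d ∧ ¬ Vanishes (G.obj (d, d' * V.deg)) ∧
    ¬ Vanishes (K.obj (d', V.deg))
  · obtain ⟨x, a, d, d', hc, hx, hG, hK⟩ := hA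
    have hc' := eq_mul_of_eq_mul hc hx rfl
    have e1 : IsIso (Fam.inc H (famComp H F G.obj) K.obj x d' hc V) :=
      Fam.isIso_inc H hc V fun _ d1 _ hd => Or.inr (by
        by_contra h1
        exact hd (K.property _ _ _ h1 hK))
    have e2 : IsIso (Fam.inc H F G.obj a d hx ((K.obj.actFn h d').obj V)) :=
      Fam.isIso_inc H hx _ fun _ d1 _ hd => Or.inr (by
        by_contra h1
        exact hd (G.property _ _ _ h1 hG))
    have e3 : IsIso (Fam.inc H G.obj K.obj d d' rfl V) :=
      Fam.isIso_inc H rfl V fun _ d1 _ hd => Or.inr (by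
        by_contra h1
        exact hd (K.property _ _ _ h1 hK))
    have e4 : IsIso (Fam.incMod H G.obj K.obj d d' rfl V) :=
      GMod.isIso_of_bijective _ (FGModuleCat.bijective_of_isIso (Fam.inc H G.obj K.obj d d' rfl V))
    have e5 : IsIso (Fam.inc H F (famComp H G.obj K.obj) a (d * d') hc' V) :=
      Fam.isIso_inc H hc' V fun _ y _ hy => Or.inr (by
        by_contra h1
        obtain ⟨d1, d1', rfl, hG', hK'⟩ := exists_of_famComp H _ _ _ h1
        obtain rfl := K.property _ _ _ hK' hK
        obtain rfl := G.property _ _ _ hG' hG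
        exact hy rfl)
    have e6 := Fam.inc_inc_assoc H (F := F) (G := G.obj) (K := K.obj) hc hx hc' rfl V
    have e7 : IsIso (Fam.inc H F G.obj a d hx ((K.obj.actFn h d').obj V) ≫
        Fam.inc H (famComp H F G.obj) K.obj x d' hc V ≫
          (Fam.app (Fam.assoc H F G.obj K.obj) c).app V) := by
      rw [e6]; infer_instance
    have e8 := IsIso.of_isIso_comp_left (Fam.inc H F G.obj a d hx ((K.obj.actFn h d').obj V))
      (Fam.inc H (famComp H F G.obj) K.obj x d' hc V ≫
        (Fam.app (Fam.assoc H F G.obj K.obj) c).app V)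
    exact IsIso.of_isIso_comp_left (Fam.inc H (famComp H F G.obj) K.obj x d' hc V) _
  · refine Fam.isIso_app_of_vanishes _ c V ?_ ?_
    · by_contra h1
      obtain ⟨x, d', hc, h2, hK⟩ := exists_of_famComp H _ _ _ h1
      obtain ⟨a, d, hx, -, hG⟩ := exists_of_famComp H _ _ _ h2
      exact hA ⟨x, a, d, d', hc, hx, hG, hK⟩
    · by_contra h1
      obtain ⟨a, y, hc, -, h2⟩ := exists_of_famComp H _ _ _ h1
      obtain ⟨d, d', rfl, hG, hK⟩ := exists_of_famComp H _ _ _ h2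
      exact hA ⟨a * d, a, d, d', hc.trans (mul_assoc a d d').symm, rfl, hG, hK⟩

theorem GMod.bijective_toId (V : GMod k q) : Function.Bijective (V.toId h).toLin := by
  have h1 : IsIso ((idFamIso V.deg).hom.hom.app ⟨V.mod⟩) :=
    (((ObjectProperty.ι _).mapIso (idFamIso V.deg)).app ⟨V.mod⟩).isIso_hom
  exact FGModuleCat.bijective_of_isIso ((idFamIso V.deg).hom.hom.app ⟨V.mod⟩)

theorem Fam.isIso_rightUnit (F : Fam k τ q) : IsIso (Fam.rightUnit H F) := by
  refine Fam.isIso _ fun c V => ?_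
  have e1 := GMod.isIso_of_bijective _ (GMod.bijective_toId (h := h) V)
  have e2 : IsIso (Fam.inc H F idFam c 1 (eq_mul_one c) V) :=
    Fam.isIso_inc H _ V fun _ _ _ hd => Or.inr (vanishes_idFam hd)
  rw [Fam.app_rightUnit]
  infer_instance

theorem Fam.isIso_leftUnit (G : Fam k none q) : IsIso (Fam.leftUnit H G) := by
  refine Fam.isIso _ fun c V => ?_
  have e2 : IsIso (Fam.toIdApp h G c V) := FGModuleCat.isIso_of_bijective _
    (GMod.bijective_toId (h := h) ((G.actFn h c).obj V))
  -- If the second factor differs from `c`, the first one differs from `1`, where the unit family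
  -- vanishes.
  have e4 : IsIso (Fam.inc H idFam G 1 c (eq_one_mul c) V) :=
    Fam.isIso_inc H _ V fun a' d' hc hd => Or.inl (vanishes_idFam fun ha => hd (by
      rw [hc, ha, one_mul]))
  rw [Fam.app_leftUnit]
  infer_instance

end GradedIsos

/-! ### Monoidal categories and right actions from coherent data on a given functor -/

section AbstractAction

open scoped CategoryTheory.Prod

variable {A B : Type*} [Category A] [Category B]

/-- Coherent data for a functor `T : A × A ⥤ A` to be the tensor product of a monoidal category. -/
structure TensorData (T : A × A ⥤ A) (I : A) where
  /-- The associator. -/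
  assoc (X Y Z : A) : T.obj (T.obj (X, Y), Z) ≅ T.obj (X, T.obj (Y, Z))
  /-- The inverse of the left unitor. -/
  left (X : A) : X ≅ T.obj (I, X)
  /-- The inverse of the right unitor. -/
  right (X : A) : X ≅ T.obj (X, I)
  assoc_naturality {X X' Y Y' Z Z' : A} (f : X ⟶ X') (g : Y ⟶ Y') (l : Z ⟶ Z') :
    T.map (X := (T.obj (X, Y), Z)) (Y := (T.obj (X', Y'), Z'))
        (T.map (X := (X, Y)) (Y := (X', Y')) (f ×ₘ g) ×ₘ l) ≫ (assoc X' Y' Z').hom =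
      (assoc X Y Z).hom ≫ T.map (X := (X, T.obj (Y, Z))) (Y := (X', T.obj (Y', Z')))
        (f ×ₘ T.map (X := (Y, Z)) (Y := (Y', Z')) (g ×ₘ l))
  left_naturality {X Y : A} (f : X ⟶ Y) :
    f ≫ (left Y).hom = (left X).hom ≫ T.map (X := (I, X)) (Y := (I, Y)) (𝟙 I ×ₘ f)
  right_naturality {X Y : A} (f : X ⟶ Y) :
    f ≫ (right Y).hom = (right X).hom ≫ T.map (X := (X, I)) (Y := (Y, I)) (f ×ₘ 𝟙 I)
  pentagon (X Y Z W : A) :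
    T.map (X := (T.obj (T.obj (X, Y), Z), W)) (Y := (T.obj (X, T.obj (Y, Z)), W))
        ((assoc X Y Z).hom ×ₘ 𝟙 W) ≫ (assoc X (T.obj (Y, Z)) W).hom ≫
        T.map (X := (X, T.obj (T.obj (Y, Z), W))) (Y := (X, T.obj (Y, T.obj (Z, W))))
          (𝟙 X ×ₘ (assoc Y Z W).hom) =
      (assoc (T.obj (X, Y)) Z W).hom ≫ (assoc X Y (T.obj (Z, W))).hom
  triangle (X Y : A) :
    T.map (X := (X, Y)) (Y := (T.obj (X, I), Y)) ((right X).hom ×ₘ 𝟙 Y) ≫ (assoc X I Y).hom =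
      T.map (X := (X, Y)) (Y := (X, T.obj (I, Y))) (𝟙 X ×ₘ (left Y).hom)

theorem _root_.CategoryTheory.Functor.map_prod_comp {C : Type*} [Category C] (T : B × A ⥤ C)
    {X X' X'' : B} {Y Y' Y'' : A} (f : X ⟶ X') (f' : X' ⟶ X'') (g : Y ⟶ Y') (g' : Y' ⟶ Y'') :
    T.map (X := (X, Y)) (Y := (X', Y')) (f ×ₘ g) ≫
      T.map (X := (X', Y')) (Y := (X'', Y'')) (f' ×ₘ g') =
    T.map (X := (X, Y)) (Y := (X'', Y'')) (f ≫ f' ×ₘ g ≫ g') :=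
  (T.map_comp (X := (X, Y)) (Y := (X', Y')) (Z := (X'', Y'')) (f ×ₘ g) (f' ×ₘ g')).symm

namespace TensorData

variable {T : A × A ⥤ A} {I : A} (D : TensorData T I)

/-- The monoidal category structure of coherent data. -/
@[reducible]
def monoidalCategory : MonoidalCategory A where
  tensorObj X Y := T.obj (X, Y)
  whiskerLeft X {Y Y'} g := T.map (X := (X, Y)) (Y := (X, Y')) (𝟙 X ×ₘ g)
  whiskerRight {X X'} f Y := T.map (X := (X, Y)) (Y := (X', Y)) (f ×ₘ 𝟙 Y)
  tensorHom {X X' Y Y'} f g := T.map (X := (X, Y)) (Y := (X', Y')) (f ×ₘ g)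
  tensorUnit := I
  associator := D.assoc
  leftUnitor X := (D.left X).symm
  rightUnitor X := (D.right X).symm
  tensorHom_def f g := by
    rw [T.map_prod_comp, Category.comp_id, Category.id_comp]
  id_tensorHom_id X Y := T.map_id (X, Y)
  tensorHom_comp_tensorHom f g f' g' := T.map_prod_comp f f' g g'
  whiskerLeft_id X Y := T.map_id (X, Y)
  id_whiskerRight X Y := T.map_id (X, Y)
  associator_naturality f g l := D.assoc_naturality f g l
  leftUnitor_naturality f := by
    rw [Iso.symm_hom, Iso.symm_hom, Iso.eq_inv_comp, ← Category.assoc, ← D.left_naturality,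
      Category.assoc, Iso.hom_inv_id, Category.comp_id]
  rightUnitor_naturality f := by
    rw [Iso.symm_hom, Iso.symm_hom, Iso.eq_inv_comp, ← Category.assoc, ← D.right_naturality,
      Category.assoc, Iso.hom_inv_id, Category.comp_id]
  pentagon := D.pentagon
  triangle X Y := by
    -- The data contain the inverses of the unitors, so the triangle has to be inverted as an
    -- equation between isomorphisms.
    have := congrArg Iso.inv (Iso.ext (D.triangle X Y) :
      T.mapIso (Iso.prod (D.right X) (Iso.refl Y)) ≪≫ D.assoc X I Y =
        T.mapIso (Iso.prod (Iso.refl X) (D.left Y)))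
    exact ((Iso.inv_comp_eq _).1 this).symm

end TensorData

/-- Coherent data for a functor `S : B × A ⥤ B` to be an action of a monoidal category. -/
structure ActionData {T : A × A ⥤ A} {I : A} (D : TensorData T I) (S : B × A ⥤ B) where
  /-- The associator. -/
  assoc (X : B) (Y Z : A) : S.obj (S.obj (X, Y), Z) ≅ S.obj (X, T.obj (Y, Z))
  /-- The inverse of the unitor. -/
  right (X : B) : X ≅ S.obj (X, I)
  assoc_naturality {X X' : B} {Y Y' Z Z' : A} (f : X ⟶ X') (g : Y ⟶ Y') (l : Z ⟶ Z') :
    S.map (X := (S.obj (X, Y), Z)) (Y := (S.obj (X', Y'), Z'))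
        (S.map (X := (X, Y)) (Y := (X', Y')) (f ×ₘ g) ×ₘ l) ≫ (assoc X' Y' Z').hom =
      (assoc X Y Z).hom ≫ S.map (X := (X, T.obj (Y, Z))) (Y := (X', T.obj (Y', Z')))
        (f ×ₘ T.map (X := (Y, Z)) (Y := (Y', Z')) (g ×ₘ l))
  right_naturality {X Y : B} (f : X ⟶ Y) :
    f ≫ (right Y).hom = (right X).hom ≫ S.map (X := (X, I)) (Y := (Y, I)) (f ×ₘ 𝟙 I)
  pentagon (X : B) (Y Z W : A) :
    S.map (X := (S.obj (S.obj (X, Y), Z), W)) (Y := (S.obj (X, T.obj (Y, Z)), W))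
        ((assoc X Y Z).hom ×ₘ 𝟙 W) ≫ (assoc X (T.obj (Y, Z)) W).hom ≫
        S.map (X := (X, T.obj (T.obj (Y, Z), W))) (Y := (X, T.obj (Y, T.obj (Z, W))))
          (𝟙 X ×ₘ (D.assoc Y Z W).hom) =
      (assoc (S.obj (X, Y)) Z W).hom ≫ (assoc X Y (T.obj (Z, W))).hom
  triangle (X : B) (Y : A) :
    S.map (X := (X, Y)) (Y := (S.obj (X, I), Y)) ((right X).hom ×ₘ 𝟙 Y) ≫ (assoc X I Y).hom =
      S.map (X := (X, Y)) (Y := (X, T.obj (I, Y))) (𝟙 X ×ₘ (D.left Y).hom)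
  right_assoc (X : B) (Y : A) :
    (right (S.obj (X, Y))).hom ≫ (assoc X Y I).hom =
      S.map (X := (X, Y)) (Y := (X, T.obj (Y, I))) (𝟙 X ×ₘ (D.right Y).hom)

namespace ActionData

variable {T : A × A ⥤ A} {I : A} {D : TensorData T I} {S : B × A ⥤ B} (E : ActionData D S)

theorem map_assoc_inv {X X' : B} {Y Y' Z Z' : A} (f : X ⟶ X') (g : Y ⟶ Y') (l : Z ⟶ Z') :
    S.map (X := (X, T.obj (Y, Z))) (Y := (X', T.obj (Y', Z')))
        (f ×ₘ T.map (X := (Y, Z)) (Y := (Y', Z')) (g ×ₘ l)) ≫ (E.assoc X' Y' Z').inv =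
      (E.assoc X Y Z).inv ≫ S.map (X := (S.obj (X, Y), Z)) (Y := (S.obj (X', Y'), Z'))
        (S.map (X := (X, Y)) (Y := (X', Y')) (f ×ₘ g) ×ₘ l) := by
  rw [Iso.eq_inv_comp, ← Category.assoc, ← E.assoc_naturality, Category.assoc, Iso.hom_inv_id,
    Category.comp_id]

/-- The right action of coherent data. -/
@[reducible]
def rightAction :
    letI := D.monoidalCategory
    MonoidalCategory.MonoidalRightAction A B :=
  letI := D.monoidalCategory
  { actionObj := fun X Y => S.obj (X, Y)
    actionHomRight := fun X {Y Y'} g => S.map (X := (X, Y)) (Y := (X, Y')) (𝟙 X ×ₘ g)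
    actionHomLeft := fun {X X'} f Y => S.map (X := (X, Y)) (Y := (X', Y)) (f ×ₘ 𝟙 Y)
    actionHom := fun {Y Y' X X'} f g => S.map (X := (X, Y)) (Y := (X', Y')) (f ×ₘ g)
    actionAssocIso := fun X Y Z => (E.assoc X Y Z).symm
    actionUnitIso := fun X => (E.right X).symm
    actionHom_def := fun f g => by
      rw [S.map_prod_comp, Category.comp_id, Category.id_comp]
    actionHomRight_id := fun Y X => S.map_id (X, Y)
    id_actionHomLeft := fun Y X => S.map_id (X, Y)
    actionHom_comp := fun f f' g g' => (S.map_prod_comp f f' g g').symm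
    actionAssocIso_hom_naturality := fun f g l => E.map_assoc_inv f g l
    actionUnitIso_hom_naturality := fun {X X'} f =>
      (Iso.inv_comp_eq _).2 (Eq.trans ((Iso.eq_comp_inv _).2 (E.right_naturality f))
        (Category.assoc _ _ _))
    actionHomRight_whiskerRight := fun {Y Y'} g Z X =>
      Eq.trans ((Iso.eq_comp_inv (E.assoc X Y' Z).symm).2 (E.map_assoc_inv (𝟙 X) g (𝟙 Z)))
        (Category.assoc _ _ _)
    whiskerRight_actionHomLeft := fun Y {Z Z'} g X => by
      have := E.map_assoc_inv (𝟙 X) (𝟙 Y) g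
      rw [← prod_id X Y, S.map_id] at this
      exact Eq.trans ((Iso.eq_comp_inv (E.assoc X Y Z').symm).2 this) (Category.assoc _ _ _)
    actionHom_associator := fun Y Z W X => by
      have := congrArg Iso.inv (Iso.ext (E.pentagon X Y Z W) :
        S.mapIso (Iso.prod (E.assoc X Y Z) (Iso.refl W)) ≪≫ E.assoc X (T.obj (Y, Z)) W ≪≫
          S.mapIso (Iso.prod (Iso.refl X) (D.assoc Y Z W)) =
        E.assoc (S.obj (X, Y)) Z W ≪≫ E.assoc X Y (T.obj (Z, W)))
      exact ((Iso.inv_comp_eq _).1 ((Category.assoc _ _ _).symm.trans this)).symm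
    actionHom_leftUnitor := fun Y X =>
      (congrArg Iso.inv (Iso.ext (E.triangle X Y) :
        S.mapIso (Iso.prod (E.right X) (Iso.refl Y)) ≪≫ E.assoc X I Y =
          S.mapIso (Iso.prod (Iso.refl X) (D.left Y)))).symm
    actionHom_rightUnitor := fun Y X =>
      (congrArg Iso.inv (Iso.ext (E.right_assoc X Y) :
        E.right (S.obj (X, Y)) ≪≫ E.assoc X Y I =
          S.mapIso (Iso.prod (Iso.refl X) (D.right Y)))).symm }

/-- Definitional, because the action on pairs of morphisms is set to be `S.map` and is not assembled
from the one-sided actions. -/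
theorem rightActionFunctor_rightAction :
    letI := D.monoidalCategory
    letI := E.rightAction
    rightActionFunctor A B = S := rfl

end ActionData

theorem TensorData.tensor_monoidalCategory {T : A × A ⥤ A} {I : A} (D : TensorData T I) :
    letI := D.monoidalCategory
    MonoidalCategory.tensor A = T := rfl

end AbstractAction

/-! ### The action pair of extended polynomial functors -/

section ActionPair

open scoped CategoryTheory.Prod

variable {k : Type u} [Field k] {q : kˣ} {τ : Option kˣ}
variable {h : InducedActionWellDefined k q} (H : CompositionWellDefined h)

/-- Supplies `right_assoc`, the compatibility of the associator with the unit in the last place,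
which `MonoidalRightAction` takes as an axiom besides the triangle. -/
theorem Fam.rightUnit_assoc (F : Fam k τ q) (G : Fam k none q) :
    Fam.rightUnit H (famComp H F G) ≫ Fam.assoc H F G idFam =
      famCompMap H (𝟙 F) (Fam.rightUnit H G) := by
  refine Fam.hom_ext fun c V => Fam.comp_ext H fun a d hc => ?_
  have h1 : (G.actFn h d).map (V.toId h) ≫ Fam.incMod H G idFam d 1 (eq_mul_one d) V =
    (Fam.actApp h (Fam.rightUnit H G) d).app V := rfl
  rw [Fam.app_comp, Fam.app_rightUnit, Category.assoc, Fam.inc_naturality_assoc,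
    Fam.inc_inc_assoc H (eq_mul_one c) hc hc (eq_mul_one d), ← Functor.map_comp_assoc, h1,
    Fam.inc_app_famCompMap, Fam.app_id, Category.id_comp]

namespace AEP

theorem comp_map_hom {X Y : AEP k q × AEP k q} (f : X ⟶ Y) :
    ((comp H).map f).hom = famCompMap H f.1.hom f.2.hom := rfl

theorem comp_obj_obj (X : AEP k q × AEP k q) :
    ((comp H).obj X).obj = famComp H X.1.obj X.2.obj := rfl

/-- The associator of `AEP`. -/
def associator (F G K : AEP k q) :
    (comp H).obj ((comp H).obj (F, G), K) ≅ (comp H).obj (F, (comp H).obj (G, K)) :=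
  have := Fam.isIso_assoc H F.obj G K
  let e := asIso (Fam.assoc H F.obj G.obj K.obj)
  ObjectProperty.isoMk _ e

/-- The inverse of the left unitor of `AEP`. -/
def leftUnitor (G : AEP k q) : G ≅ (comp H).obj (unit, G) :=
  have := Fam.isIso_leftUnit H G.obj
  let e := asIso (Fam.leftUnit H G.obj)
  ObjectProperty.isoMk _ e

/-- The inverse of the right unitor of `AEP`. -/
def rightUnitor (F : AEP k q) : F ≅ (comp H).obj (F, unit) :=
  have := Fam.isIso_rightUnit H F.obj
  let e := asIso (Fam.rightUnit H F.obj)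
  ObjectProperty.isoMk _ e

theorem associator_hom_hom (F G K : AEP k q) :
    (associator H F G K).hom.hom = Fam.assoc H F.obj G.obj K.obj := rfl

theorem leftUnitor_hom_hom (G : AEP k q) :
    (leftUnitor H G).hom.hom = Fam.leftUnit H G.obj := rfl

theorem rightUnitor_hom_hom (F : AEP k q) :
    (rightUnitor H F).hom.hom = Fam.rightUnit H F.obj := rfl

theorem unit_obj : (unit : AEP k q).obj = idFam := rfl

/-- The coherent data which make `AEP` a monoidal category with respect to composition. -/
def tensorData : TensorData (AEP.comp H) (AEP.unit (k := k) (q := q)) where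
  assoc := associator H
  left := leftUnitor H
  right := rightUnitor H
  assoc_naturality f g l := by
    refine ObjectProperty.hom_ext _ ?_
    dsimp only [ObjectProperty.FullSubcategory.comp_hom, associator_hom_hom, comp_map_hom,
      comp_obj_obj]
    exact Fam.assoc_naturality H f.hom g.hom l.hom
  left_naturality f := by
    refine ObjectProperty.hom_ext _ ?_
    dsimp only [ObjectProperty.FullSubcategory.comp_hom, leftUnitor_hom_hom, comp_map_hom,
      comp_obj_obj, ObjectProperty.FullSubcategory.id_hom, unit_obj]
    exact (Fam.leftUnit_naturality H f.hom).symm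
  right_naturality f := by
    refine ObjectProperty.hom_ext _ ?_
    dsimp only [ObjectProperty.FullSubcategory.comp_hom, rightUnitor_hom_hom, comp_map_hom,
      comp_obj_obj, ObjectProperty.FullSubcategory.id_hom, unit_obj]
    exact (Fam.rightUnit_naturality H f.hom).symm
  pentagon F G K L := by
    refine ObjectProperty.hom_ext _ ?_
    dsimp only [ObjectProperty.FullSubcategory.comp_hom, associator_hom_hom, comp_map_hom,
      comp_obj_obj, ObjectProperty.FullSubcategory.id_hom]
    exact Fam.pentagon H F.obj G.obj K.obj L.obj
  triangle F G := by
    refine ObjectProperty.hom_ext _ ?_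
    dsimp only [ObjectProperty.FullSubcategory.comp_hom, associator_hom_hom, rightUnitor_hom_hom,
      leftUnitor_hom_hom, comp_map_hom, comp_obj_obj, ObjectProperty.FullSubcategory.id_hom,
      unit_obj]
    exact Fam.triangle H F.obj G.obj

end AEP

namespace EP

variable {Q : kˣ}

theorem comp_map_hom {X Y : EP k Q q × AEP k q} (f : X ⟶ Y) :
    ((comp H).map f).hom = famCompMap H f.1.hom f.2.hom := rfl

theorem comp_obj_obj (X : EP k Q q × AEP k q) :
    ((comp H).obj X).obj = famComp H X.1.obj X.2.obj := rfl

/-- The associator of the action of `AEP` on `EP`. -/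
def associator (F : EP k Q q) (G K : AEP k q) :
    (comp H).obj ((comp H).obj (F, G), K) ≅ (comp H).obj (F, (AEP.comp H).obj (G, K)) :=
  have := Fam.isIso_assoc H F.obj G K
  let e := asIso (Fam.assoc H F.obj G.obj K.obj)
  ObjectProperty.isoMk _ e

/-- The inverse of the unitor of the action of `AEP` on `EP`. -/
def rightUnitor (F : EP k Q q) : F ≅ (comp H).obj (F, AEP.unit) :=
  have := Fam.isIso_rightUnit H F.obj
  let e := asIso (Fam.rightUnit H F.obj)
  ObjectProperty.isoMk _ e

theorem associator_hom_hom (F : EP k Q q) (G K : AEP k q) :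
    (associator H F G K).hom.hom = Fam.assoc H F.obj G.obj K.obj := rfl

theorem rightUnitor_hom_hom (F : EP k Q q) :
    (rightUnitor H F).hom.hom = Fam.rightUnit H F.obj := rfl

/-- The coherent data which make composition an action of `AEP` on `EP`. -/
def actionData : ActionData (AEP.tensorData H) (EP.comp (Q := Q) H) where
  assoc := associator H
  right := rightUnitor H
  assoc_naturality f g l := by
    refine ObjectProperty.hom_ext _ ?_
    dsimp only [ObjectProperty.FullSubcategory.comp_hom, associator_hom_hom, comp_map_hom,
      comp_obj_obj, AEP.comp_map_hom, AEP.comp_obj_obj]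
    exact Fam.assoc_naturality H f.hom g.hom l.hom
  right_naturality f := by
    refine ObjectProperty.hom_ext _ ?_
    dsimp only [ObjectProperty.FullSubcategory.comp_hom, rightUnitor_hom_hom, comp_map_hom,
      comp_obj_obj, ObjectProperty.FullSubcategory.id_hom, AEP.unit_obj]
    exact (Fam.rightUnit_naturality H f.hom).symm
  pentagon F G K L := by
    refine ObjectProperty.hom_ext _ ?_
    dsimp only [ObjectProperty.FullSubcategory.comp_hom, associator_hom_hom, comp_map_hom,
      comp_obj_obj, ObjectProperty.FullSubcategory.id_hom, AEP.tensorData, AEP.associator_hom_hom,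
      AEP.comp_obj_obj]
    exact Fam.pentagon H F.obj G.obj K.obj L.obj
  triangle F G := by
    refine ObjectProperty.hom_ext _ ?_
    dsimp only [ObjectProperty.FullSubcategory.comp_hom, associator_hom_hom, rightUnitor_hom_hom,
      AEP.tensorData, AEP.leftUnitor_hom_hom, comp_map_hom, comp_obj_obj, AEP.comp_obj_obj,
      ObjectProperty.FullSubcategory.id_hom, AEP.unit_obj]
    exact Fam.triangle H F.obj G.obj
  right_assoc F G := by
    refine ObjectProperty.hom_ext _ ?_
    dsimp only [ObjectProperty.FullSubcategory.comp_hom, associator_hom_hom, rightUnitor_hom_hom,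
      AEP.tensorData, AEP.rightUnitor_hom_hom, comp_map_hom, comp_obj_obj, AEP.comp_obj_obj,
      ObjectProperty.FullSubcategory.id_hom, AEP.unit_obj]
    exact Fam.rightUnit_assoc H F.obj G.obj

end EP

end ActionPair

end QPoly

end

theorem mainTheorem8 {k : Type u} [Field k] (Q q : kˣ) :
    ∃ (h : QPoly.InducedActionWellDefined k q) (H : QPoly.CompositionWellDefined h),
      -- homogeneous composition is associative and unital up to isomorphism
      (∀ (τ : Option kˣ) (a d d' e : ℕ) (F : QPoly.Pol k τ q a (d * (d' * e)))
          (G : QPoly.Pol k none q d (d' * e)) (K : QPoly.Pol k none q d' e),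
        Nonempty (QPoly.comp H (c := a * d * d') rfl rfl (QPoly.comp H rfl rfl F G) K ≅
          QPoly.comp H (mul_assoc a d d') (mul_assoc d d' e).symm F (QPoly.comp H rfl rfl G K))) ∧
      (∀ (τ : Option kˣ) (d e : ℕ) (F : QPoly.Pol k τ q d e),
        Nonempty (QPoly.comp H (mul_one d).symm (one_mul e).symm F (QPoly.idPol rfl e) ≅ F)) ∧
      (∀ (d e : ℕ) (G : QPoly.Pol k none q d e),
        Nonempty (QPoly.comp H (one_mul d).symm rfl (QPoly.idPol rfl (d * e)) G ≅ G)) ∧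
      -- composition makes `AEP` a monoidal category, which acts on `EP` by composition
      ∃ _ : MonoidalCategory (QPoly.AEP k q),
        MonoidalCategory.tensor (QPoly.AEP k q) = QPoly.AEP.comp H ∧
        MonoidalCategoryStruct.tensorUnit (QPoly.AEP k q) = QPoly.AEP.unit ∧
        ∃ _ : MonoidalCategory.MonoidalRightAction (QPoly.AEP k q) (QPoly.EP k Q q),
          QPoly.rightActionFunctor (QPoly.AEP k q) (QPoly.EP k Q q) = QPoly.EP.comp H := by
  -- The equalities with the composition functors are definitional, since both structures are built
  -- on these functors.
  refine ⟨QPoly.inducedActionWellDefined k q, QPoly.compositionWellDefined _, ?_, ?_, ?_,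
    (QPoly.AEP.tensorData _).monoidalCategory, (QPoly.AEP.tensorData _).tensor_monoidalCategory,
    rfl, (QPoly.EP.actionData _).rightAction,
    (QPoly.EP.actionData _).rightActionFunctor_rightAction⟩
  · exact fun τ a d d' e F G K => QPoly.nonempty_assoc _ τ rfl rfl (mul_assoc a d d') rfl rfl rfl
      (mul_assoc d d' e).symm F G K
  · exact fun τ d e F => QPoly.nonempty_rightUnit _ rfl (mul_one d).symm (one_mul e).symm F
  · exact fun d e G => QPoly.nonempty_leftUnit _ rfl (one_mul d).symm rfl G
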